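/- Let $n\ge 0$ be an integer, $S$ an arbitrary scheme, and $\mathcal R=\bigoplus_{d\ge 0}\mathcal R_d$ an arbitrary quasi-coherent $\mathbb N$-graded (commutative) $\mathcal O_S$-algebra, with relative homogeneous spectrum $\operatorname{Proj}(\mathcal R)\to S$. For a morphism of schemes $X\to S$ let $\mathcal{H}ilb^n_{X/S}$ denote the contravariant functor from $S$-schemes to sets that sends $T\to S$ to the set of closed subschemes $Z\subseteq T\times_S X$ such that the projection $p\colon Z\to T$ is finite and $p_*\mathcal O_Z$ is a locally free $\mathcal O_T$-module of rank $n$, and that sends a morphism $T'\to T$ of $S$-schemes to the pullback of closed subschemes along $T'\times_S X\to T\times_S X$. For an affine open subscheme $\operatorname{Spec}(A)\subseteq S$, with $R=\Gamma(\operatorname{Spec}(A),\mathcal R)$, and a homogeneous element $f\in R$ of positive degree, let $R_{(f)}$ be the degree zero part of the localization $R_f$, so that $\operatorname{Spec}(R_{(f)})$ is an open subscheme of $\operatorname{Proj}(\mathcal R)$ lying over $\operatorname{Spec}(A)$. Regard $\mathcal{H}ilb^n_{\operatorname{Spec}(R_{(f)})/\operatorname{Spec}(A)}$ as a functor on $S$-schemes,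 by letting it have no $T$-valued points when $T\to S$ does not factor through $\operatorname{Spec}(A)$; a $T$-valued point, being a closed subscheme of $T\times_{\operatorname{Spec}(A)}\operatorname{Spec}(R_{(f)})$ that is finite over $T$, is also a closed subscheme of $T\times_S\operatorname{Proj}(\mathcal R)$, which defines a natural transformation to $\mathcal{H}ilb^n_{\operatorname{Proj}(\mathcal R)/S}$. Then: 1. The functor $\mathcal{H}ilb^n_{\operatorname{Proj}(\mathcal R)/S}$ is representable by a scheme over $S$. 2. For every affine open $\operatorname{Spec}(A)\subseteq S$ and every homogeneous $f\in R$ of positive degree, the functor $\mathcal{H}ilb^n_{\operatorname{Spec}(R_{(f)})/\operatorname{Spec}(A)}$ is representable (on $A$-schemes by an $A$-scheme, and on $S$-schemes by an $S$-scheme), and it is an open subfunctor of $\mathcal{H}ilb^n_{\operatorname{Proj}(\mathcal R)/S}$: the natural transformation above is a monomorphism, and its pullback along any morphism to $\mathcal{H}ilb^n_{\operatorname{Proj}(\mathcal R)/S}$ from the functor represented by an $S$-scheme $T$ is represented by an open immersion into $T$. 3. These open subfunctors cover $\mathcal{H}ilb^n_{\operatorname{Proj}(\mathcal R)/S}$: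 for every $S$-scheme $T$, every $Z\in\mathcal{H}ilb^n_{\operatorname{Proj}(\mathcal R)/S}(T)$ and every point $t\in T$ there are an open neighbourhood $V\subseteq T$ of $t$, an affine open $\operatorname{Spec}(A)\subseteq S$ and a homogeneous $f\in R$ of positive degree such that the restriction of $Z$ to $V$ lies in $\mathcal{H}ilb^n_{\operatorname{Spec}(R_{(f)})/\operatorname{Spec}(A)}(V)$. -/

import Mathlib

universe u

open CategoryTheory Limits TopologicalSpace Opposite AlgebraicGeometry Graded

noncomputable section

namespace HilbertPoints

/-- A sheaf of commutative `𝒪_S`-algebras on a scheme `S`: a sheaf of commutative rings with a ring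
map from the structure sheaf. -/
structure AlgebraSheaf (S : Scheme.{u}) where
  ring : TopCat.Presheaf CommRingCat.{u} S
  isSheaf : ring.IsSheaf
  unit : S.presheaf ⟶ ring

namespace AlgebraSheaf
variable {S : Scheme.{u}} (R : AlgebraSheaf S)

/-- Sections over `U`. -/
abbrev sec (U : S.Opens) : CommRingCat.{u} := R.ring.obj (.op U)

/-- Restriction of sections. -/
abbrev res {V U : S.Opens} (h : V ≤ U) : R.sec U →+* R.sec V := (R.ring.map (homOfLE h).op).hom

/-- The structure map on sections over `U`. -/
abbrev str (U : S.Opens) : Γ(S, U) →+* R.sec U := (R.unit.app (.op U)).hom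

/-- The underlying sheaf of `𝒪_S`-modules: restriction of scalars along the structure map. -/
def toModules : S.Modules :=
  (SheafOfModules.restrictScalars
    (R := S.ringCatSheaf)
    (R' := (sheafCompose _ (forget₂ CommRingCat RingCat.{u})).obj ⟨R.ring, R.isSheaf⟩)
    ⟨Functor.whiskerRight R.unit (forget₂ CommRingCat RingCat.{u})⟩).obj (SheafOfModules.unit _)

lemma res_str {V U : S.Opens} (h : V ≤ U) (a : Γ(S, U)) :
    R.res h (R.str U a) = R.str V (S.presheaf.map (homOfLE h).op a) :=
  (congr($(R.unit.naturality (homOfLE h).op) a)).symm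

lemma fromSpec_image_le {U : S.Opens} (hU : IsAffineOpen U) (V : (Spec Γ(S, U)).Opens) :
    hU.fromSpec ''ᵁ V ≤ U := by
  conv_rhs => rw [← hU.opensRange_fromSpec]
  exact hU.fromSpec.image_le_opensRange V

lemma smul_eq {U : S.Opens} (hU : IsAffineOpen U) (V : (Spec Γ(S, U)).Opens)
    (r : Γ(S, U)) (x : R.sec (hU.fromSpec ''ᵁ V)) :
    (show R.sec (hU.fromSpec ''ᵁ V) from
     (r • (show (modulesSpecToSheaf.obj (R.toModules.restrict hU.fromSpec)).obj.obj (.op V) from x)))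
     = R.str _ (S.presheaf.map (homOfLE (fromSpec_image_le hU V)).op r) * x := by
  have h0 : hU.fromSpec.appLE U V (by rw [hU.fromSpec_preimage_self]; exact le_top) =
      (Scheme.ΓSpecIso Γ(S, U)).inv ≫ (Spec Γ(S, U)).presheaf.map (homOfLE le_top).op := by
    rw [Scheme.Hom.appLE, hU.fromSpec_app_self, Category.assoc, ← Functor.map_comp]
    rfl
  have h2 : (hU.fromSpec.appIso V).inv ((Spec Γ(S, U)).presheaf.map (homOfLE le_top).op
      ((Scheme.ΓSpecIso Γ(S, U)).inv r)) =
      (S.presheaf.map (homOfLE (fromSpec_image_le hU V)).op r) := by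
    have h1 := Scheme.Hom.appLE_appIso_inv hU.fromSpec (U := U) (V := V)
      (by rw [hU.fromSpec_preimage_self]; exact le_top)
    rw [h0] at h1
    exact congr($h1 r)
  rw [← h2]
  rfl

lemma loc_aux (h : R.toModules.IsQuasicoherent) {U : S.Opens} (hU : IsAffineOpen U) (f : Γ(S, U))
    (W₁ W₂ : S.Opens) (e₁ : U = W₁) (e₂ : S.basicOpen f = W₂) (h12 : W₂ ≤ W₁) :
    (∀ y : R.sec W₂, ∃ (n : ℕ) (x : R.sec W₁),
      R.str _ (S.presheaf.map (homOfLE (e₂ ▸ S.basicOpen_le f : W₂ ≤ U)).op f) ^ n * y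
        = R.res h12 x) ∧
    (∀ x y : R.sec W₁, R.res h12 x = R.res h12 y →
      ∃ n : ℕ, R.str _ (S.presheaf.map (homOfLE e₁.ge).op f) ^ n * x =
        R.str _ (S.presheaf.map (homOfLE e₁.ge).op f) ^ n * y) := by
  have h1 : IsIso (R.toModules.restrict hU.fromSpec).fromTildeΓ := inferInstance
  rw [isIso_fromTildeΓ_iff_isLocalizing] at h1
  have h2 := h1 f
  obtain rfl : W₁ = hU.fromSpec ''ᵁ ⊤ := by
    rw [← e₁, Scheme.Hom.image_top_eq_opensRange, hU.opensRange_fromSpec]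
  obtain rfl : W₂ = hU.fromSpec ''ᵁ (PrimeSpectrum.basicOpen f) := by
    rw [← e₂, ← hU.fromSpec_image_basicOpen]
  constructor
  · intro y
    obtain ⟨⟨x, ⟨_, n, rfl⟩⟩, hx⟩ := h2.surj y
    refine ⟨n, x, ?_⟩
    rw [← map_pow, ← map_pow]
    exact (smul_eq R hU _ (f ^ n) y).symm.trans hx
  · intro x y hxy
    obtain ⟨⟨_, n, rfl⟩, hx⟩ := h2.exists_of_eq hxy
    refine ⟨n, ?_⟩
    rw [← map_pow, ← map_pow]
    exact (smul_eq R hU _ (f ^ n) x).symm.trans (hx.trans (smul_eq R hU _ (f ^ n) y))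

lemma isUnit_res_str {U : S.Opens} (f : Γ(S, U)) :
    IsUnit (R.res (S.basicOpen_le f) (R.str U f)) := by
  rw [res_str]
  exact (RingedSpace.isUnit_res_basicOpen _ f).map _

lemma loc_surj (h : R.toModules.IsQuasicoherent) {U : S.Opens} (hU : IsAffineOpen U) (f : Γ(S, U))
    (y : R.sec (S.basicOpen f)) : ∃ (n : ℕ) (x : R.sec U),
      R.res (S.basicOpen_le f) (R.str U f) ^ n * y = R.res (S.basicOpen_le f) x := by
  obtain ⟨H1, H2⟩ := loc_aux R h hU f U _ rfl rfl (S.basicOpen_le f)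
  rw [res_str]
  exact H1 y

lemma loc_eq (h : R.toModules.IsQuasicoherent) {U : S.Opens} (hU : IsAffineOpen U) (f : Γ(S, U))
    (x : R.sec U) (hx : R.res (S.basicOpen_le f) x = 0) : ∃ n : ℕ, R.str U f ^ n * x = 0 := by
  obtain ⟨H1, H2⟩ := loc_aux R h hU f U _ rfl rfl (S.basicOpen_le f)
  obtain ⟨n, hn⟩ := H2 x 0 (by simpa using hx)
  refine ⟨n, ?_⟩
  rw [mul_zero] at hn
  convert hn
  simp
end AlgebraSheaf

lemma isOpenImmersion_of_isLocalIso {X Y : Scheme.{u}} (f : X ⟶ Y) [IsLocalIso f]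
    (hf : Function.Injective f) : IsOpenImmersion f := by
  have hop : UniversallyOpen f := by
    have hf' : IsLocalIso f := ‹_›
    rw [IsLocalIso.eq_sourceLocalClosure_isOpenImmersion] at hf'
    obtain ⟨𝒰, h⟩ := hf'
    rw [IsZariskiLocalAtSource.iff_of_openCover 𝒰 (P := @UniversallyOpen)]
    intro i
    have := h i
    infer_instance
  have hst (x : X) : IsIso (f.stalkMap x) := by
    obtain ⟨U, hxU, hU⟩ := IsLocalIso.exists_isOpenImmersion (f := f) x
    let y : U.toScheme := ⟨x, hxU⟩
    have h1 : IsIso (f.stalkMap (U.ι y) ≫ U.ι.stalkMap y) := by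
      rw [← Scheme.Hom.stalkMap_comp]
      exact (IsOpenImmersion.iff_isIso_stalkMap.mp hU).2 y
    exact IsIso.of_isIso_comp_right (f.stalkMap (U.ι y)) (U.ι.stalkMap y)
  exact IsOpenImmersion.of_isIso_stalkMap f
    (.of_continuous_injective_isOpenMap f.continuous hf f.isOpenMap)

section ProjLocalization

variable {A B : Type u} [CommRing A] [CommRing B] {𝒜 : ℕ → AddSubgroup A} {ℬ : ℕ → AddSubgroup B}
  [GradedRing 𝒜] [GradedRing ℬ]

/-- The graded ring map `φ` is the localization at powers of the element `a` of degree zero. -/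
structure IsDegreeZeroLocalization (φ : 𝒜 →+*ᵍ ℬ) (a : A) : Prop where
  mem : a ∈ 𝒜 0
  isUnit : IsUnit (φ a)
  surj : ∀ y : B, ∃ (n : ℕ) (x : A), φ a ^ n * y = φ x
  zero : ∀ x : A, φ x = 0 → ∃ n : ℕ, a ^ n * x = 0

namespace IsDegreeZeroLocalization

variable {φ : 𝒜 →+*ᵍ ℬ} {a : A}

lemma pow_mul_mem (h : IsDegreeZeroLocalization φ a) (n : ℕ) {d : ℕ} {x : A} (hx : x ∈ 𝒜 d) :
    a ^ n * x ∈ 𝒜 d := by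
  have := SetLike.mul_mem_graded (SetLike.pow_mem_graded n h.mem) hx
  simpa using this

lemma pow_mul_mem' (h : IsDegreeZeroLocalization φ a) (n : ℕ) {d : ℕ} {y : B} (hy : y ∈ ℬ d) :
    φ a ^ n * y ∈ ℬ d := by
  have := SetLike.mul_mem_graded (SetLike.pow_mem_graded n (map_mem φ h.mem)) hy
  simpa using this

lemma surj_of_mem (h : IsDegreeZeroLocalization φ a) {d : ℕ} {y : B} (hy : y ∈ ℬ d) :
    ∃ (n : ℕ) (x : A), x ∈ 𝒜 d ∧ φ a ^ n * y = φ x := by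
  obtain ⟨n, x, hx⟩ := h.surj y
  refine ⟨n, DirectSum.decompose 𝒜 x d, SetLike.coe_mem _, ?_⟩
  rw [φ.map_directSumDecompose, ← hx]
  exact (DirectSum.decompose_of_mem_same ℬ (h.pow_mul_mem' n hy)).symm

lemma irrelevant_le (h : IsDegreeZeroLocalization φ a) :
    HomogeneousIdeal.irrelevant ℬ ≤ (HomogeneousIdeal.irrelevant 𝒜).map φ := by
  change (HomogeneousIdeal.irrelevant ℬ).toIdeal ≤ ((HomogeneousIdeal.irrelevant 𝒜).map φ).toIdeal
  refine (HomogeneousIdeal.toIdeal_irrelevant_le _).mpr fun i hi y hy ↦ ?_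
  obtain ⟨n, x, hx, e⟩ := h.surj_of_mem hy
  obtain ⟨b, hb⟩ := (h.isUnit.pow n).exists_left_inv
  have : y = b * φ x := by rw [← e, ← mul_assoc, hb, one_mul]
  rw [this]
  refine Ideal.mul_mem_left _ _ (Ideal.mem_map_of_mem φ ?_)
  rw [HomogeneousIdeal.mem_iff]
  exact HomogeneousIdeal.mem_irrelevant_of_mem _ hi hx

lemma exists_inv (h : IsDegreeZeroLocalization φ a) : ∃ b ∈ ℬ 0, φ a * b = 1 := by
  obtain ⟨b, hb⟩ := h.isUnit.exists_right_inv
  refine ⟨DirectSum.decompose ℬ b 0, SetLike.coe_mem _, ?_⟩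
  have := DirectSum.coe_decompose_mul_of_left_mem_zero ℬ (b := b) (j := 0) (map_mem φ h.mem)
  rw [← this, hb]
  exact DirectSum.decompose_of_mem_same ℬ SetLike.GradedOne.one_mem

lemma isLocalization_away (h : IsDegreeZeroLocalization φ a) {d : ℕ} {s : A} (hs : s ∈ 𝒜 d) :
    letI := (HomogeneousLocalization.Away.map φ s).toAlgebra
    IsLocalization.Away (HomogeneousLocalization.fromZeroRingHom 𝒜 (.powers s) ⟨a, h.mem⟩)
      (HomogeneousLocalization.Away ℬ (φ s)) := by
  let := (HomogeneousLocalization.Away.map φ s).toAlgebra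
  set r := HomogeneousLocalization.fromZeroRingHom 𝒜 (.powers s) ⟨a, h.mem⟩ with hr
  have hr' : r = HomogeneousLocalization.Away.mk 𝒜 hs 0 a (by simpa using h.mem) := by
    apply HomogeneousLocalization.val_injective
    simp [hr, HomogeneousLocalization.fromZeroRingHom, HomogeneousLocalization.Away.mk]
    rfl
  have hmap : algebraMap _ (HomogeneousLocalization.Away ℬ (φ s)) r =
      HomogeneousLocalization.Away.mk ℬ (map_mem φ hs) 0 (φ a)
        (by simpa using map_mem φ h.mem) := by
    rw [hr', RingHom.algebraMap_toAlgebra, HomogeneousLocalization.Away.map_mk]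
  have hpow (n : ℕ) : r ^ n = HomogeneousLocalization.Away.mk 𝒜 hs 0 (a ^ n)
      (by simpa using h.pow_mul_mem n (SetLike.GradedOne.one_mem (A := 𝒜))) := by
    apply HomogeneousLocalization.val_injective
    simp [hr', HomogeneousLocalization.Away.val_mk, Localization.mk_pow]
  refine (isLocalization_iff _ _).mpr ?_
  refine ⟨?_, ?_, ?_⟩
  · rintro ⟨_, n, rfl⟩
    simp only [map_pow]
    refine IsUnit.pow n ?_
    obtain ⟨b, hb, e⟩ := h.exists_inv
    refine IsUnit.of_mul_eq_one (HomogeneousLocalization.Away.mk ℬ (map_mem φ hs) 0 b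
      (by simpa using hb)) ?_
    rw [hmap]
    apply HomogeneousLocalization.val_injective
    simp [HomogeneousLocalization.Away.val_mk, Localization.mk_mul, e]
  · intro z
    obtain ⟨k, y, hy, rfl⟩ := HomogeneousLocalization.Away.mk_surjective ℬ (map_mem φ hs) z
    obtain ⟨n, x, hx, e⟩ := h.surj_of_mem hy
    refine ⟨⟨HomogeneousLocalization.Away.mk 𝒜 hs k x hx, ⟨_, n, rfl⟩⟩, ?_⟩
    simp only [map_pow, hmap]
    rw [RingHom.algebraMap_toAlgebra, HomogeneousLocalization.Away.map_mk]
    apply HomogeneousLocalization.val_injective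
    simp [HomogeneousLocalization.Away.val_mk, Localization.mk_mul, Localization.mk_pow, ← e,
      mul_comm]
  · suffices H : ∀ x, algebraMap _ (HomogeneousLocalization.Away ℬ (φ s)) x = 0 →
        ∃ n : ℕ, r ^ n * x = 0 by
      intro x y hxy
      obtain ⟨n, hn⟩ := H (x - y) (by rw [map_sub, hxy, sub_self])
      refine ⟨⟨_, n, rfl⟩, ?_⟩
      rwa [mul_sub, sub_eq_zero] at hn
    intro x hx
    obtain ⟨k, x, hx', rfl⟩ := HomogeneousLocalization.Away.mk_surjective 𝒜 hs x
    rw [RingHom.algebraMap_toAlgebra, HomogeneousLocalization.Away.map_mk] at hx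
    replace hx := congr(HomogeneousLocalization.val $hx)
    rw [HomogeneousLocalization.Away.val_mk, HomogeneousLocalization.val_zero,
      Localization.mk_eq_mk', IsLocalization.mk'_eq_zero_iff] at hx
    obtain ⟨⟨_, m, rfl⟩, hm⟩ := hx
    obtain ⟨n, hn⟩ := h.zero (s ^ m * x) (by simpa using hm)
    refine ⟨n, ?_⟩
    rw [hpow]
    apply HomogeneousLocalization.val_injective
    rw [HomogeneousLocalization.val_mul, HomogeneousLocalization.Away.val_mk,
      HomogeneousLocalization.Away.val_mk, HomogeneousLocalization.val_zero, Localization.mk_mul,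
      Localization.mk_eq_mk', IsLocalization.mk'_eq_zero_iff]
    exact ⟨⟨_, m, rfl⟩, by rw [← hn]; ring⟩

lemma isOpenImmersion_away (h : IsDegreeZeroLocalization φ a) {d : ℕ} {s : A} (hs : s ∈ 𝒜 d) :
    IsOpenImmersion (Spec.map (CommRingCat.ofHom (HomogeneousLocalization.Away.map φ s))) := by
  let := (HomogeneousLocalization.Away.map φ s).toAlgebra
  have := h.isLocalization_away hs
  exact IsOpenImmersion.of_isLocalization
    (HomogeneousLocalization.fromZeroRingHom 𝒜 (.powers s) ⟨a, h.mem⟩)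

lemma injective_map (h : IsDegreeZeroLocalization φ a) :
    Function.Injective (Proj.map φ h.irrelevant_le) := by
  have key (p : Proj ℬ) (y : B) {n : ℕ} {x : A} (e : φ a ^ n * y = φ x) :
      y ∈ p.asHomogeneousIdeal ↔ x ∈ (Proj.map φ h.irrelevant_le p).asHomogeneousIdeal := by
    change _ ↔ φ x ∈ p.asHomogeneousIdeal
    rw [← e, ← HomogeneousIdeal.mem_iff, ← HomogeneousIdeal.mem_iff]
    exact (Ideal.unit_mul_mem_iff_mem _ (h.isUnit.pow n)).symm
  intro p q hpq
  apply ProjectiveSpectrum.ext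
  ext y
  obtain ⟨n, x, e⟩ := h.surj y
  rw [HomogeneousIdeal.mem_iff, HomogeneousIdeal.mem_iff, key p y e, key q y e, hpq]

lemma isLocalIso_away_map (h : IsDegreeZeroLocalization φ a) {d : ℕ} (hd : 0 < d) {s : A}
    (hs : s ∈ 𝒜 d) : IsLocalIso (Proj.awayι ℬ (φ s) (map_mem φ hs) hd ≫
        Proj.map φ h.irrelevant_le) := by
  have := h.isOpenImmersion_away hs
  rw [Proj.awayι_comp_map φ h.irrelevant_le hd s hs]
  exact ⟨fun x ↦ ⟨⊤, trivial, inferInstance⟩⟩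

lemma isOpenImmersion_map (h : IsDegreeZeroLocalization φ a) :
    IsOpenImmersion (Proj.map φ h.irrelevant_le) := by
  have hloc : IsLocalIso (Proj.map φ h.irrelevant_le) := by
    rw [IsZariskiLocalAtSource.iff_of_openCover (P := @IsLocalIso)
      (Proj.mapAffineOpenCover φ h.irrelevant_le).openCover]
    intro s
    exact h.isLocalIso_away_map s.1.2 s.2.2
  exact isOpenImmersion_of_isLocalIso _ h.injective_map

end IsDegreeZeroLocalization
end ProjLocalization

/-- A quasi-coherent graded `𝒪_S`-algebra: a sheaf of `𝒪_S`-algebras whose underlying module is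
quasi-coherent, with subsheaves `piece · d` of additive groups, for `d : ℕ`, such that `𝒪_S` maps to
degree `0`, degrees add under multiplication, and the algebra is the direct sum of its pieces. The
last condition is stated on sections over affine opens. Being closed under multiplication by
degree `0`, the pieces are subsheaves of `𝒪_S`-modules. -/
structure QCohGradedAlgebra (S : Scheme.{u}) extends AlgebraSheaf S where
  isQuasicoherent : toAlgebraSheaf.toModules.IsQuasicoherent
  piece (U : S.Opens) : ℕ → AddSubgroup (toAlgebraSheaf.sec U)
  res_mem {V U : S.Opens} (h : V ≤ U) {d : ℕ} {x : toAlgebraSheaf.sec U} :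
    x ∈ piece U d → toAlgebraSheaf.res h x ∈ piece V d
  mem_of_local (U : S.Opens) (d : ℕ) (x : toAlgebraSheaf.sec U) :
    (∀ p ∈ U, ∃ (V : S.Opens) (h : V ≤ U), p ∈ V ∧ toAlgebraSheaf.res h x ∈ piece V d) →
      x ∈ piece U d
  str_mem (U : S.Opens) (a : Γ(S, U)) : toAlgebraSheaf.str U a ∈ piece U 0
  mul_mem {U : S.Opens} {d e : ℕ} {x y : toAlgebraSheaf.sec U} :
    x ∈ piece U d → y ∈ piece U e → x * y ∈ piece U (d + e)
  isInternal {U : S.Opens} : IsAffineOpen U → DirectSum.IsInternal (piece U)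

namespace QCohGradedAlgebra

variable {S : Scheme.{u}} (R : QCohGradedAlgebra S)

instance gradedRing (U : S.AffineZariskiSite) : GradedRing (R.piece U.1) where
  one_mem := by simpa using R.str_mem U.1 1
  mul_mem _ _ _ _ hx hy := R.mul_mem hx hy
  __ := (R.isInternal U.2).chooseDecomposition

/-- Restriction as a homomorphism of graded rings. -/
def resHom {V U : S.AffineZariskiSite} (h : V ≤ U) : R.piece U.1 →+*ᵍ R.piece V.1 where
  __ := R.res (Scheme.AffineZariskiSite.toOpens_mono h)
  map_mem hx := R.res_mem _ hx

@[simp]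
lemma resHom_apply {V U : S.AffineZariskiSite} (h : V ≤ U) (x : R.sec U.1) :
    R.resHom h x = R.res (Scheme.AffineZariskiSite.toOpens_mono h) x := rfl

lemma resHom_refl (U : S.AffineZariskiSite) : R.resHom (le_refl U) = .id _ := by
  ext x
  change (R.ring.map (𝟙 _)).hom x = x
  simp

lemma resHom_comp {W V U : S.AffineZariskiSite} (h : W ≤ V) (h' : V ≤ U) :
    (R.resHom h).comp (R.resHom h') = R.resHom (h.trans h') := by
  ext x
  change (R.ring.map _ ≫ R.ring.map _).hom x = _
  rw [← Functor.map_comp]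
  rfl

lemma isDegreeZeroLocalization (U : S.AffineZariskiSite) (f : Γ(S, U.1)) :
    IsDegreeZeroLocalization (R.resHom (U.basicOpen_le f)) (R.str U.1 f) where
  mem := R.str_mem _ _
  isUnit := R.isUnit_res_str f
  surj := R.loc_surj R.isQuasicoherent U.2 f
  zero := R.loc_eq R.isQuasicoherent U.2 f

lemma exists_isDegreeZeroLocalization {V U : S.AffineZariskiSite} (h : V ≤ U) :
    ∃ f : Γ(S, U.1), S.basicOpen f = V.1 ∧
      IsDegreeZeroLocalization (R.resHom h) (R.str U.1 f) := by
  obtain ⟨f, hf⟩ := h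
  obtain rfl : U.basicOpen f = V := Subtype.ext hf
  exact ⟨f, rfl, R.isDegreeZeroLocalization U f⟩

lemma irrelevant_le {V U : S.AffineZariskiSite} (h : V ≤ U) :
    HomogeneousIdeal.irrelevant (R.piece V.1) ≤
      (HomogeneousIdeal.irrelevant (R.piece U.1)).map (R.resHom h) :=
  (R.exists_isDegreeZeroLocalization h).choose_spec.2.irrelevant_le

/-- The map of `Proj` induced by restriction to a basic open of an affine open. -/
def projRes {V U : S.AffineZariskiSite} (h : V ≤ U) :
    Proj (R.piece V.1) ⟶ Proj (R.piece U.1) :=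
  Proj.map (R.resHom h) (R.irrelevant_le h)

lemma projMap_congr {A B : Type u} [CommRing A] [CommRing B] {𝒜 : ℕ → AddSubgroup A}
    {ℬ : ℕ → AddSubgroup B} [GradedRing 𝒜] [GradedRing ℬ] {φ ψ : 𝒜 →+*ᵍ ℬ} (e : φ = ψ)
    (h : HomogeneousIdeal.irrelevant ℬ ≤ (HomogeneousIdeal.irrelevant 𝒜).map φ)
    (h' : HomogeneousIdeal.irrelevant ℬ ≤ (HomogeneousIdeal.irrelevant 𝒜).map ψ) :
    Proj.map φ h = Proj.map ψ h' := by
  subst e; rfl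

/-- The schemes `Proj Γ(U, 𝓡)`, for `U` affine open in `S`. -/
def projFunctor : S.AffineZariskiSite ⥤ Scheme.{u} where
  obj U := Proj (R.piece U.1)
  map f := R.projRes f.le
  map_id U := (projMap_congr (R.resHom_refl U) _ (by simp)).trans Proj.map_id
  map_comp f g := by
    rw [projRes, projRes, projRes, ← Proj.map_comp]
    exact projMap_congr (R.resHom_comp f.le g.le).symm _ _

/-- The structure map to the degree zero part. -/
def strZero (U : S.Opens) [GradedRing (R.piece U)] : Γ(S, U) →+* R.piece U 0 :=
  (R.str U).codRestrict (SetLike.GradeZero.subring (R.piece U)) (R.str_mem U)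

/-- The structure morphism `Proj Γ(U, 𝓡) ⟶ Spec Γ(U, 𝒪_S)`. -/
def projToSpec (U : S.AffineZariskiSite) : Proj (R.piece U.1) ⟶ Spec Γ(S, U.1) :=
  Proj.toSpecZero (R.piece U.1) ≫ Spec.map (CommRingCat.ofHom (R.strZero U.1))

lemma awayι_projToSpec (U : S.AffineZariskiSite) {d : ℕ} {s : R.sec U.1} (hs : s ∈ R.piece U.1 d)
    (hd : 0 < d) : Proj.awayι (R.piece U.1) s hs hd ≫ R.projToSpec U =
      Spec.map (CommRingCat.ofHom ((HomogeneousLocalization.fromZeroRingHom (R.piece U.1)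
        (.powers s)).comp (R.strZero U.1))) := by
  rw [projToSpec, Proj.awayι_toSpecZero_assoc, ← Spec.map_comp]
  rfl

lemma away_map_strZero {V U : S.AffineZariskiSite} (h : V ≤ U) (s : R.sec U.1) :
    (HomogeneousLocalization.Away.map (R.resHom h) s).comp
      ((HomogeneousLocalization.fromZeroRingHom (R.piece U.1) (.powers s)).comp (R.strZero U.1)) =
    ((HomogeneousLocalization.fromZeroRingHom (R.piece V.1) (.powers (R.resHom h s))).comp
      (R.strZero V.1)).comp
      (S.presheaf.map (homOfLE (Scheme.AffineZariskiSite.toOpens_mono h)).op).hom := by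
  ext x
  have e : R.resHom h (R.str U.1 x) = R.str V.1
      ((S.presheaf.map (homOfLE (Scheme.AffineZariskiSite.toOpens_mono h)).op).hom x) :=
    R.res_str _ _
  change Localization.mk (R.resHom h (R.str U.1 x)) _ = Localization.mk (R.str V.1 _) _
  rw [e]
  congr 1
  exact Subtype.ext (map_one _)

lemma awayι_projRes_projToSpec {V U : S.AffineZariskiSite} (h : V ≤ U) {d : ℕ} {s : R.sec U.1}
    (hs : s ∈ R.piece U.1 d) (hd : 0 < d) :
    Proj.awayι (R.piece V.1) (R.resHom h s) (map_mem (R.resHom h) hs) hd ≫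
      R.projRes h ≫ R.projToSpec U =
    Proj.awayι (R.piece V.1) (R.resHom h s) (map_mem (R.resHom h) hs) hd ≫ R.projToSpec V ≫
      Spec.map (S.presheaf.map (homOfLE (Scheme.AffineZariskiSite.toOpens_mono h)).op) := by
  rw [projRes, Proj.awayι_comp_map_assoc _ _ hd s hs, awayι_projToSpec,
    reassoc_of% R.awayι_projToSpec V (map_mem (R.resHom h) hs) hd, ← Spec.map_comp,
    ← Spec.map_comp]
  congr 1
  ext1
  exact R.away_map_strZero h s

lemma projRes_projToSpec {V U : S.AffineZariskiSite} (h : V ≤ U) :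
    R.projRes h ≫ R.projToSpec U = R.projToSpec V ≫
      Spec.map (S.presheaf.map (homOfLE (Scheme.AffineZariskiSite.toOpens_mono h)).op) :=
  (Proj.mapAffineOpenCover _ (R.irrelevant_le h)).openCover.hom_ext _ _ fun s ↦
    R.awayι_projRes_projToSpec h s.2.2 s.1.2

instance {V U : S.AffineZariskiSite} (h : V ≤ U) : IsOpenImmersion (R.projRes h) :=
  (R.exists_isDegreeZeroLocalization h).choose_spec.2.isOpenImmersion_map

lemma awayι_mem_range_projRes (U : S.AffineZariskiSite) (f : Γ(S, U.1)) {d : ℕ} {s : R.sec U.1}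
    (hs : s ∈ R.piece U.1 d) (hd : 0 < d)
    (x : Spec (.of (HomogeneousLocalization.Away (R.piece U.1) s)))
    (hp : (Proj.awayι (R.piece U.1) s hs hd ≫ R.projToSpec U) x ∈ PrimeSpectrum.basicOpen f) :
    Proj.awayι (R.piece U.1) s hs hd x ∈ Set.range (R.projRes (U.basicOpen_le f)) := by
  rw [awayι_projToSpec] at hp
  have h := R.isDegreeZeroLocalization U f
  let := (HomogeneousLocalization.Away.map (R.resHom (U.basicOpen_le f)) s).toAlgebra
  have := h.isLocalization_away hs
  have hx : x ∈ Set.range (PrimeSpectrum.comap (algebraMap _ (HomogeneousLocalization.Away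
      (R.piece (U.basicOpen f).1) (R.resHom (U.basicOpen_le f) s)))) := by
    rw [PrimeSpectrum.localization_away_comap_range _
      (HomogeneousLocalization.fromZeroRingHom (R.piece U.1) (.powers s) ⟨R.str U.1 f, h.mem⟩)]
    exact hp
  obtain ⟨y, rfl⟩ := hx
  refine ⟨Proj.awayι _ _ (map_mem (R.resHom (U.basicOpen_le f)) hs) hd y, ?_⟩
  exact congr($(Proj.awayι_comp_map _ (R.irrelevant_le (U.basicOpen_le f)) hd s hs) y)

lemma mem_range_projRes (U : S.AffineZariskiSite) (f : Γ(S, U.1)) (p : Proj (R.piece U.1))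
    (hp : R.projToSpec U p ∈ PrimeSpectrum.basicOpen f) :
    p ∈ Set.range (R.projRes (U.basicOpen_le f)) := by
  obtain ⟨s, x, rfl⟩ := (Proj.affineOpenCover (R.piece U.1)).openCover.exists_eq p
  exact R.awayι_mem_range_projRes U f s.2.2 s.1.2 x hp

lemma isOpenImmersion_specRes {V U : S.AffineZariskiSite} (h : V ≤ U) : IsOpenImmersion
    (Spec.map (S.presheaf.map (homOfLE (Scheme.AffineZariskiSite.toOpens_mono h)).op)) := by
  have := U.2.map_fromSpec V.2 (homOfLE (Scheme.AffineZariskiSite.toOpens_mono h)).op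
  have : IsOpenImmersion (Spec.map (S.presheaf.map
      (homOfLE (Scheme.AffineZariskiSite.toOpens_mono h)).op) ≫ U.2.fromSpec) := by
    rw [this]; infer_instance
  exact IsOpenImmersion.of_comp _ U.2.fromSpec

lemma isPullback_projRes {V U : S.AffineZariskiSite} (h : V ≤ U) :
    IsPullback (R.projRes h) (R.projToSpec V) (R.projToSpec U)
      (Spec.map (S.presheaf.map (homOfLE (Scheme.AffineZariskiSite.toOpens_mono h)).op)) := by
  have := isOpenImmersion_specRes h
  refine (IsOpenImmersion.isPullback _ _ _ _ (R.projRes_projToSpec h) ?_).flip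
  obtain ⟨f, hf⟩ := h
  obtain rfl : U.basicOpen f = V := Subtype.ext hf
  ext p
  constructor
  · rintro ⟨y, hy⟩
    refine R.mem_range_projRes U f p ?_
    have hu : IsUnit ((S.presheaf.map (homOfLE (S.basicOpen_le f)).op).hom f) :=
      RingedSpace.isUnit_res_basicOpen _ f
    rw [← hy]
    exact fun h ↦ y.2.ne_top (Ideal.eq_top_of_isUnit_mem _ h hu)
  · rintro ⟨q, rfl⟩
    exact ⟨_, congr($(R.projRes_projToSpec (U.basicOpen_le f)) q).symm⟩

/-- The structure morphisms are compatible with restriction. -/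
def projToSpecNatTrans : R.projFunctor ⟶
    Scheme.AffineZariskiSite.toOpensFunctor S ⋙ S.presheaf.rightOp ⋙ Scheme.Spec where
  app U := R.projToSpec U
  naturality _ _ f := R.projRes_projToSpec f.le

/-- The schemes `Proj Γ(U, 𝓡)` over the affine opens `U` of `S` form a gluing datum. -/
def gluingData : (Scheme.AffineZariskiSite.directedCover S).RelativeGluingData where
  functor := R.projFunctor
  natTrans := R.projToSpecNatTrans ≫ (Scheme.AffineZariskiSite.restrictIsoSpec S).inv
  equifibered := by
    have : IsIso (Scheme.AffineZariskiSite.restrictIsoSpec S).inv := Iso.isIso_inv _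
    exact NatTrans.Equifibered.comp (fun _ _ f ↦ R.isPullback_projRes f.le)
      (@NatTrans.Equifibered.of_isIso _ _ _ _ _ _ _ this)

instance : (R.gluingData.functor ⋙ Scheme.forget).IsLocallyDirected :=
  Scheme.Cover.RelativeGluingData.instIsLocallyDirectedI₀CompFunctorForgetOfIsThin ..

/-- The relative `Proj` of a quasi-coherent graded algebra, glued from the schemes `Proj Γ(U, 𝓡)`. -/
def proj : Scheme.{u} := R.gluingData.glued

/-- The structure morphism of the relative `Proj`. -/
def projToBase : R.proj ⟶ S := R.gluingData.toBase

/-- The open immersion of `Proj Γ(U, 𝓡)` in the relative `Proj`. -/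
def projChart (U : S.AffineZariskiSite) : Proj (R.piece U.1) ⟶ R.proj :=
  R.gluingData.cover.f U

lemma isPullback_projChart (U : S.AffineZariskiSite) :
    IsPullback (R.projChart U) (R.projToSpec U) R.projToBase U.2.fromSpec := by
  refine (R.gluingData.isPullback_natTrans_ι_toBase U).flip.of_iso (.refl _) (.refl _)
    U.2.isoSpec (.refl _) ?_ ?_ ?_ ?_
  · change 𝟙 _ ≫ R.projChart U = R.projChart U ≫ 𝟙 _
    simp
  · change (R.projToSpec U ≫ U.2.isoSpec.inv) ≫ U.2.isoSpec.hom = 𝟙 _ ≫ R.projToSpec U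
    simp
  · change R.projToBase ≫ 𝟙 _ = 𝟙 _ ≫ R.projToBase
    simp
  · change U.1.ι ≫ 𝟙 _ = U.2.isoSpec.hom ≫ U.2.fromSpec
    rw [← U.2.isoSpec_inv_ι, Iso.hom_inv_id_assoc, Category.comp_id]

instance (U : S.AffineZariskiSite) : IsOpenImmersion (R.projChart U) :=
  MorphismProperty.of_isPullback (R.isPullback_projChart U).flip inferInstance

instance (U : S.AffineZariskiSite) : IsSeparated (R.projToSpec U) := by
  unfold projToSpec; infer_instance

instance : IsSeparated R.projToBase := by
  rw [IsZariskiLocalAtTarget.iff_of_openCover (P := @IsSeparated)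
    (Scheme.AffineZariskiSite.directedCover S)]
  intro U
  have h := R.gluingData.isPullback_natTrans_ι_toBase U
  have : IsSeparated (R.gluingData.natTrans.app U) :=
    inferInstanceAs (IsSeparated (R.projToSpec U ≫ U.2.isoSpec.inv))
  have key : IsSeparated (h.flip.isoPullback.inv ≫ R.gluingData.natTrans.app U) := inferInstance
  rw [h.flip.isoPullback_inv_snd] at key
  exact key

/-- The structure morphism `Spec R_(f) ⟶ Spec A` for `R = Γ(U, 𝓡)`, `A = Γ(U, 𝒪_S)`, `f : R`. -/
def awayToSpec (U : S.AffineZariskiSite) (f : R.sec U.1) :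
    Spec (.of (HomogeneousLocalization.Away (R.piece U.1) f)) ⟶ Spec Γ(S, U.1) :=
  Spec.map (CommRingCat.ofHom ((HomogeneousLocalization.fromZeroRingHom (R.piece U.1)
    (.powers f)).comp (R.strZero U.1)))

/-- The open immersion of `Spec R_(f)` in the relative `Proj`, for `f` homogeneous of positive
degree. -/
def awayToProj (U : S.AffineZariskiSite) {d : ℕ} {f : R.sec U.1} (hf : f ∈ R.piece U.1 d)
    (hd : 0 < d) : Spec (.of (HomogeneousLocalization.Away (R.piece U.1) f)) ⟶ R.proj :=
  Proj.awayι (R.piece U.1) f hf hd ≫ R.projChart U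

instance (U : S.AffineZariskiSite) {d : ℕ} {f : R.sec U.1} (hf : f ∈ R.piece U.1 d)
    (hd : 0 < d) : IsOpenImmersion (R.awayToProj U hf hd) := by
  unfold awayToProj; infer_instance

lemma awayToProj_projToBase (U : S.AffineZariskiSite) {d : ℕ} {f : R.sec U.1}
    (hf : f ∈ R.piece U.1 d) (hd : 0 < d) :
    R.awayToProj U hf hd ≫ R.projToBase = R.awayToSpec U f ≫ U.2.fromSpec := by
  rw [awayToProj, Category.assoc, (R.isPullback_projChart U).w, reassoc_of% awayι_projToSpec]
  rfl

end QCohGradedAlgebra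

lemma bijective_of_isPushout {A B A' B' : CommRingCat.{u}} {f : A ⟶ B} {g : A ⟶ A'} {g' : B ⟶ B'}
    {f' : A' ⟶ B'} (h : IsPushout f g g' f') {n : ℕ} (e : Fin n → B)
    (he : Function.Bijective fun a : Fin n → A ↦ ∑ i, f (a i) * e i) :
    Function.Bijective fun a : Fin n → A' ↦ ∑ i, f' (a i) * g' (e i) := by
  algebraize [f.hom, g.hom, g'.hom, f'.hom, (f ≫ g').hom]
  have : IsScalarTower A A' B' := .of_algebraMap_eq' congr(($h.w).hom)
  have : IsScalarTower A B B' := .of_algebraMap_eq' rfl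
  have hP : Algebra.IsPushout A A' B B' := CommRingCat.isPushout_iff_isPushout.mp h.flip
  let φ : (Fin n → A) ≃ₗ[A] B := .ofBijective
    { toFun a := ∑ i, f (a i) * e i
      map_add' a b := by simp [add_mul, Finset.sum_add_distrib]
      map_smul' r a := by
        simp [Finset.mul_sum, Algebra.smul_def, mul_assoc]; rfl } he
  let b : Module.Basis (Fin n) A B := .ofEquivFun φ.symm
  have hb (i) : b i = e i := by
    simp [b, φ, Module.Basis.coe_ofEquivFun, Pi.single_apply,
      apply_ite f, ite_mul]
  let b' := hP.out.basis b
  convert b'.equivFun.symm.bijective using 2 with a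
  rw [Module.Basis.equivFun_symm_apply]
  refine Finset.sum_congr rfl fun i _ ↦ ?_
  rw [Algebra.smul_def, IsBaseChange.basis_apply, hb]
  rfl

/-- `π_* 𝒪_Z` is a locally free `𝒪_T`-module of rank `n`: locally on `T` there are `n` sections
of `π_* 𝒪_Z` which induce an isomorphism from the `n`-fold power of the structure sheaf. -/
def IsLocallyFreeOfRank (n : ℕ) {Z T : Scheme.{u}} (π : Z ⟶ T) : Prop :=
  ∀ t : T, ∃ U : T.Opens, t ∈ U ∧ ∃ e : Fin n → Γ(Z, π ⁻¹ᵁ U), ∀ (V : T.Opens) (h : V ≤ U),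
    Function.Bijective fun a : Fin n → Γ(T, V) ↦
      ∑ i, π.app V (a i) * Z.presheaf.map (homOfLE (π.preimage_mono h)).op (e i)

section

variable {Z T : Scheme.{u}} (π : Z ⟶ T) {n : ℕ} {U : T.Opens} (e : Fin n → Γ(Z, π ⁻¹ᵁ U))

/-- The map from the `n`-fold power of the structure sheaf to `π_* 𝒪_Z` given by sections `e`. -/
def combination {V : T.Opens} (h : V ≤ U) (a : Fin n → Γ(T, V)) : Γ(Z, π ⁻¹ᵁ V) :=
  ∑ i, π.app V (a i) * Z.presheaf.map (homOfLE (π.preimage_mono h)).op (e i)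

lemma combination_res {V W : T.Opens} (h : V ≤ U) (h' : W ≤ V) (a : Fin n → Γ(T, V)) :
    combination π e (h'.trans h) (fun i ↦ T.presheaf.map (homOfLE h').op (a i)) =
      Z.presheaf.map (homOfLE (π.preimage_mono h')).op (combination π e h a) := by
  simp only [combination, map_sum, map_mul]
  refine Finset.sum_congr rfl fun i _ ↦ ?_
  congr 1
  · exact congr($(π.naturality (homOfLE h').op) (a i))
  · rw [← CommRingCat.comp_apply, ← Functor.map_comp]; rfl

lemma le_iSup_affine (V : T.Opens) :
    V ≤ ⨆ W : {W : T.Opens // IsAffineOpen W ∧ W ≤ V}, W.1 := by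
  intro x hx
  obtain ⟨_, ⟨W, hW, rfl⟩, hxW, hWV⟩ :=
    T.isBasis_affineOpens.exists_subset_of_mem_open hx V.isOpen
  exact Opens.mem_iSup.mpr ⟨⟨W, hW, hWV⟩, hxW⟩

lemma injective_combination
    (H : ∀ {V : T.Opens} (h : V ≤ U), IsAffineOpen V → Function.Injective (combination π e h))
    {V : T.Opens} (h : V ≤ U) : Function.Injective (combination π e h) := by
  intro a b hab
  funext i
  refine T.sheaf.eq_of_locally_eq' _ V (fun W ↦ homOfLE W.2.2) (le_iSup_affine V) _ _ fun W ↦ ?_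
  exact congr_fun (H (W.2.2.trans h) W.2.1 (((combination_res π e h W.2.2 a).trans
    congr(Z.presheaf.map _ $hab)).trans (combination_res π e h W.2.2 b).symm)) i

lemma bijective_combination
    (H : ∀ {V : T.Opens} (h : V ≤ U), IsAffineOpen V → Function.Bijective (combination π e h))
    {V : T.Opens} (h : V ≤ U) : Function.Bijective (combination π e h) := by
  have inj {V : T.Opens} (h : V ≤ U) : Function.Injective (combination π e h) :=
    injective_combination π e (fun h h' ↦ (H h h').1) h
  refine ⟨inj h, fun z ↦ ?_⟩
  choose a ha using fun W : {W : T.Opens // IsAffineOpen W ∧ W ≤ V} ↦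
    (H (W.2.2.trans h) W.2.1).2 (Z.presheaf.map (homOfLE (π.preimage_mono W.2.2)).op z)
  have hc (i) (W W' : {W : T.Opens // IsAffineOpen W ∧ W ≤ V}) :
      T.presheaf.map (homOfLE (inf_le_left : W.1 ⊓ W'.1 ≤ W.1)).op (a W i) =
        T.presheaf.map (homOfLE (inf_le_right : W.1 ⊓ W'.1 ≤ W'.1)).op (a W' i) := by
    refine congr_fun (inj (inf_le_left.trans (W.2.2.trans h))
      (a₁ := fun i ↦ T.presheaf.map (homOfLE (inf_le_left : W.1 ⊓ W'.1 ≤ W.1)).op (a W i))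
      (a₂ := fun i ↦ T.presheaf.map (homOfLE (inf_le_right : W.1 ⊓ W'.1 ≤ W'.1)).op (a W' i)) ?_) i
    refine (combination_res π e (W.2.2.trans h) inf_le_left (a W)).trans
      (.trans ?_ (combination_res π e (W'.2.2.trans h) inf_le_right (a W')).symm)
    rw [ha, ha, ← CommRingCat.comp_apply, ← CommRingCat.comp_apply, ← Functor.map_comp,
      ← Functor.map_comp]
    rfl
  choose b hb using fun i ↦ (T.sheaf.existsUnique_gluing'
    (fun W : {W : T.Opens // IsAffineOpen W ∧ W ≤ V} ↦ W.1) V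
    (fun W ↦ homOfLE W.2.2) (le_iSup_affine V) (fun W ↦ a W i) (hc i)).exists
  refine ⟨b, Z.sheaf.eq_of_locally_eq' (fun W : {W : T.Opens // IsAffineOpen W ∧ W ≤ V} ↦
    π ⁻¹ᵁ W.1) _ (fun W ↦ homOfLE (π.preimage_mono W.2.2)) ?_ _ _ fun W ↦ ?_⟩
  · intro x hx
    obtain ⟨W, hW⟩ := Opens.mem_iSup.mp (le_iSup_affine V hx)
    exact Opens.mem_iSup.mpr ⟨W, hW⟩
  · refine (combination_res π e h W.2.2 b).symm.trans (.trans ?_ (ha W))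
    congr 1
    funext i
    exact hb i W

end

lemma IsLocallyFreeOfRank.of_isPullback {Z T Z' T' : Scheme.{u}} {π : Z ⟶ T} {g : T' ⟶ T}
    {g' : Z' ⟶ Z} {π' : Z' ⟶ T'} [IsAffineHom π] (H : IsPullback g' π' π g) {n : ℕ}
    (h : IsLocallyFreeOfRank n π) : IsLocallyFreeOfRank n π' := by
  intro t'
  obtain ⟨U, hU, e, he⟩ := h (g t')
  obtain ⟨_, ⟨U₀, hU₀, rfl⟩, htU₀, hU₀U⟩ :=
    T.isBasis_affineOpens.exists_subset_of_mem_open hU U.isOpen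
  let e₀ (i : Fin n) : Γ(Z, π ⁻¹ᵁ U₀) := Z.presheaf.map (homOfLE (π.preimage_mono hU₀U)).op (e i)
  have hle {V : T'.Opens} (hV : V ≤ g ⁻¹ᵁ U₀) : π' ⁻¹ᵁ V ≤ g' ⁻¹ᵁ π ⁻¹ᵁ U₀ := by
    rw [← Scheme.Hom.comp_preimage, H.w]
    exact π'.preimage_mono hV
  refine ⟨g ⁻¹ᵁ U₀, htU₀, fun i ↦ g'.appLE _ _ (hle le_rfl) (e₀ i), fun V hV ↦ ?_⟩
  refine bijective_combination π' _ (fun {V} hV hVa ↦ ?_) hV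
  have hp := (isIso_pushoutSection_iff H hV le_rfl (UX := π ⁻¹ᵁ U₀) (UY := π' ⁻¹ᵁ V)
    (inf_eq_right.mpr (hle hV)).symm).mp
      (isIso_pushoutSection_of_isAffineOpen _ _ _ _ hU₀ hVa (hU₀.preimage π))
  have := bijective_of_isPushout hp e₀ (by
    rw [Scheme.Hom.appLE_eq_app]
    exact he U₀ hU₀U)
  convert this using 2 with a
  refine Finset.sum_congr rfl fun i _ ↦ ?_
  congr 1
  · rw [Scheme.Hom.appLE_eq_app]
  · rw [← CommRingCat.comp_apply, Scheme.Hom.appLE_map]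

/-- The `T`-valued points of the Hilbert functor of `n` points of `p : X ⟶ S`, for `t : T ⟶ S`:
closed subschemes `Z` of `T ×_S X`, given by their ideal sheaves, that are finite over `T` and such
that the direct image of `𝒪_Z` is a locally free `𝒪_T`-module of rank `n`. -/
@[ext]
structure HilbPoints (n : ℕ) {X S T : Scheme.{u}} (p : X ⟶ S) (t : T ⟶ S) : Type u where
  ideal : (pullback t p).IdealSheafData
  isFinite : IsFinite (ideal.subschemeι ≫ pullback.fst t p)
  isLocallyFree : IsLocallyFreeOfRank n (ideal.subschemeι ≫ pullback.fst t p)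

/-- The map `T' ×_S X ⟶ T ×_S X` induced by a morphism `g : T' ⟶ T` over `S`. -/
def baseChangeMap {X S T T' : Scheme.{u}} (p : X ⟶ S) {t : T ⟶ S} {t' : T' ⟶ S} (g : T' ⟶ T)
    (e : g ≫ t = t') : pullback t' p ⟶ pullback t p :=
  pullback.lift (pullback.fst t' p ≫ g) (pullback.snd t' p)
    (by rw [Category.assoc, e, pullback.condition])

section

variable {X S T T' T'' : Scheme.{u}} (p : X ⟶ S) {t : T ⟶ S} {t' : T' ⟶ S} {t'' : T'' ⟶ S}
  (g : T' ⟶ T) (e : g ≫ t = t') (g' : T'' ⟶ T') (e' : g' ≫ t' = t'')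

@[simp]
lemma baseChangeMap_fst : baseChangeMap p g e ≫ pullback.fst t p = pullback.fst t' p ≫ g :=
  pullback.lift_fst _ _ _

@[simp]
lemma baseChangeMap_snd : baseChangeMap p g e ≫ pullback.snd t p = pullback.snd t' p :=
  pullback.lift_snd _ _ _

lemma baseChangeMap_id (e : 𝟙 T ≫ t = t) : baseChangeMap p (𝟙 T) e = 𝟙 _ := by
  apply pullback.hom_ext <;> simp

lemma baseChangeMap_comp (e'' : (g' ≫ g) ≫ t = t'') :
    baseChangeMap p (g' ≫ g) e'' = baseChangeMap p g' e' ≫ baseChangeMap p g e := by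
  apply pullback.hom_ext <;> simp [reassoc_of% (baseChangeMap_fst p g' e')]

lemma isPullback_baseChangeMap :
    IsPullback (baseChangeMap p g e) (pullback.fst t' p) (pullback.fst t p) g := by
  refine .of_right ?_ (baseChangeMap_fst p g e) (IsPullback.of_hasPullback t p).flip
  rw [baseChangeMap_snd, e]
  exact (IsPullback.of_hasPullback t' p).flip

lemma isPullback_comap {X Y : Scheme.{u}} (f : X ⟶ Y) (I : Y.IdealSheafData) :
    IsPullback (I.comap f).subschemeι
      (Scheme.IdealSheafData.subschemeMap _ _ f (I.le_map_comap f)) f I.subschemeι :=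
  isPullback_of_isClosedImmersion _ _ _ _ (by simp) (by simp)

lemma ker_eq_comap_of_isPullback {Z Y Z' Y' : Scheme.{u}} {i : Z ⟶ Y} {f : Y' ⟶ Y} {i' : Z' ⟶ Y'}
    {f' : Z' ⟶ Z} [IsClosedImmersion i] (h : IsPullback i' f' f i) : i'.ker = i.ker.comap f := by
  rw [← Scheme.IdealSheafData.ker_fst_of_isClosedImmersion, ← h.isoPullback_hom_fst,
    Scheme.Hom.ker_comp_of_isIso]

lemma isPullback_comap_baseChangeMap (I : (pullback t p).IdealSheafData) :
    IsPullback (Scheme.IdealSheafData.subschemeMap _ _ (baseChangeMap p g e) (I.le_map_comap _))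
      ((I.comap (baseChangeMap p g e)).subschemeι ≫ pullback.fst t' p)
      (I.subschemeι ≫ pullback.fst t p) g :=
  (isPullback_comap _ I).flip.paste_vert (isPullback_baseChangeMap p g e)

end

namespace HilbPoints

variable {n : ℕ} {X S T T' T'' : Scheme.{u}} {p : X ⟶ S} {t : T ⟶ S} {t' : T' ⟶ S} {t'' : T'' ⟶ S}

/-- Pullback of closed subschemes along a morphism `g : T' ⟶ T` over `S`. -/
def map (g : T' ⟶ T) (e : g ≫ t = t') (Z : HilbPoints n p t) : HilbPoints n p t' where
  ideal := Z.ideal.comap (baseChangeMap p g e)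
  isFinite := MorphismProperty.of_isPullback (isPullback_comap_baseChangeMap p g e Z.ideal)
    Z.isFinite
  isLocallyFree := by
    have := Z.isFinite
    exact Z.isLocallyFree.of_isPullback (isPullback_comap_baseChangeMap p g e Z.ideal)

lemma map_id (e : 𝟙 T ≫ t = t) (Z : HilbPoints n p t) : Z.map (𝟙 T) e = Z := by
  ext1
  simp [map, baseChangeMap_id]

lemma map_comp (g : T' ⟶ T) (e : g ≫ t = t') (g' : T'' ⟶ T') (e' : g' ≫ t' = t'')
    (e'' : (g' ≫ g) ≫ t = t'') (Z : HilbPoints n p t) :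
    Z.map (g' ≫ g) e'' = (Z.map g e).map g' e' := by
  ext1
  simp [map, baseChangeMap_comp p g e g' e' e'']

end HilbPoints

/-- The Hilbert functor of `n` points of `p : X ⟶ S`, on the category of schemes over `S`. -/
def hilb (n : ℕ) {X S : Scheme.{u}} (p : X ⟶ S) : (Over S)ᵒᵖ ⥤ Type u where
  obj T := HilbPoints n p T.unop.hom
  map φ := TypeCat.ofHom (HilbPoints.map φ.unop.left (Over.w φ.unop))
  map_id T := by refine ConcreteCategory.hom_ext _ _ fun Z ↦ ?_; exact Z.map_id _
  map_comp φ ψ := by refine ConcreteCategory.hom_ext _ _ fun Z ↦ ?_; exact Z.map_comp _ _ _ _ _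

lemma HilbPoints.sigma_map_eq {n : ℕ} {W U S T T' : Scheme.{u}} {q : W ⟶ U} {i : U ⟶ S}
    {t' : T' ⟶ S} {h : T ⟶ U} {h' : T' ⟶ U} (g : T' ⟶ T) (e : g ≫ h = h') (w : (g ≫ h) ≫ i = t')
    (w' : h' ≫ i = t') (Z : HilbPoints n q h) :
    (⟨⟨g ≫ h, w⟩, Z.map g rfl⟩ : Σ h : {h : T' ⟶ U // h ≫ i = t'}, HilbPoints n q h.1) =
      ⟨⟨h', w'⟩, Z.map g e⟩ := by
  subst e
  rfl

/-- For a monomorphism `i : U ⟶ S` and `q : W ⟶ U`, the Hilbert functor of `q` viewed as a functor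
on schemes over `S`: a `T`-valued point is a point of the Hilbert functor of `q` for the (unique)
factorization of `T ⟶ S` through `U`, and there are none if there is no such factorization. -/
def hilbExt (n : ℕ) {W U S : Scheme.{u}} (q : W ⟶ U) (i : U ⟶ S) : (Over S)ᵒᵖ ⥤ Type u where
  obj T := Σ h : {h : T.unop.left ⟶ U // h ≫ i = T.unop.hom}, HilbPoints n q h.1
  map φ := TypeCat.ofHom fun Z ↦
    ⟨⟨φ.unop.left ≫ Z.1.1, by rw [Category.assoc, Z.1.2, Over.w]⟩, Z.2.map φ.unop.left rfl⟩
  map_id T := by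
    refine ConcreteCategory.hom_ext _ _ fun Z ↦ ?_
    refine (HilbPoints.sigma_map_eq (𝟙 _) (Category.id_comp _) _ Z.1.2 Z.2).trans ?_
    rw [HilbPoints.map_id]
    rfl
  map_comp φ ψ := by
    refine ConcreteCategory.hom_ext _ _ fun Z ↦ ?_
    refine (HilbPoints.sigma_map_eq (ψ.unop.left ≫ φ.unop.left) (Category.assoc _ _ _) _ ?_
      Z.2).trans ?_
    · simp [Z.1.2]
    · rw [HilbPoints.map_comp φ.unop.left rfl ψ.unop.left rfl]
      rfl

section Incl

variable {n : ℕ} {W U X S T T' : Scheme.{u}} {q : W ⟶ U} {i : U ⟶ S} {p : X ⟶ S} {j : W ⟶ X}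

/-- The map `T ×_U W ⟶ T ×_S X` induced by `j : W ⟶ X` over `i : U ⟶ S`. -/
def inclMap (w : j ≫ p = q ≫ i) {h : T ⟶ U} {t : T ⟶ S} (e : h ≫ i = t) :
    pullback h q ⟶ pullback t p :=
  pullback.lift (pullback.fst h q) (pullback.snd h q ≫ j)
    (by rw [← e, pullback.condition_assoc, Category.assoc, w])

@[simp]
lemma inclMap_fst (w : j ≫ p = q ≫ i) {h : T ⟶ U} {t : T ⟶ S} (e : h ≫ i = t) :
    inclMap w e ≫ pullback.fst t p = pullback.fst h q :=
  pullback.lift_fst _ _ _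

@[simp]
lemma inclMap_snd (w : j ≫ p = q ≫ i) {h : T ⟶ U} {t : T ⟶ S} (e : h ≫ i = t) :
    inclMap w e ≫ pullback.snd t p = pullback.snd h q ≫ j :=
  pullback.lift_snd _ _ _

instance mono_inclMap [Mono j] (w : j ≫ p = q ≫ i) {h : T ⟶ U} {t : T ⟶ S} (e : h ≫ i = t) :
    Mono (inclMap w e) where
  right_cancellation a b hab := by
    apply pullback.hom_ext
    · simpa using congr($hab ≫ pullback.fst t p)
    · rw [← cancel_mono j]
      simpa using congr($hab ≫ pullback.snd t p)

lemma isClosedImmersion_incl [Mono j] [IsSeparated p] (w : j ≫ p = q ≫ i) {h : T ⟶ U} {t : T ⟶ S}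
    (e : h ≫ i = t) (Z : HilbPoints n q h) :
    IsClosedImmersion (Z.ideal.subschemeι ≫ inclMap w e) := by
  rw [IsClosedImmersion.iff_isProper_and_mono]
  refine ⟨?_, inferInstance⟩
  have := Z.isFinite
  have : IsProper ((Z.ideal.subschemeι ≫ inclMap w e) ≫ pullback.fst t p) := by
    rw [Category.assoc, inclMap_fst]
    infer_instance
  exact IsProper.of_comp _ (pullback.fst t p)

lemma isPullback_inclMap (w : j ≫ p = q ≫ i) {h : T ⟶ U} {t : T ⟶ S} (e : h ≫ i = t)
    {h' : T' ⟶ U} {t' : T' ⟶ S} (e' : h' ≫ i = t') (g : T' ⟶ T) (eh : g ≫ h = h')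
    (et : g ≫ t = t') :
    IsPullback (inclMap w e') (baseChangeMap q g eh) (baseChangeMap p g et) (inclMap w e) := by
  refine (IsPullback.of_bot ?_ ?_ (isPullback_baseChangeMap p g et)).flip
  · simpa using isPullback_baseChangeMap q g eh
  · apply pullback.hom_ext <;> simp [reassoc_of% (inclMap_fst w e'),
      reassoc_of% (baseChangeMap_snd q g eh)]

lemma exists_isPullback_ker {Z Y : Scheme.{u}} (f : Z ⟶ Y) [IsClosedImmersion f] (a : Y ⟶ T) :
    ∃ φ, IsPullback φ (f.ker.subschemeι ≫ a) (f ≫ a) (𝟙 T) := by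
  have : IsIso f.toImage := inferInstance
  refine ⟨(asIso f.toImage).inv, IsPullback.of_horiz_isIso ⟨?_⟩⟩
  rw [Iso.inv_comp_eq, Category.comp_id, asIso_hom]
  exact congr($(f.toImage_imageι.symm) ≫ a).trans (Category.assoc _ _ _)

lemma exists_isPullback_incl [Mono j] [IsSeparated p] (w : j ≫ p = q ≫ i) {h : T ⟶ U} {t : T ⟶ S}
    (e : h ≫ i = t) (Z : HilbPoints n q h) :
    ∃ φ, IsPullback φ ((Z.ideal.map (inclMap w e)).subschemeι ≫ pullback.fst t p)
      (Z.ideal.subschemeι ≫ pullback.fst h q) (𝟙 T) := by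
  have := isClosedImmersion_incl w e Z
  have := exists_isPullback_ker (Z.ideal.subschemeι ≫ inclMap w e) (pullback.fst t p)
  rwa [Category.assoc (Z.ideal.subschemeι), inclMap_fst] at this

/-- A closed subscheme of `T ×_U W` that is finite over `T`, viewed as a closed subscheme of
`T ×_S X` (it is closed there because `X` is separated over `S`). -/
def HilbPoints.incl [Mono j] [IsSeparated p] (w : j ≫ p = q ≫ i) {h : T ⟶ U} {t : T ⟶ S}
    (e : h ≫ i = t) (Z : HilbPoints n q h) : HilbPoints n p t where
  ideal := Z.ideal.map (inclMap w e)
  isFinite := by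
    obtain ⟨φ, hφ⟩ := exists_isPullback_incl w e Z
    exact MorphismProperty.of_isPullback hφ Z.isFinite
  isLocallyFree := by
    obtain ⟨φ, hφ⟩ := exists_isPullback_incl w e Z
    have := Z.isFinite
    exact Z.isLocallyFree.of_isPullback hφ

lemma HilbPoints.map_incl [Mono j] [IsSeparated p] (w : j ≫ p = q ≫ i) {h : T ⟶ U} {t : T ⟶ S}
    (e : h ≫ i = t) {h' : T' ⟶ U} {t' : T' ⟶ S} (e' : h' ≫ i = t') (g : T' ⟶ T) (eh : g ≫ h = h')
    (et : g ≫ t = t') (Z : HilbPoints n q h) :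
    (Z.map g eh).incl w e' = (Z.incl w e).map g et := by
  ext1
  have := isClosedImmersion_incl w e Z
  exact ker_eq_comap_of_isPullback
    ((isPullback_comap (baseChangeMap q g eh) Z.ideal).paste_horiz
      (isPullback_inclMap w e e' g eh et))

/-- For `j : W ⟶ X` over `i : U ⟶ S`, the natural transformation from the Hilbert functor of `W`
over `U`, viewed as a functor on schemes over `S`, to the Hilbert functor of `X` over `S`, which
regards a closed subscheme of `T ×_U W` as a closed subscheme of `T ×_S X`. -/
def hilbIncl (n : ℕ) [Mono j] [IsSeparated p] (w : j ≫ p = q ≫ i) : hilbExt n q i ⟶ hilb n p where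
  app T := TypeCat.ofHom fun Z ↦ Z.2.incl w Z.1.2
  naturality T T' φ := by
    refine ConcreteCategory.hom_ext _ _ fun Z ↦ ?_
    exact Z.2.map_incl w _ _ _ _ _

end Incl

/-- Open subfunctors: monomorphisms whose pullbacks to representable functors are represented by
open immersions. -/
def IsOpenSubfunctor {S : Scheme.{u}} {F G : (Over S)ᵒᵖ ⥤ Type u} (f : F ⟶ G) : Prop :=
  Mono f ∧ (MorphismProperty.inverseImage @IsOpenImmersion (Over.forget S)).presheaf f

namespace QCohGradedAlgebra

variable {S : Scheme.{u}} (R : QCohGradedAlgebra S)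

/-- The Hilbert functor of `n` points of the relative `Proj` of `𝓡` over `S`. -/
def hilbProj (n : ℕ) : (Over S)ᵒᵖ ⥤ Type u := hilb n R.projToBase

/-- The Hilbert functor of `n` points of `Spec R_(f)` over `Spec A`, on schemes over `Spec A`. -/
def hilbAway (n : ℕ) (U : S.AffineZariskiSite) (f : R.sec U.1) :
    (Over (Spec Γ(S, U.1)))ᵒᵖ ⥤ Type u :=
  hilb n (R.awayToSpec U f)

/-- The Hilbert functor of `n` points of `Spec R_(f)` over `Spec A`, on schemes over `S`. -/
def hilbAwayExt (n : ℕ) (U : S.AffineZariskiSite) (f : R.sec U.1) : (Over S)ᵒᵖ ⥤ Type u :=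
  hilbExt n (R.awayToSpec U f) U.2.fromSpec

/-- The inclusion of the Hilbert functor of `Spec R_(f)` over `Spec A` in that of the relative
`Proj` of `𝓡` over `S`. -/
def hilbAwayIncl (n : ℕ) (U : S.AffineZariskiSite) {d : ℕ} {f : R.sec U.1}
    (hf : f ∈ R.piece U.1 d) (hd : 0 < d) : R.hilbAwayExt n U f ⟶ R.hilbProj n :=
  hilbIncl n (R.awayToProj_projToBase U hf hd)

end QCohGradedAlgebra

end HilbertPoints

end

/-! Covering. A point `Z` of the Hilbert functor over `T` is finite over `T`, so its fibre at `t`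
has finitely many points, all lying over one affine open `Spec A` of `S`. Homogeneous prime
avoidance (`exists_forall_notMem`) yields a homogeneous `f` of positive degree outside all the
corresponding primes, so the fibre lies in `Spec R_(f)`. As `Z ⟶ T` is closed, the points of `T`
whose fibre lies in `Spec R_(f)` form an open set (`includedLocus`). A base change factors through
this open exactly when the pulled back subscheme lies in `Spec R_(f)`
(`map_mem_range_hilbIncl_iff`). So these subfunctors are open and they cover.

Affine case. Let `B` be an `A`-algebra and `b` an `n`-tuple in `B`. A closed subscheme on which `b`
induces a basis of the functions is determined by the coordinates of all elements of `B`. These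
satisfy polynomial equations (`IsCoordinateMap`), and every solution comes from a quotient algebra
(`IsCoordinateMap.exists_algebra`). The spectrum of the ring with these coordinates as generators
and these equations as relations therefore represents the framed subschemes
(`HilbPoints.isFramed_iff_exists`); `B` may be arbitrarily large. Being framed by `b` is the
invertibility of a determinant, hence open (`HilbPoints.isFramed_map_iff`), and linear algebra over
residue fields gives a suitable `b` at every point (`HilbPoints.exists_mem_framedLocus`).

Gluing. The Hilbert functor is a Zariski sheaf (`isZariskiSheaf_hilb`), and a Zariski sheaf covered
by representable open subfunctors is representable (`isRepresentable_of_cover`). This is used twice: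
for the tuples `b` in the affine case, and for the opens `Spec R_(f)` of the relative `Proj`. -/

noncomputable section

namespace HilbertPoints

/-! ### Free quotient algebras of `C ⊗ B` and their universal coordinates. -/

section Coordinates

variable {A B C : Type u} [CommRing A] [CommRing B] [CommRing C] {n : ℕ}

/-- For ring homomorphisms `φ : A → B`, `θ : A → C` and elements `b` of `B`, the map `c` is the
coordinate map of a quotient algebra of `C ⊗ B` that is free over `C` with basis `b`. -/
structure IsCoordinateMap (φ : A →+* B) (θ : A →+* C) (b : Fin n → B) (c : B → Fin n → C) :
    Prop where
  add (x y : B) : c (x + y) = c x + c y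
  smul (a : A) (x : B) : c (φ a * x) = θ a • c x
  basis (i : Fin n) : c (b i) = Pi.single i 1
  -- This makes the kernel of the `C`-linear extension of `c` to `C ⊗ B` an ideal. The unit and
  -- associativity need no axioms, being inherited from `C ⊗ B`.
  mul (x y : B) : c (x * y) = ∑ i, c y i • c (x * b i)

/-- The map taking `a` to the linear combination of the `β (b i)` with coefficients `α (a i)`. -/
def linearCombination {E : Type u} [CommRing E] (α : C →+* E) (e : Fin n → E)
    (a : Fin n → C) : E :=
  ∑ i, α (a i) * e i

lemma linearCombination_add {E : Type u} [CommRing E] (α : C →+* E) (e : Fin n → E)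
    (a a' : Fin n → C) :
    linearCombination α e (a + a') = linearCombination α e a + linearCombination α e a' := by
  simp [linearCombination, add_mul, Finset.sum_add_distrib]

lemma linearCombination_smul {E : Type u} [CommRing E] (α : C →+* E) (e : Fin n → E)
    (r : C) (a : Fin n → C) :
    linearCombination α e (r • a) = α r * linearCombination α e a := by
  simp [linearCombination, Finset.mul_sum, mul_assoc]

lemma linearCombination_sum {E : Type u} [CommRing E] (α : C →+* E) (e : Fin n → E)
    {ι : Type*} (s : Finset ι) (a : ι → Fin n → C) :
    linearCombination α e (∑ i ∈ s, a i) = ∑ i ∈ s, linearCombination α e (a i) := by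
  simp [linearCombination, Finset.sum_mul]
  exact Finset.sum_comm

lemma linearCombination_single {E : Type u} [CommRing E] (α : C →+* E) (e : Fin n → E)
    (i : Fin n) : linearCombination α e (Pi.single i 1) = e i := by
  simp [linearCombination, Pi.single_apply, apply_ite α, ite_mul]

@[simp]
lemma linearCombination_zero {E : Type u} [CommRing E] (α : C →+* E) (e : Fin n → E) :
    linearCombination α e 0 = 0 := by
  simp [linearCombination]

/-- An algebra that is free on the images of the `b i` yields a coordinate map. -/
lemma exists_isCoordinateMap {E : Type u} [CommRing E] {φ : A →+* B} {θ : A →+* C}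
    (α : C →+* E) (β : B →+* E) (h : ∀ a, α (θ a) = β (φ a)) (b : Fin n → B)
    (hb : Function.Bijective (linearCombination α (fun i ↦ β (b i)))) :
    ∃ c, IsCoordinateMap φ θ b c ∧ ∀ x, β x = linearCombination α (fun i ↦ β (b i)) (c x) := by
  choose c hc using fun x ↦ hb.2 (β x)
  refine ⟨c, ⟨fun x y ↦ hb.1 ?_, fun a x ↦ hb.1 ?_, fun i ↦ hb.1 ?_, fun x y ↦ hb.1 ?_⟩,
    fun x ↦ (hc x).symm⟩
  · rw [linearCombination_add, hc, hc, hc, map_add]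
  · rw [linearCombination_smul, hc, hc, map_mul, h]
  · rw [linearCombination_single, hc]
  · simp_rw [linearCombination_sum, linearCombination_smul, hc, map_mul]
    conv_lhs => rw [← hc y]
    simp only [linearCombination, Finset.mul_sum]
    exact Finset.sum_congr rfl fun i _ ↦ by ring

/-- A coordinate map is the coordinate map of a quotient algebra of `C ⊗ B`. -/
lemma IsCoordinateMap.exists_algebra {φ : A →+* B} {θ : A →+* C} {b : Fin n → B}
    {c : B → Fin n → C} (h : IsCoordinateMap φ θ b c) :
    ∃ (E : CommRingCat.{u}) (α : C →+* E) (β : B →+* E), (∀ a, α (θ a) = β (φ a)) ∧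
      (∀ x, β x = linearCombination α (fun i ↦ β (b i)) (c x)) ∧
      Function.Bijective (linearCombination α (fun i ↦ β (b i))) := by
  algebraize [φ, θ]
  let c' : B →ₗ[A] (Fin n → C) :=
    { toFun := c
      map_add' := h.add
      map_smul' a x := by
        rw [Algebra.smul_def, RingHom.algebraMap_toAlgebra, h.smul]
        exact algebraMap_smul C a (c x) }
  let Φ : TensorProduct A C B →ₗ[C] (Fin n → C) := c'.liftBaseChange C
  have hΦ (r : C) (x : B) : Φ (r ⊗ₜ x) = r • c x := by simp [Φ, c']
  -- Multiplication by `1 ⊗ x` changes `Φ z` in a way that depends on `z` only through `Φ z`; hence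
  -- `ker Φ` is an ideal.
  have key (x : B) (z : TensorProduct A C B) : Φ ((1 ⊗ₜ x) * z) = ∑ i, Φ z i • c (x * b i) := by
    induction z with
    | zero => simp
    | tmul r y =>
      rw [Algebra.TensorProduct.tmul_mul_tmul, one_mul, hΦ, hΦ, h.mul]
      simp [Finset.smul_sum, smul_smul]
    | add z w hz hw => simp [mul_add, map_add, hz, hw, add_smul, Finset.sum_add_distrib]
  let I : Ideal (TensorProduct A C B) :=
    { __ := LinearMap.ker Φ
      smul_mem' w z hz := by
        replace hz : Φ z = 0 := hz
        change Φ (w * z) = 0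
        induction w with
        | zero => simp
        | tmul r x =>
          have : (r ⊗ₜ[A] x) * z = r • ((1 ⊗ₜ x) * z) := by
            rw [← smul_mul_assoc, TensorProduct.smul_tmul', smul_eq_mul, mul_one]
          rw [this, map_smul, key, hz]
          simp
        | add w w' hw hw' => rw [add_mul, map_add, hw, hw', add_zero] }
  have hI (z) : z ∈ I ↔ Φ z = 0 := Iff.rfl
  let mk := Ideal.Quotient.mk I
  let α : C →+* TensorProduct A C B ⧸ I :=
    mk.comp (Algebra.TensorProduct.includeLeftRingHom)
  let β : B →+* TensorProduct A C B ⧸ I :=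
    mk.comp (Algebra.TensorProduct.includeRight (R := A) (A := C) (B := B)).toRingHom
  have hcomb (a : Fin n → C) : linearCombination α (fun i ↦ β (b i)) a =
      mk (∑ i, a i ⊗ₜ b i) := by
    simp only [linearCombination, map_sum]
    refine Finset.sum_congr rfl fun i _ ↦ ?_
    change mk (a i ⊗ₜ 1) * mk (1 ⊗ₜ b i) = _
    rw [← map_mul, Algebra.TensorProduct.tmul_mul_tmul, one_mul, mul_one]
  have hΦsum (a : Fin n → C) : Φ (∑ i, a i ⊗ₜ b i) = a := by
    rw [map_sum]
    simp_rw [hΦ, h.basis]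
    ext j
    simp [Pi.single_apply]
  -- Since `a ↦ ∑ a i ⊗ b i` is a section of `Φ` (`hΦsum`), every `z` is congruent modulo `ker Φ` to
  -- a combination of the `b i`.
  have hz (z : TensorProduct A C B) :
      mk z = linearCombination α (fun i ↦ β (b i)) (Φ z) := by
    rw [hcomb, Ideal.Quotient.mk_eq_mk_iff_sub_mem, hI, map_sub, hΦsum, sub_self]
  refine ⟨.of (TensorProduct A C B ⧸ I), α, β, fun a ↦ ?_, fun x ↦ ?_, ?_, ?_⟩
  · change mk (algebraMap A C a ⊗ₜ 1) = mk (1 ⊗ₜ algebraMap A B a)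
    rw [Algebra.algebraMap_eq_smul_one, Algebra.algebraMap_eq_smul_one, TensorProduct.smul_tmul]
  · refine (hz (1 ⊗ₜ x)).trans ?_
    rw [hΦ, one_smul]
  · intro a a' e
    replace e : linearCombination α (fun i ↦ β (b i)) a =
      linearCombination α (fun i ↦ β (b i)) a' := e
    rw [hcomb, hcomb, Ideal.Quotient.mk_eq_mk_iff_sub_mem, hI, map_sub, hΦsum, hΦsum,
      sub_eq_zero] at e
    exact e
  · intro z
    obtain ⟨z, rfl⟩ := Ideal.Quotient.mk_surjective z
    exact ⟨_, (hz z).symm⟩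

/-- The relations that define the universal coordinate map. -/
inductive CoordinateRel (φ : A →+* B) (b : Fin n → B) :
    MvPolynomial (B × Fin n) A → MvPolynomial (B × Fin n) A → Prop
  | add (x y k) : CoordinateRel φ b (.X (x + y, k)) (.X (x, k) + .X (y, k))
  | smul (a x k) : CoordinateRel φ b (.X (φ a * x, k)) (.C a * .X (x, k))
  | basis (i k) : CoordinateRel φ b (.X (b i, k)) ((Pi.single i 1 : Fin n → _) k)
  | mul (x y k) : CoordinateRel φ b (.X (x * y, k)) (∑ i, .X (y, i) * .X (x * b i, k))

/-- The ring over which the universal coordinate map is defined. -/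
abbrev CoordinateRing (φ : A →+* B) (b : Fin n → B) : Type u := RingQuot (CoordinateRel φ b)

/-- The structure map of the coordinate ring. -/
def coordinateRingHom (φ : A →+* B) (b : Fin n → B) : A →+* CoordinateRing φ b :=
  (RingQuot.mkRingHom (CoordinateRel φ b)).comp MvPolynomial.C

/-- The universal coordinate map. -/
def coordinateMap (φ : A →+* B) (b : Fin n → B) (x : B) (k : Fin n) : CoordinateRing φ b :=
  RingQuot.mkRingHom (CoordinateRel φ b) (.X (x, k))

lemma isCoordinateMap_coordinateMap (φ : A →+* B) (b : Fin n → B) :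
    IsCoordinateMap φ (coordinateRingHom φ b) b (coordinateMap φ b) where
  add x y := by
    ext k
    simpa [coordinateMap] using RingQuot.mkRingHom_rel (CoordinateRel.add (φ := φ) (b := b) x y k)
  smul a x := by
    ext k
    simpa [coordinateMap, coordinateRingHom] using
      RingQuot.mkRingHom_rel (CoordinateRel.smul (φ := φ) (b := b) a x k)
  basis i := by
    ext k
    have := RingQuot.mkRingHom_rel (CoordinateRel.basis (φ := φ) (b := b) i k)
    rw [Pi.single_apply] at this ⊢
    rw [coordinateMap, this]
    split_ifs <;> simp
  mul x y := by
    ext k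
    simpa [coordinateMap] using RingQuot.mkRingHom_rel (CoordinateRel.mul (φ := φ) (b := b) x y k)

/-- With `coordinateRing_hom_ext` this is the universal property: homomorphisms from the coordinate
ring to `C` are pairs of a homomorphism `θ` and a coordinate map over it, because the relations are
the four axioms of `IsCoordinateMap`. -/
lemma exists_coordinateRing_hom {φ : A →+* B} {θ : A →+* C} {b : Fin n → B} {c : B → Fin n → C}
    (h : IsCoordinateMap φ θ b c) : ∃ g : CoordinateRing φ b →+* C,
      g.comp (coordinateRingHom φ b) = θ ∧ ∀ x k, g (coordinateMap φ b x k) = c x k := by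
  let f : MvPolynomial (B × Fin n) A →+* C := MvPolynomial.eval₂Hom θ fun x ↦ c x.1 x.2
  have hf : ∀ ⦃x y⦄, CoordinateRel φ b x y → f x = f y := by
    rintro _ _ (⟨x, y, k⟩ | ⟨a, x, k⟩ | ⟨i, k⟩ | ⟨x, y, k⟩)
    · simp [f, h.add]
    · simp [f, h.smul]
    · simp only [f, MvPolynomial.coe_eval₂Hom, MvPolynomial.eval₂_X, h.basis, Pi.single_apply]
      split_ifs <;> simp
    · simp [f, h.mul x y]
  refine ⟨RingQuot.lift ⟨f, hf⟩, ?_, fun x k ↦ ?_⟩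
  · ext a
    simp [coordinateRingHom, f]
  · simp [coordinateMap, f]

lemma coordinateRing_hom_ext {φ : A →+* B} {b : Fin n → B} {g g' : CoordinateRing φ b →+* C}
    (h : g.comp (coordinateRingHom φ b) = g'.comp (coordinateRingHom φ b))
    (h' : ∀ x k, g (coordinateMap φ b x k) = g' (coordinateMap φ b x k)) : g = g' := by
  refine RingQuot.ringQuot_ext _ _ (MvPolynomial.ringHom_ext (fun a ↦ congr($h a)) ?_)
  rintro ⟨x, k⟩
  exact h' x k

end Coordinates

/-! ### Homogeneous prime avoidance. -/

section PrimeAvoidance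

variable {A : Type u} [CommRing A] (𝒜 : ℕ → AddSubgroup A) [GradedRing 𝒜]

lemma exists_mem_notMem_of_not_le {I J : HomogeneousIdeal 𝒜} (h : ¬ I ≤ J) :
    ∃ (d : ℕ) (x : A), x ∈ 𝒜 d ∧ x ∈ I ∧ x ∉ J := by
  classical
  obtain ⟨x, hx, hx'⟩ := SetLike.not_le_iff_exists.mp h
  by_contra! H
  refine hx' ?_
  rw [← DirectSum.sum_support_decompose 𝒜 x]
  rw [← HomogeneousIdeal.mem_iff]
  refine Ideal.sum_mem _ fun i _ ↦ H i _ (SetLike.coe_mem _) ?_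
  exact I.isHomogeneous i hx

/-- Start from a homogeneous element of positive degree outside `p`, available because `p` does not
contain the irrelevant ideal, and multiply by a homogeneous element of each `q` that is not in `p`.
Primality keeps the product outside `p`. -/
lemma exists_prod_mem (s : Finset (ProjectiveSpectrum 𝒜)) (p : ProjectiveSpectrum 𝒜)
    (h : ∀ q ∈ s, ¬ q.asHomogeneousIdeal ≤ p.asHomogeneousIdeal) :
    ∃ (d : ℕ) (g : A), 0 < d ∧ g ∈ 𝒜 d ∧ g ∉ p.asHomogeneousIdeal ∧
      ∀ q ∈ s, g ∈ q.asHomogeneousIdeal := by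
  classical
  induction s using Finset.induction_on with
  | empty =>
    obtain ⟨x, hx, hx'⟩ := SetLike.not_le_iff_exists.mp p.not_irrelevant_le
    by_contra! H
    refine hx' ?_
    rw [← DirectSum.sum_support_decompose 𝒜 x, ← HomogeneousIdeal.mem_iff]
    refine Ideal.sum_mem _ fun i _ ↦ ?_
    rcases Nat.eq_zero_or_pos i with rfl | hi
    · rw [show (DirectSum.decompose 𝒜 x 0 : A) = 0 from
        (HomogeneousIdeal.mem_irrelevant_iff 𝒜 x).mp hx]
      exact zero_mem _
    · by_contra h'
      obtain ⟨q, hq, -⟩ := H i _ hi (SetLike.coe_mem _) h'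
      simp at hq
  | insert q s hq ih =>
    obtain ⟨d, g, hd, hg, hgp, hgs⟩ := ih fun q hq ↦ h q (Finset.mem_insert_of_mem hq)
    obtain ⟨e, x, hx, hxq, hxp⟩ :=
      exists_mem_notMem_of_not_le 𝒜 (h q (Finset.mem_insert_self q s))
    refine ⟨d + e, g * x, by omega, SetLike.mul_mem_graded hg hx, fun H ↦ ?_, fun q' hq' ↦ ?_⟩
    · exact (p.isPrime.mem_or_mem H).elim hgp hxp
    · rcases Finset.mem_insert.mp hq' with rfl | hq'
      · exact Ideal.mul_mem_left _ _ hxq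
      · exact Ideal.mul_mem_right _ _ (hgs _ hq')

/-- Homogeneous prime avoidance: a finite set of points of `Proj` is contained in a basic open. -/
lemma exists_forall_notMem (s : Finset (ProjectiveSpectrum 𝒜)) :
    ∃ (d : ℕ) (f : A), 0 < d ∧ f ∈ 𝒜 d ∧ ∀ p ∈ s, f ∉ p.asHomogeneousIdeal := by
  classical
  induction s using Finset.strongInduction with
  | H s ih =>
    -- If `q ≤ p`, an element outside `p` is outside `q`, so `q` may be dropped. Otherwise no two of
    -- the primes are comparable.
    by_cases H : ∃ q ∈ s, ∃ p ∈ s, q ≠ p ∧ q.asHomogeneousIdeal ≤ p.asHomogeneousIdeal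
    · obtain ⟨q, hq, p, hp, hne, hle⟩ := H
      obtain ⟨d, f, hd, hf, h⟩ := ih _ (Finset.erase_ssubset hq)
      refine ⟨d, f, hd, hf, fun r hr ↦ ?_⟩
      by_cases hrq : r = q
      · subst hrq
        exact fun h' ↦ h p (Finset.mem_erase.mpr ⟨hne.symm, hp⟩) (hle h')
      · exact h r (Finset.mem_erase.mpr ⟨hrq, hr⟩)
    push Not at H
    obtain rfl | ⟨p, hp⟩ := s.eq_empty_or_nonempty
    -- Zero is homogeneous of every degree; degree `1` is chosen to be positive.
    · exact ⟨1, 0, one_pos, zero_mem _, by simp⟩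
    obtain ⟨d, f, hd, hf, h⟩ := ih _ (Finset.erase_ssubset hp)
    by_cases hfp : f ∈ p.asHomogeneousIdeal
    swap
    · refine ⟨d, f, hd, hf, fun r hr ↦ ?_⟩
      by_cases hrp : r = p
      · exact hrp ▸ hfp
      · exact h r (Finset.mem_erase.mpr ⟨hrp, hr⟩)
    obtain ⟨e, g, he, hg, hgp, hgs⟩ := exists_prod_mem 𝒜 (s.erase p) p fun q hq ↦
      H q (Finset.mem_of_mem_erase hq) p hp (Finset.ne_of_mem_erase hq)
    -- The exponents bring `f`, of degree `d`, and `g`, of degree `e`, to the same degree. At `p`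
    -- only `g` is outside the prime, at the other points only `f`.
    refine ⟨e * d, f ^ e + g ^ d, by positivity, ?_, fun r hr ↦ ?_⟩
    · refine add_mem (SetLike.pow_mem_graded e hf) ?_
      rw [mul_comm]
      exact SetLike.pow_mem_graded d hg
    · by_cases hrp : r = p
      · subst hrp
        intro h'
        exact hgp (r.isPrime.mem_of_pow_mem d
          ((Ideal.add_mem_iff_right _ (Ideal.pow_mem_of_mem _ hfp e he)).mp h'))
      · have hr' := Finset.mem_erase.mpr ⟨hrp, hr⟩
        intro h'
        exact h r hr' (r.isPrime.mem_of_pow_mem e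
          ((Ideal.add_mem_iff_left _ (Ideal.pow_mem_of_mem _ (hgs r hr') d hd)).mp h'))

end PrimeAvoidance

/-! ### Gluing representable open subfunctors of a Zariski sheaf. -/

/-- A monomorphism of presheaves has the property `P` if the locus where an element of the target
comes from the source is represented by a monomorphism with this property. -/
lemma presheaf_of_forall_exists {C : Type*} [Category.{u} C] (P : MorphismProperty C)
    [P.RespectsIso] {F G : Cᵒᵖ ⥤ Type u} (f : F ⟶ G)
    (hf : ∀ T, Function.Injective (f.app T))
    (H : ∀ (T : C) (y : G.obj (op T)), ∃ (V : C) (i : V ⟶ T), P i ∧ Mono i ∧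
      ∀ (T' : C) (g : T' ⟶ T), G.map g.op y ∈ Set.range (f.app (op T')) ↔ ∃ h, h ≫ i = g) :
    P.presheaf f := by
  refine MorphismProperty.relative.of_exists fun T g ↦ ?_
  obtain ⟨V, i, hi, _, hV⟩ := H T (yonedaEquiv g)
  -- The criterion for the morphism `i` itself says that the element comes from the source over `V`;
  -- this `x` is the projection of the fibre product `V` to `F`.
  obtain ⟨x, hx⟩ := (hV V i).mpr ⟨𝟙 _, Category.id_comp _⟩
  have key (T' : C) (a : T' ⟶ T) : g.app (op T') a = G.map a.op (yonedaEquiv g) := by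
    rw [map_yonedaEquiv]
  have hw : yonedaEquiv.symm x ≫ f = yoneda.map i ≫ g := by
    apply yonedaEquiv.injective
    rw [yonedaEquiv_comp, Equiv.apply_symm_apply, hx, ← yonedaEquiv_naturality]
  refine ⟨V, yonedaEquiv.symm x, i, IsPullback.of_forall_isPullback_app fun T' ↦ ?_, hi⟩
  refine (Types.isPullback_iff _ _ _ _).mpr ⟨congr(($hw).app T'), ?_, ?_⟩
  · rintro a b ⟨-, h⟩
    exact (cancel_mono i).mp h
  · intro y a hya
    obtain ⟨h, rfl⟩ := (hV T'.unop a).mp ⟨y, hya.trans (key _ a)⟩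
    refine ⟨h, hf _ ?_, rfl⟩
    exact (congr(($hw).app T' h)).trans hya.symm

variable {S : Scheme.{u}}

section Total

variable (G : (Over S)ᵒᵖ ⥤ Type u)

/-- The presheaf on schemes whose value on `T` consists of a morphism `T ⟶ S` together with an
element of `G` over it. -/
def total : Scheme.{u}ᵒᵖ ⥤ Type u where
  obj T := Σ t : T.unop ⟶ S, G.obj (op (Over.mk t))
  map g := TypeCat.ofHom fun x ↦ ⟨g.unop ≫ x.1,
    G.map (Over.homMk g.unop : Over.mk (g.unop ≫ x.1) ⟶ Over.mk x.1).op x.2⟩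
  map_id T := by
    refine ConcreteCategory.hom_ext _ _ fun x ↦ ?_
    obtain ⟨t, x⟩ := x
    have h (t' : T.unop ⟶ S) (e : t' = t) (φ : Over.mk t' ⟶ Over.mk t) (hφ : φ.left = 𝟙 _) :
        (⟨t', G.map φ.op x⟩ : Σ t : T.unop ⟶ S, G.obj (op (Over.mk t))) = ⟨t, x⟩ := by
      subst e
      obtain rfl : φ = 𝟙 _ := by ext1; exact hφ
      simp
    exact h _ (Category.id_comp t) _ rfl
  map_comp {T T' T''} g g' := by
    refine ConcreteCategory.hom_ext _ _ fun x ↦ ?_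
    obtain ⟨t, x⟩ := x
    have h (t' : T''.unop ⟶ S) (φ : Over.mk t' ⟶ Over.mk t)
        (e : t' = g'.unop ≫ g.unop ≫ t) (hφ : φ.left = g'.unop ≫ g.unop) :
        (⟨t', G.map φ.op x⟩ : Σ t : T''.unop ⟶ S, G.obj (op (Over.mk t))) =
          ⟨g'.unop ≫ g.unop ≫ t, G.map (Over.homMk g'.unop : Over.mk (g'.unop ≫ g.unop ≫ t) ⟶
            Over.mk (g.unop ≫ t)).op (G.map (Over.homMk g.unop :
            Over.mk (g.unop ≫ t) ⟶ Over.mk t).op x)⟩ := by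
      subst e
      obtain rfl : φ = (Over.homMk g'.unop : Over.mk (g'.unop ≫ g.unop ≫ t) ⟶
            Over.mk (g.unop ≫ t)) ≫ (Over.homMk g.unop : Over.mk (g.unop ≫ t) ⟶ Over.mk t) := by
        ext1; exact hφ
      simp
    exact h _ _ (Category.assoc _ _ _) rfl

variable {G}

/-- An element of `G` as an element of the total presheaf. -/
def total.mk {T : Over S} (x : G.obj (op T)) : (total G).obj (op T.left) := ⟨T.hom, x⟩

lemma total.mk_injective {T : Over S} : Function.Injective (total.mk (G := G) (T := T)) :=
  fun _ _ h ↦ eq_of_heq (Sigma.mk.inj h).2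

lemma total.map_mk {T T' : Over S} (φ : T' ⟶ T) (x : G.obj (op T)) :
    (total G).map φ.left.op (total.mk x) = total.mk (G.map φ.op x) := by
  have h {T' : Scheme.{u}} (t' : T' ⟶ S) (g : T' ⟶ T.left) (w : g ≫ T.hom = t') :
      (total G).map g.op (total.mk x) =
        total.mk (G.map (Over.homMk g w : Over.mk t' ⟶ T).op x) := by
    subst w
    rfl
  exact h T'.hom φ.left (Over.w φ)

lemma total.exists_eq_mk {T : Scheme.{u}} (y : (total G).obj (op T)) :
    ∃ (t : T ⟶ S) (x : G.obj (op (Over.mk t))), y = total.mk x :=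
  ⟨y.1, y.2, rfl⟩

/-- An equality in the total presheaf contains an equality of structure morphisms, which turns `g`
and `h` into morphisms over `S`. -/
lemma total.exists_hom_of_eq {T T' U : Over S} {x : G.obj (op T)} {y : G.obj (op T')}
    {g : U.left ⟶ T.left} {h : U.left ⟶ T'.left}
    (e : (total G).map g.op (total.mk x) = (total G).map h.op (total.mk y))
    (w : h ≫ T'.hom = U.hom) : ∃ (φ : U ⟶ T) (ψ : U ⟶ T'), φ.left = g ∧ ψ.left = h ∧
      G.map φ.op x = G.map ψ.op y := by
  have e' : g ≫ T.hom = h ≫ T'.hom := congr(Sigma.fst $e)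
  refine ⟨Over.homMk g (e'.trans w), Over.homMk h w, rfl, rfl, ?_⟩
  apply total.mk_injective
  rw [← total.map_mk, ← total.map_mk]
  exact e

/-- The sheaf condition for the Zariski topology, for a presheaf on schemes over `S`. -/
def IsZariskiSheaf (G : (Over S)ᵒᵖ ⥤ Type u) : Prop :=
  ∀ (T : Over S) (𝒰 : Scheme.OpenCover.{u} T.left) (x : ∀ i, G.obj (op (Over.mk (𝒰.f i ≫ T.hom)))),
    (∀ (i j) (W : Over S) (a : W ⟶ Over.mk (𝒰.f i ≫ T.hom)) (b : W ⟶ Over.mk (𝒰.f j ≫ T.hom)),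
      a.left ≫ 𝒰.f i = b.left ≫ 𝒰.f j → G.map a.op (x i) = G.map b.op (x j)) →
    ∃! y : G.obj (op T), ∀ i, G.map (Over.homMk (𝒰.f i) : Over.mk (𝒰.f i ≫ T.hom) ⟶ T).op y = x i

/-- The structure morphisms agree on overlaps, so they glue to some `t : T ⟶ S`. The second
components are then a compatible family for `G` over `t`. -/
lemma IsZariskiSheaf.isSheaf_total (hG : IsZariskiSheaf G) :
    Presheaf.IsSheaf Scheme.zariskiTopology.{u} (total G) := by
  rw [isSheaf_iff_isSheaf_of_type,
    Precoverage.isSheaf_toGrothendieck_iff_of_isStableUnderBaseChange_of_small.{u}]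
  intro T (𝒰 : Scheme.OpenCover.{u} T)
  refine (Presieve.isSheafFor_arrows_iff _ _).mpr fun x hx ↦ ?_
  let t : T ⟶ S := 𝒰.glueMorphisms (fun i ↦ (x i).1) fun i j ↦
    congr(Sigma.fst $(hx i j _ (pullback.fst _ _) (pullback.snd _ _) pullback.condition))
  have ht (i) : 𝒰.f i ≫ t = (x i).1 := 𝒰.ι_glueMorphisms _ _ _
  have hx' (i) : ∃ y : G.obj (op (Over.mk (𝒰.f i ≫ t))), total.mk y = x i := by
    obtain ⟨s, y, hy⟩ := total.exists_eq_mk (x i)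
    have : s = 𝒰.f i ≫ t := by rw [ht, hy]; rfl
    subst this
    exact ⟨y, hy.symm⟩
  choose y hy using hx'
  obtain ⟨z, hz, huniq⟩ := hG (Over.mk t) 𝒰 y fun i j W a b hab ↦ by
    apply total.mk_injective
    rw [← total.map_mk, ← total.map_mk, hy, hy]
    exact hx i j W.left a.left b.left hab
  refine ⟨total.mk z, fun i ↦ ?_, fun z' hz' ↦ ?_⟩
  · rw [← hy i, ← hz i]
    rfl
  · obtain ⟨t', z', rfl⟩ := total.exists_eq_mk z'
    have : t' = t := 𝒰.hom_ext _ _ fun i ↦ by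
      rw [ht, ← hz']; rfl
    subst this
    congr 1
    refine huniq _ fun i ↦ total.mk_injective ?_
    rw [hy i, ← hz' i]
    rfl

/-- A Zariski sheaf on schemes over `S` that is covered by representable open subfunctors is
representable. -/
theorem isRepresentable_of_cover (hG : IsZariskiSheaf G) {ι : Type u} (X : ι → Over S)
    (x : ∀ i, G.obj (op (X i)))
    (inj : ∀ (i) (T : Over S) (φ ψ : T ⟶ X i), G.map φ.op (x i) = G.map ψ.op (x i) → φ = ψ)
    (hopen : ∀ (i) (T : Over S) (y : G.obj (op T)), ∃ V : T.left.Opens, ∀ (T' : Over S)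
      (g : T' ⟶ T), (∃ φ : T' ⟶ X i, G.map φ.op (x i) = G.map g.op y) ↔ ∀ z, g.left z ∈ V)
    (hcov : ∀ (T : Over S) (y : G.obj (op T)) (t : T.left), ∃ V : T.left.Opens, t ∈ V ∧
      ∃ (i : ι) (φ : Over.mk (V.ι ≫ T.hom) ⟶ X i),
        G.map φ.op (x i) = G.map (Over.homMk V.ι : Over.mk (V.ι ≫ T.hom) ⟶ T).op y) :
    G.IsRepresentable := by
  let F : Sheaf Scheme.zariskiTopology.{u} (Type u) := ⟨total G, hG.isSheaf_total⟩
  let f (i : ι) : yoneda.obj (X i).left ⟶ F.1 := yonedaEquiv.symm (total.mk (x i))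
  have hfapp (i : ι) (T : Scheme.{u}) (a : T ⟶ (X i).left) :
      (f i).app (op T) a = (total G).map a.op (total.mk (x i)) := rfl
  have hf (i : ι) : IsOpenImmersion.presheaf (f i) := by
    refine presheaf_of_forall_exists _ _ ?_ ?_
    · rintro ⟨T⟩ a b hab
      change T ⟶ (X i).left at a b
      obtain ⟨φ, ψ, hφ, hψ, e⟩ := total.exists_hom_of_eq (U := Over.mk (b ≫ (X i).hom)) hab rfl
      exact hφ.symm.trans (congr(($(inj i _ φ ψ e)).left).trans hψ)
    · intro T y
      obtain ⟨t, y, rfl⟩ := total.exists_eq_mk y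
      obtain ⟨V, hV⟩ := hopen i (Over.mk t) y
      refine ⟨V, V.ι, inferInstanceAs (IsOpenImmersion V.ι), inferInstance, fun T' g ↦ ?_⟩
      have hfac : (∃ h, h ≫ V.ι = g) ↔ ∀ z, g z ∈ V := by
        constructor
        · rintro ⟨h, rfl⟩ z
          exact (h z).2
        · intro hz
          refine ⟨IsOpenImmersion.lift V.ι g ?_, IsOpenImmersion.lift_fac _ _ _⟩
          rintro _ ⟨z, rfl⟩
          simpa using hz z
      rw [hfac]
      refine Iff.trans ?_ (hV (Over.mk (g ≫ t)) (Over.homMk g))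
      constructor
      · rintro ⟨a, ha⟩
        change T' ⟶ (X i).left at a
        obtain ⟨φ, ψ, rfl, h, e⟩ := total.exists_hom_of_eq (U := Over.mk (g ≫ t))
          (T' := Over.mk t) ha rfl
        obtain rfl : ψ = Over.homMk g := by ext1; exact h
        exact ⟨φ, e⟩
      · rintro ⟨φ, hφ⟩
        refine ⟨φ.left, ?_⟩
        change (total G).map φ.left.op (total.mk (x i)) = _
        rw [total.map_mk, hφ]
        rfl
  -- Each point of `T` has a neighbourhood over which the element comes from some `X i`; these
  -- neighbourhoods form the required covering.
  have : Presheaf.IsLocallySurjective Scheme.zariskiTopology (Sigma.desc f) := by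
    refine ⟨fun {T} y ↦ ?_⟩
    obtain ⟨t, y, rfl⟩ := total.exists_eq_mk y
    choose V hV i φ hφ using hcov (Over.mk t) y
    let 𝒰 : T.OpenCover := Scheme.openCoverOfIsOpenCover T V
      (eq_top_iff.mpr fun p _ ↦ Opens.mem_iSup.mpr ⟨p, hV p⟩)
    refine GrothendieckTopology.superset_covering _ ?_ 𝒰.mem_grothendieckTopology
    rintro W _ ⟨_, a, _, ⟨p⟩, rfl⟩
    refine ⟨(Sigma.ι (fun i ↦ yoneda.obj (X i).left) (i p)).app (op W) (a ≫ (φ p).left), ?_⟩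
    have e : (Sigma.ι (fun i ↦ yoneda.obj (X i).left) (i p) ≫ Sigma.desc f).app (op W)
      (a ≫ (φ p).left) = (f (i p)).app (op W) (a ≫ (φ p).left) := by rw [Sigma.ι_desc]
    refine e.trans ?_
    rw [hfapp]
    refine congr($((total G).map_comp (φ p).left.op a.op) (total.mk (x (i p)))).trans ?_
    refine congr((total G).map a.op $((total.map_mk (φ p) (x (i p))).trans
      congr(total.mk $(hφ p)))).trans ?_
    exact congr($(((total G).map_comp (V p).ι.op a.op).symm) (total.mk (T := Over.mk t) y))
  -- The universal element of the scheme `H` representing the total presheaf is a morphism `h : H ⟶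
  -- S` with an element `z` over it. Comparing first components shows that the map `T ⟶ H`
  -- classifying an element over `T ⟶ S` is a morphism over `S`, so `z` represents `G`.
  obtain ⟨H, ⟨r⟩⟩ := Scheme.LocalRepresentability.isRepresentable hf
  obtain ⟨h, z, hz⟩ := total.exists_eq_mk (r.homEquiv (𝟙 H))
  have hr {T : Scheme.{u}} (a : T ⟶ H) : r.homEquiv a = (total G).map a.op (total.mk z) := by
    rw [← hz]; exact r.homEquiv_eq a
  refine ⟨Over.mk h, ⟨⟨fun {T} ↦ Equiv.ofBijective (fun a ↦ G.map a.op z) ⟨?_, ?_⟩, ?_⟩⟩⟩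
  · intro a b hab
    ext1
    apply r.homEquiv.injective
    rw [hr, hr]
    exact (total.map_mk a z).trans (congr(total.mk $hab).trans (total.map_mk b z).symm)
  · intro y
    obtain ⟨a, ha⟩ := r.homEquiv.surjective (total.mk y)
    rw [hr] at ha
    have w : a ≫ h = T.hom := congr(Sigma.fst $ha)
    refine ⟨Over.homMk a w, total.mk_injective ?_⟩
    rw [← total.map_mk]
    exact ha
  · intro T T' a b
    exact congr($(G.map_comp b.op a.op) z)

end Total

/-! ### Gluing closed subschemes along an open cover. -/

section GlueIdeal

lemma app_res {Z Y : Scheme.{u}} (z : Z ⟶ Y) {U V : Y.Opens} (h : V ≤ U) (s : Γ(Y, U)) :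
    z.app V (Y.presheaf.map (homOfLE h).op s) =
      Z.presheaf.map (homOfLE (z.preimage_mono h)).op (z.app U s) :=
  congr($(z.naturality (homOfLE h).op) s)

lemma comp_app_apply {X Y Z : Scheme.{u}} (f : X ⟶ Y) (g : Y ⟶ Z) (V : Z.Opens) (s : Γ(Z, V)) :
    (f ≫ g).app V s = f.app (g ⁻¹ᵁ V) (g.app V s) :=
  congr($(Scheme.Hom.comp_app f g V) s)

lemma res_res {Y : Scheme.{u}} {U V W : Y.Opens} (h : V ≤ U) (h' : W ≤ V) (s : Γ(Y, U)) :
    Y.presheaf.map (homOfLE h').op (Y.presheaf.map (homOfLE h).op s) =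
      Y.presheaf.map (homOfLE (h'.trans h)).op s := by
  rw [← CommRingCat.comp_apply, ← Functor.map_comp]
  rfl

/-- A morphism whose kernel contains an ideal sheaf factors through its closed subscheme. -/
lemma exists_comp_subschemeι {P Y : Scheme.{u}} (I : Y.IdealSheafData) (a : P ⟶ Y)
    (h : I ≤ a.ker) : ∃ k, k ≫ I.subschemeι = a :=
  ⟨a.toImage ≫ Scheme.IdealSheafData.inclusion h, by simp⟩

variable {Y : Scheme.{u}} (𝒰 : Scheme.OpenCover.{u} Y) (I : ∀ i, (𝒰.X i).IdealSheafData)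

/-- Take the fibre product over `Y` of the `j`-th subscheme with the `i`-th chart. By compatibility
its projection to the chart factors through the `i`-th subscheme, so `s` vanishes on it. As `V` lies
in the `i`-th chart, its open immersion in the `j`-th subscheme is an isomorphism over `V`. -/
lemma app_eq_zero_of_compatible
    (hI : ∀ i j, (I i).comap (pullback.fst (𝒰.f i) (𝒰.f j)) =
      (I j).comap (pullback.snd (𝒰.f i) (𝒰.f j)))
    {i : 𝒰.I₀} {V : Y.Opens} (hV : V ≤ (𝒰.f i).opensRange) (s : Γ(Y, V))
    (h : ((I i).subschemeι ≫ 𝒰.f i).app V s = 0) (j : 𝒰.I₀) :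
    ((I j).subschemeι ≫ 𝒰.f j).app V s = 0 := by
  let fst := pullback.fst ((I j).subschemeι ≫ 𝒰.f j) (𝒰.f i)
  let snd := pullback.snd ((I j).subschemeι ≫ 𝒰.f j) (𝒰.f i)
  have w : fst ≫ (I j).subschemeι ≫ 𝒰.f j = snd ≫ 𝒰.f i := pullback.condition
  let a : pullback ((I j).subschemeι ≫ 𝒰.f j) (𝒰.f i) ⟶ pullback (𝒰.f i) (𝒰.f j) :=
    pullback.lift snd (fst ≫ (I j).subschemeι) (by rw [← w, Category.assoc])
  have ha₁ : a ≫ pullback.fst (𝒰.f i) (𝒰.f j) = snd := pullback.lift_fst _ _ _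
  have ha₂ : a ≫ pullback.snd (𝒰.f i) (𝒰.f j) = fst ≫ (I j).subschemeι := pullback.lift_snd _ _ _
  have hle : I i ≤ snd.ker := by
    rw [← ha₁, ← Scheme.IdealSheafData.map_ker, Scheme.IdealSheafData.le_map_iff_comap_le, hI,
      ← Scheme.IdealSheafData.le_map_iff_comap_le, Scheme.IdealSheafData.map_ker, ha₂]
    exact (I j).ker_subschemeι.ge.trans (Scheme.Hom.le_ker_comp _ _)
  obtain ⟨k, hk⟩ := exists_comp_subschemeι (I i) snd hle
  have e : k ≫ (I i).subschemeι ≫ 𝒰.f i = fst ≫ (I j).subschemeι ≫ 𝒰.f j := by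
    rw [w, ← hk, Category.assoc]
  have h₁ : (k ≫ (I i).subschemeι ≫ 𝒰.f i).app V s = 0 := by
    refine (comp_app_apply k ((I i).subschemeι ≫ 𝒰.f i) V s).trans ?_
    rw [h, map_zero]
    rfl
  have h₂ : (fst ≫ (I j).subschemeι ≫ 𝒰.f j).app V s = 0 := by
    generalize k ≫ (I i).subschemeι ≫ 𝒰.f i = f₁ at e h₁
    subst e
    exact h₁
  replace h₂ := (comp_app_apply fst ((I j).subschemeι ≫ 𝒰.f j) V s).symm.trans h₂
  have : IsIso (fst.app (((I j).subschemeι ≫ 𝒰.f j) ⁻¹ᵁ V)) := by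
    refine fst.isIso_app _ ?_
    rw [Scheme.Hom.opensRange_pullbackFst]
    exact Scheme.Hom.preimage_mono _ hV
  exact (map_eq_zero_iff _ (ConcreteCategory.bijective_of_isIso
    (fst.app (((I j).subschemeι ≫ 𝒰.f j) ⁻¹ᵁ V))).1).mp h₂

/-- One exponent has to serve all `j`, although the cover may be infinite. Near a point of the
`i`-th chart the `i`-th subscheme alone decides (`app_eq_zero_of_compatible`), and its part over a
small affine open is affine, so some power of `f` suffices. Quasi-compactness of `U` then bounds the
exponents. -/
lemma exists_pow_mul_app_eq_zero
    (hI : ∀ i j, (I i).comap (pullback.fst (𝒰.f i) (𝒰.f j)) =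
      (I j).comap (pullback.snd (𝒰.f i) (𝒰.f j)))
    (U : Y.affineOpens) (f s : Γ(Y, U))
    (hs : ∀ j, ((I j).subschemeι ≫ 𝒰.f j).app (Y.basicOpen f)
      (Y.presheaf.map (homOfLE (Y.basicOpen_le f)).op s) = 0) :
    ∃ N : ℕ, ∀ j, ((I j).subschemeι ≫ 𝒰.f j).app U (f ^ N * s) = 0 := by
  have key (x : U.1) : ∃ (V : Y.Opens) (hV : V ≤ U.1) (N : ℕ), x.1 ∈ V ∧
      ∀ j, ((I j).subschemeι ≫ 𝒰.f j).app V (Y.presheaf.map (homOfLE hV).op (f ^ N * s)) = 0 := by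
    obtain ⟨i, y, hy⟩ := 𝒰.exists_eq x.1
    obtain ⟨_, ⟨V, hVa, rfl⟩, hxV, hVU⟩ := Y.isBasis_affineOpens.exists_subset_of_mem_open
      (show x.1 ∈ U.1 ⊓ (𝒰.f i).opensRange from ⟨x.2, y, hy⟩) (U.1 ⊓ (𝒰.f i).opensRange).isOpen
    have hVU₁ : V ≤ U.1 := fun _ h ↦ (hVU h).1
    have hVU₂ : V ≤ (𝒰.f i).opensRange := fun _ h ↦ (hVU h).2
    set z := (I i).subschemeι ≫ 𝒰.f i with hz
    have haff : IsAffineOpen (z ⁻¹ᵁ V) := (hVa.preimage_of_isOpenImmersion (𝒰.f i) hVU₂).preimage _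
    obtain ⟨N, hN⟩ := exists_pow_mul_eq_zero_of_res_basicOpen_eq_zero_of_isAffineOpen _ haff
      (z.app V (Y.presheaf.map (homOfLE hVU₁).op s)) (z.app V (Y.presheaf.map (homOfLE hVU₁).op f)) <| by
        have hle : (I i).subscheme.basicOpen (z.app V (Y.presheaf.map (homOfLE hVU₁).op f)) ≤
            z ⁻¹ᵁ (Y.basicOpen f) := by
          rw [← Scheme.preimage_basicOpen]
          refine z.preimage_mono ?_
          rw [Scheme.basicOpen_res]
          exact inf_le_right
        have := congr((I i).subscheme.presheaf.map (homOfLE hle).op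
          $((app_res z (Y.basicOpen_le f) s).symm.trans (hs i)))
        rw [map_zero] at this
        refine .trans ?_ ((res_res _ _ _).symm.trans this)
        exact (congr((I i).subscheme.presheaf.map _ $(app_res z hVU₁ s))).trans (res_res _ _ _)
    refine ⟨V, hVU₁, N, hxV, fun j ↦ app_eq_zero_of_compatible 𝒰 I hI hVU₂ _ ?_ j⟩
    rw [map_mul, map_pow, map_mul, map_pow]
    exact hN
  choose V hV N hxV hN using key
  obtain ⟨t, ht⟩ := U.2.isCompact.elim_finite_subcover (fun x ↦ (V x : Set Y))
    (fun x ↦ (V x).isOpen) fun x hx ↦ Set.mem_iUnion.mpr ⟨⟨x, hx⟩, hxV ⟨x, hx⟩⟩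
  refine ⟨t.sup N, fun j ↦ (I j).subscheme.IsSheaf.section_ext fun y hy ↦ ?_⟩
  obtain ⟨x, hx, hyx⟩ := Set.mem_iUnion₂.mp (ht hy)
  refine ⟨((I j).subschemeι ≫ 𝒰.f j) ⁻¹ᵁ (V x), Scheme.Hom.preimage_mono _ (hV x), hyx, ?_⟩
  have h₁ : N x ≤ t.sup N := Finset.le_sup hx
  have h₂ : f ^ (t.sup N) * s = f ^ (t.sup N - N x) * (f ^ N x * s) := by
    rw [← mul_assoc, ← pow_add, Nat.sub_add_cancel h₁]
  refine (app_res _ (hV x) _).symm.trans ?_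
  rw [map_zero, h₂, map_mul, map_mul, hN, mul_zero]

/-- The ideal sheaf glued from compatible ideal sheaves on the members of an open cover. -/
def glueIdeal (hI : ∀ i j, (I i).comap (pullback.fst (𝒰.f i) (𝒰.f j)) =
      (I j).comap (pullback.snd (𝒰.f i) (𝒰.f j))) : Y.IdealSheafData :=
  ⟨fun U ↦ ⨅ i, RingHom.ker (((I i).subschemeι ≫ 𝒰.f i).app U).hom, by
    intro U f
    apply le_antisymm
    · refine Ideal.map_le_iff_le_comap.mpr ?_
      intro s hs
      simp only [Ideal.mem_iInf, RingHom.mem_ker] at hs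
      refine Ideal.mem_iInf.mpr fun i ↦ ?_
      refine (app_res _ _ s).trans ?_
      rw [hs i, map_zero]
    · intro s hs
      replace hs (i) : ((I i).subschemeι ≫ 𝒰.f i).app (Y.basicOpen f) s = 0 :=
        Ideal.mem_iInf.mp hs i
      have := U.2.isLocalization_basicOpen f
      obtain ⟨⟨s', _, N, rfl⟩, e⟩ := IsLocalization.surj (Submonoid.powers f) s
      replace e : s * (Y.presheaf.map (homOfLE (Y.basicOpen_le f)).op (f ^ N)) =
        Y.presheaf.map (homOfLE (Y.basicOpen_le f)).op s' := e
      -- Localization need not commute with an infinite intersection of ideals; the exponent `M`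
      -- common to the whole cover makes it do so here.
      obtain ⟨M, hM⟩ := exists_pow_mul_app_eq_zero 𝒰 I hI U f s' fun j ↦ by
        rw [← e, map_mul]
        exact mul_eq_zero_of_left (hs j) _
      have hunit : IsUnit (Y.presheaf.map (homOfLE (Y.basicOpen_le f)).op f) :=
        RingedSpace.isUnit_res_basicOpen _ f
      refine (Ideal.mul_unit_mem_iff_mem _ ((hunit.pow N).mul (hunit.pow M))).mp ?_
      have : s * (Y.presheaf.map (homOfLE (Y.basicOpen_le f)).op f ^ N *
          Y.presheaf.map (homOfLE (Y.basicOpen_le f)).op f ^ M) =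
          Y.presheaf.map (homOfLE (Y.basicOpen_le f)).op (f ^ M * s') := by
        rw [map_mul, ← e, map_pow, map_pow]
        ring
      rw [this]
      refine Ideal.mem_map_of_mem _ ?_
      simpa only [Ideal.mem_iInf, RingHom.mem_ker] using hM, _, rfl⟩

lemma mem_comap_ideal_iff {X : Scheme.{u}} (f : X ⟶ Y) [IsOpenImmersion f] (J : Y.IdealSheafData)
    (W : X.affineOpens) (s : Γ(X, W)) : s ∈ (J.comap f).ideal W ↔
      (f.appIso W).inv s ∈ J.ideal ⟨f ''ᵁ W, W.2.image_of_isOpenImmersion _⟩ := by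
  have := Scheme.ker_ideal_of_isPullback_of_isOpenImmersion _ _ _ _ (isPullback_comap f J) W
  rw [Scheme.IdealSheafData.ker_subschemeι, Scheme.IdealSheafData.ker_subschemeι] at this
  rw [this]
  rfl

/-- On opens inside the `i`-th chart the intersection of all the kernels is the `i`-th kernel, by
`app_eq_zero_of_compatible`. -/
lemma glueIdeal_comap (hI : ∀ i j, (I i).comap (pullback.fst (𝒰.f i) (𝒰.f j)) =
      (I j).comap (pullback.snd (𝒰.f i) (𝒰.f j))) (i) : (glueIdeal 𝒰 I hI).comap (𝒰.f i) = I i := by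
  ext W s
  rw [mem_comap_ideal_iff, ← (I i).ker_subschemeι_app W, RingHom.mem_ker]
  have h₁ : (𝒰.f i).app (𝒰.f i ''ᵁ W) (((𝒰.f i).appIso W).inv s) =
      (𝒰.X i).presheaf.map (homOfLE ((𝒰.f i).preimage_image_eq W.1).le).op s :=
    congr($((𝒰.f i).appIso_inv_app W) s)
  have h₂ : ((I i).subschemeι ≫ 𝒰.f i).app (𝒰.f i ''ᵁ W) (((𝒰.f i).appIso W).inv s) = 0 ↔
      (I i).subschemeι.app W s = 0 := by
    rw [show ((I i).subschemeι ≫ 𝒰.f i).app (𝒰.f i ''ᵁ W) (((𝒰.f i).appIso W).inv s) = _ from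
      (comp_app_apply (I i).subschemeι (𝒰.f i) _ _).trans
        (congr((I i).subschemeι.app _ $h₁).trans (app_res _ _ s))]
    have : IsIso ((I i).subscheme.presheaf.map (homOfLE ((I i).subschemeι.preimage_mono
      ((𝒰.f i).preimage_image_eq W.1).le)).op) := by
      have e := congr((I i).subschemeι ⁻¹ᵁ $((𝒰.f i).preimage_image_eq W.1))
      rw [show (homOfLE ((I i).subschemeι.preimage_mono ((𝒰.f i).preimage_image_eq W.1).le)) =
        eqToHom e from rfl]
      infer_instance
    exact map_eq_zero_iff _ (ConcreteCategory.bijective_of_isIso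
      ((I i).subscheme.presheaf.map (homOfLE ((I i).subschemeι.preimage_mono
      ((𝒰.f i).preimage_image_eq W.1).le)).op)).1
  change _ ∈ ⨅ i, RingHom.ker (((I i).subschemeι ≫ 𝒰.f i).app _).hom ↔ _
  simp only [Ideal.mem_iInf, RingHom.mem_ker]
  refine Iff.trans ⟨fun h ↦ h i, fun h j ↦ ?_⟩ h₂
  exact app_eq_zero_of_compatible 𝒰 I hI ((𝒰.f i).image_le_opensRange W) _ h j

lemma idealSheafData_ext_of_openCover {J J' : Y.IdealSheafData}
    (h : ∀ i, J.comap (𝒰.f i) = J'.comap (𝒰.f i)) : J = J' := by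
  refine Scheme.IdealSheafData.ext_of_iSup_eq_top
    (fun W : Σ i, (𝒰.X i).affineOpens ↦ ⟨𝒰.f W.1 ''ᵁ W.2, W.2.2.image_of_isOpenImmersion _⟩)
    (eq_top_iff.mpr fun y _ ↦ ?_) fun ⟨i, W⟩ ↦ ?_
  · obtain ⟨i, x, rfl⟩ := 𝒰.exists_eq y
    obtain ⟨_, ⟨W, hW, rfl⟩, hxW, -⟩ := (𝒰.X i).isBasis_affineOpens.exists_subset_of_mem_open
      (Set.mem_univ x) isOpen_univ
    exact Opens.mem_iSup.mpr ⟨⟨i, W, hW⟩, x, hxW, rfl⟩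
  · ext s
    obtain ⟨s, rfl⟩ := (ConcreteCategory.bijective_of_isIso ((𝒰.f i).appIso W).inv).2 s
    have := mem_comap_ideal_iff (𝒰.f i) J W s
    rw [h i] at this
    exact this.symm.trans (mem_comap_ideal_iff (𝒰.f i) J' W s)

end GlueIdeal

/-! ### Bases of the direct image of a structure sheaf. -/

section Frames

lemma bijective_linearCombination_iff {C C' E E' : Type u} [CommRing C] [CommRing C'] [CommRing E]
    [CommRing E'] {n : ℕ} {α : C →+* E} {α' : C' →+* E'} {σ : C →+* C'} {τ : E →+* E'}
    (hσ : Function.Bijective σ) (hτ : Function.Bijective τ) (h : ∀ c, τ (α c) = α' (σ c))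
    {e : Fin n → E} {e' : Fin n → E'} (he : ∀ i, τ (e i) = e' i) :
    Function.Bijective (linearCombination α e) ↔ Function.Bijective (linearCombination α' e') := by
  have key (a) : linearCombination α' e' (σ ∘ a) = τ (linearCombination α e a) := by
    simp [linearCombination, h, he]
  have hσ' : Function.Bijective fun a : Fin n → C ↦ σ ∘ a :=
    ⟨hσ.1.comp_left, hσ.2.comp_left⟩
  rw [← Function.Bijective.of_comp_iff (linearCombination α' e') hσ',
    ← Function.Bijective.of_comp_iff' hτ]
  exact iff_of_eq (congrArg _ (funext fun a ↦ (key a).symm))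

lemma linearCombination_vecMul {C E : Type u} [CommRing C] [CommRing E] {n : ℕ} (α : C →+* E)
    {e b : Fin n → E} (M : Matrix (Fin n) (Fin n) C) (hb : ∀ i, b i = linearCombination α e (M i))
    (a : Fin n → C) : linearCombination α b a = linearCombination α e (Matrix.vecMul a M) := by
  have : Matrix.vecMul a M = ∑ i, a i • M i := by
    ext j
    simp [Matrix.vecMul, dotProduct]
  rw [this, linearCombination_sum]
  simp_rw [linearCombination_smul, ← hb]
  rfl

variable {Z T Z' T' : Scheme.{u}} {n : ℕ}

/-- The sections `e` form a basis of `π_* 𝒪_Z`. -/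
def IsFrame (π : Z ⟶ T) (e : Fin n → Γ(Z, ⊤)) : Prop :=
  ∀ V : T.Opens, Function.Bijective (linearCombination (π.app V).hom
    fun i ↦ Z.presheaf.map (homOfLE (le_top : π ⁻¹ᵁ V ≤ ⊤)).op (e i))

lemma combination_eq_linearCombination (π : Z ⟶ T) {U : T.Opens} (e : Fin n → Γ(Z, π ⁻¹ᵁ U))
    {V : T.Opens} (h : V ≤ U) : combination π e h = linearCombination (π.app V).hom
      fun i ↦ Z.presheaf.map (homOfLE (π.preimage_mono h)).op (e i) := rfl

lemma IsFrame.bijective_top {π : Z ⟶ T} {e : Fin n → Γ(Z, ⊤)} (h : IsFrame π e) :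
    Function.Bijective (linearCombination π.appTop.hom e) := by
  have h' : Function.Bijective (linearCombination π.appTop.hom fun i ↦ Z.presheaf.map (𝟙 _) (e i)) :=
    h ⊤
  simpa using h'

section Local

variable (π : Z ⟶ T) {U : T.Opens} (e : Fin n → Γ(Z, π ⁻¹ᵁ U))

/-- Local coordinates are unique, so they agree on overlaps and glue in the structure sheaf of `T`.
That the glued combination is the given section is checked locally on `Z`. -/
lemma bijective_combination_of_local
    (H : ∀ t ∈ U, ∃ (W : T.Opens) (_ : t ∈ W) (_ : W ≤ U), ∀ (V : T.Opens) (_ : V ≤ W)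
      (h : V ≤ U), Function.Bijective (combination π e h)) {V : T.Opens} (h : V ≤ U) :
    Function.Bijective (combination π e h) := by
  let ι (V : T.Opens) := {W : T.Opens // W ≤ V ∧ ∀ (V' : T.Opens) (_ : V' ≤ W) (h : V' ≤ U),
    Function.Bijective (combination π e h)}
  have hcov (V : T.Opens) (h : V ≤ U) : V ≤ ⨆ W : ι V, W.1 := by
    intro t ht
    obtain ⟨W, htW, -, hW⟩ := H t (h ht)
    exact Opens.mem_iSup.mpr ⟨⟨W ⊓ V, inf_le_right, fun V' hV' h ↦ hW V' (hV'.trans inf_le_left) h⟩,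
      htW, ht⟩
  have inj {V : T.Opens} (h : V ≤ U) : Function.Injective (combination π e h) := by
    intro a b hab
    funext i
    refine T.sheaf.eq_of_locally_eq' _ V (fun W : ι V ↦ homOfLE W.2.1) (hcov V h) _ _ fun W ↦ ?_
    exact congr_fun ((W.2.2 W.1 le_rfl (W.2.1.trans h)).1 (((combination_res π e h W.2.1 a).trans
      congr(Z.presheaf.map _ $hab)).trans (combination_res π e h W.2.1 b).symm)) i
  refine ⟨inj h, fun z ↦ ?_⟩
  choose a ha using fun W : ι V ↦ (W.2.2 W.1 le_rfl (W.2.1.trans h)).2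
    (Z.presheaf.map (homOfLE (π.preimage_mono W.2.1)).op z)
  have hc (i) (W W' : ι V) :
      T.presheaf.map (homOfLE (inf_le_left : W.1 ⊓ W'.1 ≤ W.1)).op (a W i) =
        T.presheaf.map (homOfLE (inf_le_right : W.1 ⊓ W'.1 ≤ W'.1)).op (a W' i) := by
    refine congr_fun (inj (inf_le_left.trans (W.2.1.trans h))
      (a₁ := fun i ↦ T.presheaf.map (homOfLE (inf_le_left : W.1 ⊓ W'.1 ≤ W.1)).op (a W i))
      (a₂ := fun i ↦ T.presheaf.map (homOfLE (inf_le_right : W.1 ⊓ W'.1 ≤ W'.1)).op (a W' i)) ?_) i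
    refine (combination_res π e (W.2.1.trans h) inf_le_left (a W)).trans
      (.trans ?_ (combination_res π e (W'.2.1.trans h) inf_le_right (a W')).symm)
    rw [ha, ha, ← CommRingCat.comp_apply, ← CommRingCat.comp_apply, ← Functor.map_comp,
      ← Functor.map_comp]
    rfl
  choose b hb using fun i ↦ (T.sheaf.existsUnique_gluing'
    (fun W : ι V ↦ W.1) V (fun W ↦ homOfLE W.2.1) (hcov V h) (fun W ↦ a W i) (hc i)).exists
  refine ⟨b, Z.sheaf.eq_of_locally_eq' (fun W : ι V ↦
    π ⁻¹ᵁ W.1) _ (fun W ↦ homOfLE (π.preimage_mono W.2.1)) ?_ _ _ fun W ↦ ?_⟩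
  · intro x hx
    obtain ⟨W, hW⟩ := Opens.mem_iSup.mp (hcov V h hx)
    exact Opens.mem_iSup.mpr ⟨W, hW⟩
  · refine (combination_res π e h W.2.1 b).symm.trans (.trans ?_ (ha W))
    congr 1
    funext i
    exact hb i W

end Local

lemma isFrame_of_local (π : Z ⟶ T) (e : Fin n → Γ(Z, ⊤))
    (H : ∀ t : T, ∃ W : T.Opens, t ∈ W ∧ ∀ V ≤ W, IsAffineOpen V →
      Function.Bijective (linearCombination (π.app V).hom
        fun i ↦ Z.presheaf.map (homOfLE (le_top : π ⁻¹ᵁ V ≤ ⊤)).op (e i))) : IsFrame π e := by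
  intro V
  refine bijective_combination_of_local π (U := ⊤) e (fun t _ ↦ ?_) le_top
  obtain ⟨W, htW, hW⟩ := H t
  refine ⟨W, htW, le_top, fun V hVW h ↦ ?_⟩
  have := bijective_combination π (U := W)
    (fun i ↦ Z.presheaf.map (homOfLE (le_top : π ⁻¹ᵁ W ≤ ⊤)).op (e i)) (fun {V} hV hVa ↦ ?_) hVW
  · rw [combination_eq_linearCombination] at this
    change Function.Bijective (linearCombination (π.app V).hom
      fun i ↦ Z.presheaf.map (homOfLE (le_top : π ⁻¹ᵁ V ≤ ⊤)).op (e i))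
    convert this with i
    exact (res_res _ _ _).symm
  · rw [combination_eq_linearCombination]
    convert hW V hV hVa with i
    exact res_res _ _ _

section Pullback

variable {π : Z ⟶ T} {g : T' ⟶ T} {g' : Z' ⟶ Z} {π' : Z' ⟶ T'}

lemma preimage_le_of_isPullback (H : IsPullback g' π' π g) {U : T.Opens} {V : T'.Opens}
    (hV : V ≤ g ⁻¹ᵁ U) : π' ⁻¹ᵁ V ≤ g' ⁻¹ᵁ π ⁻¹ᵁ U := by
  rw [← Scheme.Hom.comp_preimage, H.w]
  exact π'.preimage_mono hV

/-- Over affine opens the functions on the fibre product form a pushout of rings, and a basis stays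
a basis after base change (`bijective_of_isPushout`). -/
lemma bijective_linearCombination_of_isPullback [IsAffineHom π] (H : IsPullback g' π' π g)
    {U : T.Opens} (hU : IsAffineOpen U) {e : Fin n → Γ(Z, π ⁻¹ᵁ U)}
    (he : Function.Bijective (linearCombination (π.app U).hom e)) {V : T'.Opens}
    (hVa : IsAffineOpen V) (hV : V ≤ g ⁻¹ᵁ U) :
    Function.Bijective (linearCombination (π'.app V).hom fun i ↦
      g'.appLE (π ⁻¹ᵁ U) (π' ⁻¹ᵁ V) (preimage_le_of_isPullback H hV) (e i)) := by
  have hp := (isIso_pushoutSection_iff H hV le_rfl (UX := π ⁻¹ᵁ U) (UY := π' ⁻¹ᵁ V)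
    (inf_eq_right.mpr (preimage_le_of_isPullback H hV)).symm).mp
      (isIso_pushoutSection_of_isAffineOpen _ _ _ _ hU hVa (hU.preimage π))
  have := bijective_of_isPushout hp e (by
    rw [Scheme.Hom.appLE_eq_app]
    exact he)
  rw [Scheme.Hom.appLE_eq_app] at this
  exact this

/-- Frames are stable under base change. -/
lemma IsFrame.of_isPullback [IsAffineHom π] (H : IsPullback g' π' π g) {e : Fin n → Γ(Z, ⊤)}
    (he : IsFrame π e) : IsFrame π' fun i ↦ g'.appTop (e i) := by
  refine isFrame_of_local _ _ fun t' ↦ ?_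
  obtain ⟨_, ⟨U, hU, rfl⟩, htU, -⟩ :=
    T.isBasis_affineOpens.exists_subset_of_mem_open (Set.mem_univ (g t')) isOpen_univ
  refine ⟨g ⁻¹ᵁ U, htU, fun V hV hVa ↦ ?_⟩
  convert bijective_linearCombination_of_isPullback H hU (he U) hVa hV with i
  have h₁ : (Z.presheaf.map (homOfLE le_top).op ≫ g'.appLE (π ⁻¹ᵁ U) (π' ⁻¹ᵁ V)
      (preimage_le_of_isPullback H hV)) = g'.appTop ≫ Z'.presheaf.map (homOfLE le_top).op := by
    rw [Scheme.Hom.map_appLE, Scheme.Hom.appLE]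
    rfl
  exact congr($h₁.symm (e i))

/-- A basis of the sections of an affine morphism over an affine scheme is a frame. -/
lemma isFrame_of_bijective [IsAffineHom π] [IsAffine T] {e : Fin n → Γ(Z, ⊤)}
    (he : Function.Bijective (linearCombination π.appTop.hom e)) : IsFrame π e := by
  refine isFrame_of_local _ _ fun t' ↦ ⟨⊤, trivial, fun V _ hVa ↦ ?_⟩
  -- Restriction from `T` to the affine open `V` is treated as base change along the identity of
  -- `T`.
  convert bijective_linearCombination_of_isPullback (IsPullback.id_horiz π) (isAffineOpen_top T)
    he hVa le_top with i
  have h₁ : (𝟙 Z : Z ⟶ Z).appLE ⊤ (π ⁻¹ᵁ V) le_top = Z.presheaf.map (homOfLE le_top).op := by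
    simp [Scheme.Hom.appLE]
  exact congr($h₁.symm (e i))

/-- A locally free direct image has frames locally on the base. -/
lemma IsLocallyFreeOfRank.exists_isFrame [IsAffineHom π] (h : IsLocallyFreeOfRank n π) (t : T) :
    ∃ U : T.Opens, IsAffineOpen U ∧ t ∈ U ∧ ∀ {Z' : Scheme.{u}} {g' : Z' ⟶ Z} {π' : Z' ⟶ U},
      IsPullback g' π' π U.ι → ∃ e : Fin n → Γ(Z', ⊤), IsFrame π' e := by
  obtain ⟨U, hU, e, he⟩ := h t
  obtain ⟨_, ⟨U₀, hU₀, rfl⟩, htU₀, hU₀U⟩ :=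
    T.isBasis_affineOpens.exists_subset_of_mem_open hU U.isOpen
  refine ⟨U₀, hU₀, htU₀, fun {Z' g' π'} H ↦ ?_⟩
  let U₁ : T.Opens := U₀
  have hle : (⊤ : U₁.toScheme.Opens) ≤ U₁.ι ⁻¹ᵁ U₀ := by
    rw [Scheme.Opens.ι_preimage_self]
  refine ⟨fun i ↦ g'.appLE (π ⁻¹ᵁ U₀) (π' ⁻¹ᵁ ⊤) (preimage_le_of_isPullback H hle)
    (Z.presheaf.map (homOfLE (π.preimage_mono hU₀U)).op (e i)), ?_⟩
  have : IsAffineHom π' := MorphismProperty.of_isPullback H ‹_›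
  have : IsAffine U₁.toScheme := hU₀
  exact isFrame_of_bijective
    (bijective_linearCombination_of_isPullback H hU₀ (he U₀ hU₀U) (isAffineOpen_top _) hle)

/-- Over opens in the range, `g` and `g'` are isomorphisms on sections, so bijectivity is reflected
as well as preserved. This is what allows descent from an open cover. -/
lemma bijective_linearCombination_iff_of_isOpenImmersion [IsOpenImmersion g]
    (H : IsPullback g' π' π g) {V : T.Opens} (hV : V ≤ g.opensRange) (e : Fin n → Γ(Z, π ⁻¹ᵁ V)) :
    Function.Bijective (linearCombination (π.app V).hom e) ↔
      Function.Bijective (linearCombination (π'.app (g ⁻¹ᵁ V)).hom fun i ↦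
        g'.appLE (π ⁻¹ᵁ V) (π' ⁻¹ᵁ g ⁻¹ᵁ V) (preimage_le_of_isPullback H le_rfl) (e i)) := by
  have : IsOpenImmersion g' := MorphismProperty.of_isPullback H.flip ‹_›
  have h₁ : IsIso (g.app V) := g.isIso_app _ hV
  have hr : π ⁻¹ᵁ V ≤ g'.opensRange := by
    intro z hz
    obtain ⟨t, ht⟩ := hV hz
    obtain ⟨y, hy, -⟩ := Scheme.exists_preimage_of_isPullback H z t ht.symm
    exact ⟨y, hy⟩
  have h₂ : IsIso (g'.app (π ⁻¹ᵁ V)) := g'.isIso_app _ hr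
  have heq : π' ⁻¹ᵁ g ⁻¹ᵁ V = g' ⁻¹ᵁ π ⁻¹ᵁ V := by
    rw [← Scheme.Hom.comp_preimage, ← Scheme.Hom.comp_preimage, H.w]
  have h₃ : IsIso (g'.appLE (π ⁻¹ᵁ V) (π' ⁻¹ᵁ g ⁻¹ᵁ V) (preimage_le_of_isPullback H le_rfl)) := by
    have : IsIso (Z'.presheaf.map (homOfLE heq.le).op) := by
      rw [show homOfLE heq.le = eqToHom heq from rfl]
      infer_instance
    rw [Scheme.Hom.appLE]
    infer_instance
  refine bijective_linearCombination_iff (σ := (g.app V).hom) (τ := (g'.appLE (π ⁻¹ᵁ V)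
    (π' ⁻¹ᵁ g ⁻¹ᵁ V) (preimage_le_of_isPullback H le_rfl)).hom)
    (ConcreteCategory.bijective_of_isIso (g.app V)) (ConcreteCategory.bijective_of_isIso
      (g'.appLE (π ⁻¹ᵁ V) (π' ⁻¹ᵁ g ⁻¹ᵁ V) (preimage_le_of_isPullback H le_rfl)))
    (fun c ↦ ?_) fun i ↦ rfl
  have w : π.app V ≫ g'.appLE (π ⁻¹ᵁ V) (π' ⁻¹ᵁ g ⁻¹ᵁ V) (preimage_le_of_isPullback H le_rfl) =
      g.app V ≫ π'.app (g ⁻¹ᵁ V) := by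
    rw [← Scheme.Hom.appLE_eq_app, ← Scheme.Hom.appLE_eq_app, ← Scheme.Hom.appLE_eq_app,
      Scheme.Hom.appLE_comp_appLE, Scheme.Hom.appLE_comp_appLE]
    simp only [H.w]
  exact congr($w c)

/-- Being a frame is local on the base. -/
lemma isFrame_of_openCover {e : Fin n → Γ(Z, ⊤)} (H : ∀ t : T, ∃ (T' Z' : Scheme.{u}) (g : T' ⟶ T)
    (g' : Z' ⟶ Z) (π' : Z' ⟶ T') (_ : IsOpenImmersion g), IsPullback g' π' π g ∧
      t ∈ g.opensRange ∧ IsFrame π' fun i ↦ g'.appTop (e i)) : IsFrame π e := by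
  refine isFrame_of_local _ _ fun t ↦ ?_
  obtain ⟨T', Z', g, g', π', _, hp, ht, he⟩ := H t
  refine ⟨g.opensRange, ht, fun V hV _ ↦ ?_⟩
  rw [bijective_linearCombination_iff_of_isOpenImmersion hp hV]
  convert he (g ⁻¹ᵁ V) with i
  have h₁ : (Z.presheaf.map (homOfLE le_top).op ≫ g'.appLE (π ⁻¹ᵁ V) (π' ⁻¹ᵁ g ⁻¹ᵁ V)
      (preimage_le_of_isPullback hp le_rfl)) =
        g'.appTop ≫ Z'.presheaf.map (homOfLE le_top).op := by
    rw [Scheme.Hom.map_appLE, Scheme.Hom.appLE]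
    rfl
  exact congr($h₁ (e i))

/-- Local freeness is local on the base. -/
lemma isLocallyFreeOfRank_of_openCover (H : ∀ t : T, ∃ (T' Z' : Scheme.{u}) (g : T' ⟶ T)
    (g' : Z' ⟶ Z) (π' : Z' ⟶ T') (_ : IsOpenImmersion g), IsPullback g' π' π g ∧
      t ∈ g.opensRange ∧ IsLocallyFreeOfRank n π') : IsLocallyFreeOfRank n π := by
  intro t
  obtain ⟨T', Z', g, g', π', _, hp, ⟨t', rfl⟩, h⟩ := H t
  obtain ⟨U', ht', e', he'⟩ := h t'
  have : IsOpenImmersion g' := MorphismProperty.of_isPullback hp.flip ‹_›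
  have hU' : g ⁻¹ᵁ g ''ᵁ U' = U' := g.preimage_image_eq U'
  have hiso : IsIso (g'.appLE (π ⁻¹ᵁ g ''ᵁ U') (π' ⁻¹ᵁ U')
      (preimage_le_of_isPullback hp hU'.ge)) := by
    have hr : π ⁻¹ᵁ g ''ᵁ U' ≤ g'.opensRange := by
      rintro z ⟨t, -, ht⟩
      obtain ⟨y, hy, -⟩ := Scheme.exists_preimage_of_isPullback hp z t ht.symm
      exact ⟨y, hy⟩
    have h₂ : IsIso (g'.app (π ⁻¹ᵁ g ''ᵁ U')) := g'.isIso_app _ hr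
    have heq : π' ⁻¹ᵁ U' = g' ⁻¹ᵁ π ⁻¹ᵁ g ''ᵁ U' := by
      rw [← Scheme.Hom.comp_preimage, hp.w, Scheme.Hom.comp_preimage, hU']
    have : IsIso (Z'.presheaf.map (homOfLE heq.le).op) := by
      rw [show homOfLE heq.le = eqToHom heq from rfl]
      infer_instance
    rw [Scheme.Hom.appLE]
    infer_instance
  choose e he using fun i ↦ (ConcreteCategory.bijective_of_isIso (g'.appLE (π ⁻¹ᵁ g ''ᵁ U')
    (π' ⁻¹ᵁ U') (preimage_le_of_isPullback hp hU'.ge))).2 (e' i)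
  refine ⟨g ''ᵁ U', ⟨t', ht', rfl⟩, e, fun V hV ↦ ?_⟩
  have hVU' : g ⁻¹ᵁ V ≤ U' := (g.preimage_mono hV).trans hU'.le
  refine (bijective_linearCombination_iff_of_isOpenImmersion hp
    (hV.trans (g.image_le_opensRange U')) _).mpr ?_
  convert he' (g ⁻¹ᵁ V) hVU' with a
  refine Finset.sum_congr rfl fun i _ ↦ congr(_ * $(?_))
  rw [← he i, ← CommRingCat.comp_apply, ← CommRingCat.comp_apply, Scheme.Hom.map_appLE,
    Scheme.Hom.appLE_map]

end Pullback

section ChangeOfFrame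

variable {π : Z ⟶ T} {e b : Fin n → Γ(Z, ⊤)} {M : Matrix (Fin n) (Fin n) Γ(T, ⊤)}

/-- Multiplication by `M` turns coordinates for `b` into coordinates for `e`, and `M` stays
invertible after restriction to any open. -/
lemma IsFrame.of_isUnit_det (he : IsFrame π e)
    (hb : ∀ i, b i = linearCombination π.appTop.hom e (M i)) (hM : IsUnit M.det) :
    IsFrame π b := by
  intro V
  let r := T.presheaf.map (homOfLE (le_top : V ≤ ⊤)).op
  let N : Matrix (Fin n) (Fin n) Γ(T, V) := M.map r
  have hN : IsUnit N := by
    rw [Matrix.isUnit_iff_isUnit_det, show N.det = r M.det from (RingHom.map_det r.hom M).symm]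
    exact hM.map r.hom
  have hb' (i) : Z.presheaf.map (homOfLE (le_top : π ⁻¹ᵁ V ≤ ⊤)).op (b i) =
      linearCombination (π.app V).hom
        (fun i ↦ Z.presheaf.map (homOfLE (le_top : π ⁻¹ᵁ V ≤ ⊤)).op (e i)) (N i) := by
    rw [hb i]
    simp only [linearCombination, map_sum, map_mul]
    refine Finset.sum_congr rfl fun j _ ↦ congr($(?_) * _)
    exact (app_res π le_top (M i j)).symm
  have := (he V).comp (f := fun a ↦ Matrix.vecMul a N)
    ⟨Matrix.vecMul_injective_of_isUnit hN, Matrix.vecMul_surjective_iff_isUnit.mpr hN⟩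
  convert this using 1
  exact funext fun a ↦ linearCombination_vecMul _ N hb' a

/-- Since `b` generates and coordinates for `e` are unique, multiplication by `M` is surjective on
row vectors, which makes the square matrix `M` invertible. -/
lemma IsFrame.isUnit_det (he : IsFrame π e)
    (hb : ∀ i, b i = linearCombination π.appTop.hom e (M i)) (hb' : IsFrame π b) :
    IsUnit M.det := by
  rw [← Matrix.isUnit_iff_isUnit_det, ← Matrix.vecMul_surjective_iff_isUnit]
  intro a
  obtain ⟨c, hc⟩ := hb'.bijective_top.2 (linearCombination π.appTop.hom e a)
  rw [linearCombination_vecMul _ M hb] at hc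
  exact ⟨c, he.bijective_top.1 hc⟩

end ChangeOfFrame

end Frames

/-! ### The Zariski sheaf property of the Hilbert functor. -/

lemma isZariskiLocalAtTarget_isFinite : IsZariskiLocalAtTarget @IsFinite.{u} := by
  have h : HasAffineProperty @IsFinite.{u} (affineAnd RingHom.Finite) :=
    (HasAffineProperty.affineAnd_iff _ RingHom.finite_respectsIso
      RingHom.finite_localizationPreserves.away RingHom.finite_ofLocalizationSpan).mpr
      fun f ↦ by simp [isFinite_iff]
  exact h.instIsZariskiLocalAtTarget

section Sheaf

variable {n : ℕ} {X S T : Scheme.{u}} (p : X ⟶ S)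

/-- The open cover of `T ×_S X` induced by an open cover of `T`. -/
def baseChangeCover (t : T ⟶ S) (𝒰 : Scheme.OpenCover.{u} T) :
    Scheme.OpenCover.{u} (pullback t p) :=
  Scheme.Cover.mkOfCovers 𝒰.I₀ (fun i ↦ pullback (𝒰.f i ≫ t) p)
    (fun i ↦ baseChangeMap p (𝒰.f i) rfl)
    (fun x ↦ by
      obtain ⟨i, y, hy⟩ := 𝒰.exists_eq (pullback.fst t p x)
      obtain ⟨z, hz, -⟩ := Scheme.exists_preimage_of_isPullback
        (isPullback_baseChangeMap p (𝒰.f i) rfl) x y hy.symm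
      exact ⟨i, z, hz⟩)
    (fun i ↦ MorphismProperty.of_isPullback (isPullback_baseChangeMap p (𝒰.f i) rfl).flip
      (𝒰.map_prop i))

/-- The hypothesis concerns overlaps in `T`, while gluing ideals requires overlaps in `T ×_S X`. The
morphism `m` sends the latter to the base change of the former, compatibly with both projections. -/
lemma HilbPoints.comap_eq_of_compatible {t : T ⟶ S} {𝒰 : Scheme.OpenCover.{u} T}
    {x : ∀ i, HilbPoints n p (𝒰.f i ≫ t)}
    (hx : ∀ i j, (x i).map (t' := pullback.fst (𝒰.f i) (𝒰.f j) ≫ 𝒰.f i ≫ t)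
      (pullback.fst (𝒰.f i) (𝒰.f j)) rfl =
        (x j).map (pullback.snd (𝒰.f i) (𝒰.f j)) (by rw [pullback.condition_assoc])) (i j) :
    (x i).ideal.comap (pullback.fst (baseChangeMap p (𝒰.f i) rfl) (baseChangeMap p (𝒰.f j) rfl)) =
      (x j).ideal.comap
        (pullback.snd (baseChangeMap p (𝒰.f i) rfl) (baseChangeMap p (𝒰.f j) rfl)) := by
  have w := pullback.condition (f := baseChangeMap p (𝒰.f i) (rfl : 𝒰.f i ≫ t = _))
    (g := baseChangeMap p (𝒰.f j) (rfl : 𝒰.f j ≫ t = _))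
  have w₁ := congr($w ≫ pullback.fst t p)
  have w₂ := congr($w ≫ pullback.snd t p)
  simp only [Category.assoc, baseChangeMap_fst, baseChangeMap_snd] at w₁ w₂
  let m : pullback (baseChangeMap p (𝒰.f i) (rfl : 𝒰.f i ≫ t = _))
      (baseChangeMap p (𝒰.f j) (rfl : 𝒰.f j ≫ t = _)) ⟶
      pullback (pullback.fst (𝒰.f i) (𝒰.f j) ≫ 𝒰.f i ≫ t) p :=
    pullback.lift (pullback.lift (pullback.fst _ _ ≫ pullback.fst _ p)
      (pullback.snd _ _ ≫ pullback.fst _ p) (by simpa using w₁)) (pullback.fst _ _ ≫ pullback.snd _ p)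
      (by rw [pullback.lift_fst_assoc, Category.assoc, pullback.condition, Category.assoc])
  have hm₁ : m ≫ pullback.fst _ p = pullback.lift (pullback.fst _ _ ≫ pullback.fst _ p)
      (pullback.snd _ _ ≫ pullback.fst _ p) (by simpa using w₁) := pullback.lift_fst _ _ _
  have hm₂ : m ≫ pullback.snd _ p = pullback.fst _ _ ≫ pullback.snd _ p := pullback.lift_snd _ _ _
  clear_value m
  have h₁ : m ≫ baseChangeMap p (pullback.fst (𝒰.f i) (𝒰.f j)) rfl = pullback.fst _ _ := by
    apply pullback.hom_ext
    · rw [Category.assoc, baseChangeMap_fst, reassoc_of% hm₁, pullback.lift_fst]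
    · rw [Category.assoc, baseChangeMap_snd, hm₂]
  have h₂ : m ≫ baseChangeMap p (pullback.snd (𝒰.f i) (𝒰.f j)) (by rw [pullback.condition_assoc]) =
      pullback.snd _ _ := by
    apply pullback.hom_ext
    · rw [Category.assoc, baseChangeMap_fst, reassoc_of% hm₁, pullback.lift_snd]
    · rw [Category.assoc, baseChangeMap_snd, hm₂, w₂]
  rw [← h₁, ← h₂, Scheme.IdealSheafData.comap_comp, Scheme.IdealSheafData.comap_comp]
  exact congr(($(hx i j)).ideal.comap m)

/-- The Hilbert functor of points is a sheaf for the Zariski topology. -/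
theorem isZariskiSheaf_hilb : IsZariskiSheaf (hilb n p) := by
  intro T 𝒰 x hx
  change ∀ i, HilbPoints n p (𝒰.f i ≫ T.hom) at x
  have hI := HilbPoints.comap_eq_of_compatible p (x := x) fun i j ↦
    hx i j (Over.mk (pullback.fst (𝒰.f i) (𝒰.f j) ≫ 𝒰.f i ≫ T.hom))
      (Over.homMk (pullback.fst (𝒰.f i) (𝒰.f j)))
      (Over.homMk (pullback.snd (𝒰.f i) (𝒰.f j)) (by simp [pullback.condition_assoc]))
      pullback.condition
  -- The ideal sheaves glue along the induced cover of `T ×_S X`; finiteness and local freeness of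
  -- the result are local on `T`.
  let I := glueIdeal (baseChangeCover p T.hom 𝒰) (fun i ↦ (x i).ideal) hI
  have hcomap (i) : I.comap (baseChangeMap p (𝒰.f i) rfl) = (x i).ideal :=
    glueIdeal_comap (baseChangeCover p T.hom 𝒰) (fun i ↦ (x i).ideal) hI i
  have hfin (i) : IsFinite ((I.comap (baseChangeMap p (𝒰.f i) rfl)).subschemeι ≫
      pullback.fst (𝒰.f i ≫ T.hom) p) := by
    rw [hcomap]; exact (x i).isFinite
  have hfree (i) : IsLocallyFreeOfRank n ((I.comap (baseChangeMap p (𝒰.f i) rfl)).subschemeι ≫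
      pullback.fst (𝒰.f i ≫ T.hom) p) := by
    rw [hcomap]; exact (x i).isLocallyFree
  let y : HilbPoints n p T.hom :=
    { ideal := I
      isFinite := by
        have := isZariskiLocalAtTarget_isFinite.{u}
        rw [IsZariskiLocalAtTarget.iff_of_openCover (P := @IsFinite) 𝒰]
        intro i
        have H := isPullback_comap_baseChangeMap p (𝒰.f i) rfl I
        have := hfin i
        have key : IsFinite (H.isoPullback.inv ≫ (I.comap (baseChangeMap p (𝒰.f i) rfl)).subschemeι ≫
          pullback.fst (𝒰.f i ≫ T.hom) p) := inferInstance
        rwa [H.isoPullback_inv_snd] at key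
      isLocallyFree := by
        refine isLocallyFreeOfRank_of_openCover fun t ↦ ?_
        obtain ⟨i, z, hz⟩ := 𝒰.exists_eq t
        exact ⟨_, _, 𝒰.f i, _, _, 𝒰.map_prop i, isPullback_comap_baseChangeMap p (𝒰.f i) rfl I,
          ⟨z, hz⟩, hfree i⟩ }
  refine ⟨y, fun i ↦ HilbPoints.ext (hcomap i), fun y' hy' ↦ HilbPoints.ext ?_⟩
  refine idealSheafData_ext_of_openCover (baseChangeCover p T.hom 𝒰) fun i ↦ ?_
  exact congr(HilbPoints.ideal $(hy' i)).trans (hcomap i).symm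

end Sheaf

/-! ### Morphisms to affine schemes, and the projections of a point of the Hilbert functor. -/

section SectionsHom

variable {A B : CommRingCat.{u}} {Y Y' : Scheme.{u}}

/-- The ring homomorphism corresponding to a morphism to an affine scheme. -/
def sectionsHom (f : Y ⟶ Spec B) : B →+* Γ(Y, ⊤) :=
  ((Scheme.ΓSpecIso B).inv ≫ f.appTop).hom

lemma appTop_sectionsHom (g : Y' ⟶ Y) (f : Y ⟶ Spec B) (x : B) :
    g.appTop (sectionsHom f x) = sectionsHom (g ≫ f) x := by
  simp only [sectionsHom, Scheme.Hom.comp_appTop]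
  rfl

lemma sectionsHom_comp_SpecMap (f : Y ⟶ Spec B) (φ : A ⟶ B) (a : A) :
    sectionsHom (f ≫ Spec.map φ) a = sectionsHom f (φ a) := by
  have : (Scheme.ΓSpecIso A).inv ≫ (Spec.map φ).appTop = φ ≫ (Scheme.ΓSpecIso B).inv :=
    (Scheme.ΓSpecIso_inv_naturality φ).symm
  rw [← appTop_sectionsHom]
  exact congr(f.appTop ($this a))

lemma sectionsHom_injective : Function.Injective (sectionsHom : (Y ⟶ Spec B) → _) := by
  intro f g h
  have h' : (Scheme.ΓSpecIso B).inv ≫ f.appTop = (Scheme.ΓSpecIso B).inv ≫ g.appTop :=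
    CommRingCat.hom_ext h
  exact ext_to_Spec h'

lemma sectionsHom_surjective : Function.Surjective (sectionsHom : (Y ⟶ Spec B) → _) := by
  intro ψ
  exact ⟨_, congr(($(ΓSpecIso_inv_ΓSpec_adjunction_homEquiv (CommRingCat.ofHom ψ))).hom)⟩

end SectionsHom

/-- The ring `D` is the tensor product of `B` and `C` over `A`, hence additively generated by
products of an element from `C` and one from `B`. -/
lemma isPushout_induction {A B C D : CommRingCat.{u}} {f : A ⟶ B} {g : A ⟶ C} {f' : B ⟶ D}
    {g' : C ⟶ D} (h : IsPushout f g f' g') {motive : D → Prop} (zero : motive 0)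
    (incl : ∀ b, motive (f' b)) (mul : ∀ c d, motive d → motive (g' c * d))
    (add : ∀ d d', motive d → motive d' → motive (d + d')) (d : D) : motive d := by
  algebraize [f.hom, g.hom, f'.hom, g'.hom, (f ≫ f').hom]
  have : IsScalarTower A C D := .of_algebraMap_eq' congr(($h.w).hom)
  have : IsScalarTower A B D := .of_algebraMap_eq' rfl
  have hP : Algebra.IsPushout A C B D := CommRingCat.isPushout_iff_isPushout.mp h.flip
  refine hP.out.inductionOn d _ zero incl (fun c d hd ↦ ?_) add
  rw [Algebra.smul_def]
  exact mul c d hd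

namespace HilbPoints

variable {n : ℕ} {X S T T' : Scheme.{u}} {p : X ⟶ S} {t' : T' ⟶ S} {t : T ⟶ S}

/-- The structure morphism of a point of the Hilbert functor. -/
def toBase (Z : HilbPoints n p t) : Z.ideal.subscheme ⟶ T :=
  Z.ideal.subschemeι ≫ pullback.fst t p

/-- The projection of a point of the Hilbert functor to the ambient scheme. -/
def toTotal (Z : HilbPoints n p t) : Z.ideal.subscheme ⟶ X :=
  Z.ideal.subschemeι ≫ pullback.snd t p

instance isFinite_toBase (Z : HilbPoints n p t) : IsFinite Z.toBase := Z.isFinite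

lemma toBase_comp (Z : HilbPoints n p t) : Z.toBase ≫ t = Z.toTotal ≫ p := by
  simp [toBase, toTotal, pullback.condition]

/-- The projection from a pullback of a point of the Hilbert functor. -/
def mapHom (g : T' ⟶ T) (e : g ≫ t = t') (Z : HilbPoints n p t) :
    (Z.map g e).ideal.subscheme ⟶ Z.ideal.subscheme :=
  Scheme.IdealSheafData.subschemeMap _ _ (baseChangeMap p g e) (Z.ideal.le_map_comap _)

lemma isPullback_mapHom (g : T' ⟶ T) (e : g ≫ t = t') (Z : HilbPoints n p t) :
    IsPullback (Z.mapHom g e) (Z.map g e).toBase Z.toBase g :=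
  isPullback_comap_baseChangeMap p g e Z.ideal

lemma mapHom_toTotal (g : T' ⟶ T) (e : g ≫ t = t') (Z : HilbPoints n p t) :
    Z.mapHom g e ≫ Z.toTotal = (Z.map g e).toTotal := by
  have h : Z.mapHom g e ≫ Z.ideal.subschemeι =
      (Z.map g e).ideal.subschemeι ≫ baseChangeMap p g e :=
    Scheme.IdealSheafData.subschemeMap_subschemeι _ _ _ _
  rw [toTotal, reassoc_of% h, baseChangeMap_snd]
  rfl

end HilbPoints

/-! ### The affine case: closed subschemes and their coordinates. -/

section Affine

variable {n : ℕ} {A B : CommRingCat.{u}} {φ : A ⟶ B} {T T' : Scheme.{u}} {t : T ⟶ Spec A}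
  {t' : T' ⟶ Spec A}

namespace HilbPoints

/-- The functions on a closed subscheme of `T ×_A B` induced by elements of `B`. -/
abbrev pull (Z : HilbPoints n (Spec.map φ) t) : B →+* Γ(Z.ideal.subscheme, ⊤) :=
  sectionsHom Z.toTotal

lemma toBase_sectionsHom (Z : HilbPoints n (Spec.map φ) t) (a : A) :
    Z.toBase.appTop (sectionsHom t a) = Z.pull (φ a) := by
  rw [appTop_sectionsHom, toBase_comp, sectionsHom_comp_SpecMap]

lemma mapHom_pull (g : T' ⟶ T) (e : g ≫ t = t') (Z : HilbPoints n (Spec.map φ) t) (x : B) :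
    (Z.mapHom g e).appTop (Z.pull x) = (Z.map g e).pull x := by
  rw [pull, appTop_sectionsHom, mapHom_toTotal]

/-- The elements `b` of `B` induce a basis of the functions on `Z`. -/
def IsFramed (b : Fin n → B) (Z : HilbPoints n (Spec.map φ) t) : Prop :=
  IsFrame Z.toBase fun i ↦ Z.pull (b i)

/-- The functions `c` are the coordinates of the elements of `B` with respect to `b`. -/
def HasCoordinates (b : Fin n → B) (Z : HilbPoints n (Spec.map φ) t)
    (c : B → Fin n → Γ(T, ⊤)) : Prop :=
  ∀ x, Z.pull x = linearCombination Z.toBase.appTop.hom (fun i ↦ Z.pull (b i)) (c x)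

lemma IsFramed.map {b : Fin n → B} {Z : HilbPoints n (Spec.map φ) t} (h : Z.IsFramed b)
    (g : T' ⟶ T) (e : g ≫ t = t') : (Z.map g e).IsFramed b := by
  have := IsFrame.of_isPullback (Z.isPullback_mapHom g e) h
  simp only [mapHom_pull] at this
  exact this

lemma mapHom_toBase (Z : HilbPoints n (Spec.map φ) t) (g : T' ⟶ T) (e : g ≫ t = t') (a : Γ(T, ⊤)) :
    (Z.mapHom g e).appTop (Z.toBase.appTop a) = (Z.map g e).toBase.appTop (g.appTop a) := by
  have := congr($((Z.isPullback_mapHom g e).w).appTop)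
  rw [Scheme.Hom.comp_appTop, Scheme.Hom.comp_appTop] at this
  exact congr($this a)

lemma mapHom_linearCombination (Z : HilbPoints n (Spec.map φ) t) (g : T' ⟶ T) (e : g ≫ t = t')
    (s : Fin n → Γ(Z.ideal.subscheme, ⊤)) (a : Fin n → Γ(T, ⊤)) :
    (Z.mapHom g e).appTop (linearCombination Z.toBase.appTop.hom s a) =
      linearCombination (Z.map g e).toBase.appTop.hom (fun i ↦ (Z.mapHom g e).appTop (s i))
        fun i ↦ g.appTop (a i) := by
  simp only [linearCombination, map_sum, map_mul]
  exact Finset.sum_congr rfl fun i _ ↦ congr($(Z.mapHom_toBase g e (a i)) * _)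

lemma HasCoordinates.map {b : Fin n → B} {Z : HilbPoints n (Spec.map φ) t}
    {c : B → Fin n → Γ(T, ⊤)} (h : Z.HasCoordinates b c) (g : T' ⟶ T) (e : g ≫ t = t') :
    (Z.map g e).HasCoordinates b fun x i ↦ g.appTop (c x i) := by
  intro x
  rw [← mapHom_pull, h x, mapHom_linearCombination]
  simp only [mapHom_pull]

lemma IsFramed.exists_hasCoordinates {b : Fin n → B} {Z : HilbPoints n (Spec.map φ) t}
    (h : Z.IsFramed b) : ∃ c, IsCoordinateMap φ.hom (sectionsHom t) b c ∧ Z.HasCoordinates b c :=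
  exists_isCoordinateMap Z.toBase.appTop.hom Z.pull Z.toBase_sectionsHom b h.bijective_top

lemma HasCoordinates.unique {b : Fin n → B} {Z : HilbPoints n (Spec.map φ) t} (h : Z.IsFramed b)
    {c c' : B → Fin n → Γ(T, ⊤)} (hc : Z.HasCoordinates b c) (hc' : Z.HasCoordinates b c') :
    c = c' :=
  funext fun x ↦ h.bijective_top.1 ((hc x).symm.trans (hc' x))

/-- Over an affine base, functions on a closed subscheme of `T ×_A B` are generated by those coming
from `B` and from the base. -/
lemma induction_of_isAffine [IsAffine T] {motive : Γ(pullback t (Spec.map φ), ⊤) → Prop}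
    (zero : motive 0) (incl : ∀ x : B, motive (sectionsHom (pullback.snd t (Spec.map φ)) x))
    (mul : ∀ c d, motive d → motive ((pullback.fst t (Spec.map φ)).appTop c * d))
    (add : ∀ d d', motive d → motive d' → motive (d + d')) (d) : motive d := by
  refine isPushout_induction (isPushout_appTop_of_isPullback
    (IsPullback.of_hasPullback t (Spec.map φ))).flip zero (fun x ↦ ?_) mul add d
  obtain ⟨x, rfl⟩ := (ConcreteCategory.bijective_of_isIso (Scheme.ΓSpecIso B).inv).2 x
  exact incl x

lemma appTop_subschemeι_fst (Z : HilbPoints n (Spec.map φ) t) (c : Γ(T, ⊤)) :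
    Z.ideal.subschemeι.appTop ((pullback.fst t (Spec.map φ)).appTop c) = Z.toBase.appTop c := by
  rw [toBase, Scheme.Hom.comp_appTop]
  rfl

/-- Functions on `T ×_A B` are generated by those from `T` and from `B`, so the images of each in
the functions on `Z` and on `Z'` have a common coordinate vector, built from `c`. As both are
framed, the images vanish simultaneously, and on an affine scheme global sections determine the
ideal sheaf. -/
lemma ext_of_hasCoordinates_of_isAffine [IsAffine T] {b : Fin n → B}
    {Z Z' : HilbPoints n (Spec.map φ) t} (h : Z.IsFramed b) (h' : Z'.IsFramed b)
    {c : B → Fin n → Γ(T, ⊤)} (hc : Z.HasCoordinates b c) (hc' : Z'.HasCoordinates b c) :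
    Z = Z' := by
  have key (d : Γ(pullback t (Spec.map φ), ⊤)) : ∃ v : Fin n → Γ(T, ⊤),
      Z.ideal.subschemeι.appTop d =
        linearCombination Z.toBase.appTop.hom (fun i ↦ Z.pull (b i)) v ∧
      Z'.ideal.subschemeι.appTop d =
        linearCombination Z'.toBase.appTop.hom (fun i ↦ Z'.pull (b i)) v := by
    refine induction_of_isAffine (motive := fun d ↦ ∃ v : Fin n → Γ(T, ⊤),
      Z.ideal.subschemeι.appTop d =
        linearCombination Z.toBase.appTop.hom (fun i ↦ Z.pull (b i)) v ∧
      Z'.ideal.subschemeι.appTop d =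
        linearCombination Z'.toBase.appTop.hom (fun i ↦ Z'.pull (b i)) v) ⟨0, by simp, by simp⟩
      (fun x ↦ ⟨c x, ?_, ?_⟩) ?_ ?_ d
    · rw [← hc x, appTop_sectionsHom]; rfl
    · rw [← hc' x, appTop_sectionsHom]; rfl
    · rintro r d ⟨v, hv, hv'⟩
      refine ⟨r • v, ?_, ?_⟩
      · rw [map_mul, hv, linearCombination_smul, appTop_subschemeι_fst]
      · rw [map_mul, hv', linearCombination_smul, appTop_subschemeι_fst]
    · rintro d d' ⟨v, hv, hv'⟩ ⟨w, hw, hw'⟩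
      exact ⟨v + w, by rw [map_add, hv, hw, linearCombination_add],
        by rw [map_add, hv', hw', linearCombination_add]⟩
  have hz (d) : Z.ideal.subschemeι.appTop d = 0 ↔ Z'.ideal.subschemeι.appTop d = 0 := by
    obtain ⟨v, hv, hv'⟩ := key d
    rw [hv, hv', ← linearCombination_zero Z.toBase.appTop.hom fun i ↦ Z.pull (b i),
      ← linearCombination_zero Z'.toBase.appTop.hom fun i ↦ Z'.pull (b i),
      h.bijective_top.1.eq_iff, h'.bijective_top.1.eq_iff]
  have : IsAffine (pullback t (Spec.map φ)) := inferInstance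
  ext1
  refine Scheme.IdealSheafData.ext_of_isAffine ?_
  ext d
  rw [← Scheme.IdealSheafData.ker_subschemeι_app, ← Scheme.IdealSheafData.ker_subschemeι_app]
  exact hz d

/-- By the sheaf property, equality may be tested on an affine cover of `T`. -/
lemma ext_of_hasCoordinates {b : Fin n → B}
    {Z Z' : HilbPoints n (Spec.map φ) t} (h : Z.IsFramed b) (h' : Z'.IsFramed b)
    {c : B → Fin n → Γ(T, ⊤)} (hc : Z.HasCoordinates b c) (hc' : Z'.HasCoordinates b c) :
    Z = Z' := by
  let 𝒰 := T.affineCover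
  refine (isZariskiSheaf_hilb (n := n) (Spec.map φ) (Over.mk t) 𝒰
    (fun i ↦ Z.map (𝒰.f i) rfl) ?_).unique (fun i ↦ rfl) (fun i ↦ ?_)
  · intro i j W a b hab
    refine (Z.map_comp (𝒰.f i) rfl a.left (Over.w a) (by rw [Category.assoc]; exact Over.w a)).symm.trans
      (.trans ?_ (Z.map_comp (𝒰.f j) rfl b.left (Over.w b)
        (by rw [Category.assoc]; exact Over.w b)))
    congr 1
  · have : IsAffine (𝒰.X i) := inferInstance
    exact ext_of_hasCoordinates_of_isAffine (T := 𝒰.X i) (h'.map _ _) (h.map _ _)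
      (hc'.map _ _) (hc.map _ _)

end HilbPoints

end Affine

lemma IsFrame.isLocallyFreeOfRank {Z T : Scheme.{u}} {π : Z ⟶ T} {n : ℕ} {e : Fin n → Γ(Z, ⊤)}
    (h : IsFrame π e) : IsLocallyFreeOfRank n π :=
  fun _ ↦ ⟨⊤, trivial, e, fun V _ ↦ h V⟩

lemma exists_comp_eq_ker_subschemeι {Y X : Scheme.{u}} (f : Y ⟶ X) [IsClosedImmersion f] :
    ∃ k : f.ker.subscheme ⟶ Y, IsIso k ∧ k ≫ f = f.ker.subschemeι := by
  have : IsIso f.toImage := inferInstance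
  refine ⟨(asIso f.toImage).inv, inferInstance, ?_⟩
  rw [Iso.inv_comp_eq]
  exact f.toImage_imageι.symm

/-- A point of the Hilbert functor records only an ideal sheaf. The isomorphism `k` identifies its
subscheme with `Y`, which transports finiteness and freeness. -/
lemma HilbPoints.exists_of_isClosedImmersion {n : ℕ} {X S T Y : Scheme.{u}} {p : X ⟶ S} {t : T ⟶ S}
    (f : Y ⟶ pullback t p) [IsClosedImmersion f] (hf : IsFinite (f ≫ pullback.fst t p))
    (hl : IsLocallyFreeOfRank n (f ≫ pullback.fst t p)) :
    ∃ Z : HilbPoints n p t, Z.ideal = f.ker ∧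
      ∃ k : Z.ideal.subscheme ⟶ Y, IsIso k ∧ k ≫ f = Z.ideal.subschemeι := by
  obtain ⟨k, _, hk⟩ := exists_comp_eq_ker_subschemeι f
  have H : IsPullback k (f.ker.subschemeι ≫ pullback.fst t p) (f ≫ pullback.fst t p) (𝟙 T) :=
    IsPullback.of_horiz_isIso ⟨by rw [← hk, Category.comp_id, Category.assoc]⟩
  exact ⟨⟨f.ker, MorphismProperty.of_isPullback H hf, hl.of_isPullback H⟩, rfl, k, inferInstance, hk⟩

section Affine

variable {n : ℕ} {A B C : CommRingCat.{u}} {φ : A ⟶ B} {T T' : Scheme.{u}} {t : T ⟶ Spec A}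
  {t' : T' ⟶ Spec A}

lemma sectionsHom_SpecMap (θ : A ⟶ C) (a : A) :
    sectionsHom (Spec.map θ) a = (Scheme.ΓSpecIso C).inv (θ a) :=
  congr($(Scheme.ΓSpecIso_inv_naturality θ) a).symm

lemma appTop_SpecMap (θ : A ⟶ C) (a : A) :
    (Spec.map θ).appTop ((Scheme.ΓSpecIso A).inv a) = (Scheme.ΓSpecIso C).inv (θ a) :=
  sectionsHom_SpecMap θ a

/-- The subscheme is the spectrum of the algebra `E` of `IsCoordinateMap.exists_algebra`. The images
of `b` span `E` over `C`, so `Spec E` is both closed in the fibre product and finite over `Spec C`.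
-/
lemma HilbPoints.exists_of_isCoordinateMap {θ : A ⟶ C} {b : Fin n → B} {c : B → Fin n → C}
    (h : IsCoordinateMap φ.hom θ.hom b c) :
    ∃ Z : HilbPoints n (Spec.map φ) (Spec.map θ), Z.IsFramed b ∧
      Z.HasCoordinates b fun x i ↦ (Scheme.ΓSpecIso C).inv (c x i) := by
  obtain ⟨E, α, β, hαβ, hc, hb⟩ := h.exists_algebra
  let α' : C ⟶ E := CommRingCat.ofHom α
  let β' : B ⟶ E := CommRingCat.ofHom β
  let f : Spec E ⟶ pullback (Spec.map θ) (Spec.map φ) :=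
    pullback.lift (Spec.map α') (Spec.map β') (by
      rw [← Spec.map_comp, ← Spec.map_comp]
      congr 1
      ext a
      exact hαβ a)
  have hf₁ : f ≫ pullback.fst _ _ = Spec.map α' := pullback.lift_fst _ _ _
  have hf₂ : f ≫ pullback.snd _ _ = Spec.map β' := pullback.lift_snd _ _ _
  have hfa (a : C) : f.appTop ((pullback.fst (Spec.map θ) (Spec.map φ)).appTop
      ((Scheme.ΓSpecIso C).inv a)) = (Scheme.ΓSpecIso E).inv (α a) := by
    have := congr(($hf₁).appTop ((Scheme.ΓSpecIso C).inv a))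
    rw [appTop_SpecMap, Scheme.Hom.comp_appTop] at this
    exact this
  have hfb (x : B) : f.appTop (sectionsHom (pullback.snd (Spec.map θ) (Spec.map φ)) x) =
      (Scheme.ΓSpecIso E).inv (β x) := by
    rw [appTop_sectionsHom, hf₂, sectionsHom_SpecMap]
    rfl
  have hfc : IsClosedImmersion f := by
    refine IsClosedImmersion.of_surjective_of_isAffine f fun y ↦ ?_
    obtain ⟨y, rfl⟩ := (ConcreteCategory.bijective_of_isIso (Scheme.ΓSpecIso E).inv).2 y
    obtain ⟨a, rfl⟩ := hb.2 y
    refine ⟨∑ i, (pullback.fst (Spec.map θ) (Spec.map φ)).appTop ((Scheme.ΓSpecIso C).inv (a i)) *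
      sectionsHom (pullback.snd (Spec.map θ) (Spec.map φ)) (b i), ?_⟩
    simp only [map_sum, map_mul, hfa, hfb, linearCombination]
  have hfin : IsFinite (f ≫ pullback.fst _ _) := by
    rw [hf₁, IsFinite.SpecMap_iff]
    algebraize [α]
    refine ⟨Submodule.fg_def.mpr ⟨Set.range fun i ↦ β (b i), Set.finite_range _,
      eq_top_iff.mpr fun y _ ↦ ?_⟩⟩
    obtain ⟨a, rfl⟩ := hb.2 y
    refine Submodule.sum_mem _ fun i _ ↦ ?_
    rw [← RingHom.algebraMap_toAlgebra α, ← Algebra.smul_def]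
    exact Submodule.smul_mem _ _ (Submodule.subset_span ⟨i, rfl⟩)
  have hframe : IsFrame (f ≫ pullback.fst _ _) fun i ↦ sectionsHom (f ≫ pullback.snd _ _) (b i) := by
    refine isFrame_of_bijective ((bijective_linearCombination_iff
      (σ := (Scheme.ΓSpecIso C).inv.hom) (τ := (Scheme.ΓSpecIso E).inv.hom)
      (ConcreteCategory.bijective_of_isIso (Scheme.ΓSpecIso C).inv)
      (ConcreteCategory.bijective_of_isIso (Scheme.ΓSpecIso E).inv) (fun a ↦ ?_) fun i ↦ ?_).mp hb)
    · rw [hf₁]; exact (appTop_SpecMap α' a).symm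
    · rw [← appTop_sectionsHom]; exact (hfb (b i)).symm
  obtain ⟨Z, -, k, hk, hkf⟩ := exists_of_isClosedImmersion f hfin hframe.isLocallyFreeOfRank
  have hkb : k ≫ f ≫ pullback.fst _ _ = Z.toBase := by rw [reassoc_of% hkf]; rfl
  have hkt : k ≫ f ≫ pullback.snd _ _ = Z.toTotal := by rw [reassoc_of% hkf]; rfl
  have H : IsPullback k Z.toBase (f ≫ pullback.fst _ _) (𝟙 _) :=
    IsPullback.of_horiz_isIso ⟨by rw [hkb, Category.comp_id]⟩
  have hpull (x : B) : k.appTop ((Scheme.ΓSpecIso E).inv (β x)) = Z.pull x := by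
    rw [← hfb, appTop_sectionsHom, appTop_sectionsHom, hkt]
  have hbase (a : C) : k.appTop ((Scheme.ΓSpecIso E).inv (α a)) =
      Z.toBase.appTop ((Scheme.ΓSpecIso C).inv a) := by
    rw [← hfa, ← hkb, Scheme.Hom.comp_appTop, Scheme.Hom.comp_appTop]
    rfl
  refine ⟨Z, ?_, fun x ↦ ?_⟩
  · have := hframe.of_isPullback H
    simp only [appTop_sectionsHom, hkt] at this
    exact this
  · rw [← hpull, hc x]
    simp only [linearCombination, map_sum, map_mul, hpull, hbase]

end Affine

/-! ### The affine case: universal framed subschemes and framed loci. -/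

/-- The images of the `c x` span `K ^ n`, so `n` of them form a basis. With `K` a residue field,
this finds a tuple that frames a given subscheme near a point. -/
lemma exists_det_ne_zero {R K B : Type*} [CommRing R] [Field K] (f : R →+* K) {n : ℕ}
    (c : B → Fin n → R) (hc : Submodule.span R (Set.range c) = ⊤) :
    ∃ b : Fin n → B, f (Matrix.of fun i ↦ c (b i)).det ≠ 0 := by
  let k (x : B) : Fin n → K := f ∘ c x
  have hmem (v : Fin n → R) : f ∘ v ∈ Submodule.span K (Set.range k) := by
    have hv : v ∈ Submodule.span R (Set.range c) := hc ▸ trivial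
    induction hv using Submodule.span_induction with
    | mem v hv =>
      obtain ⟨x, rfl⟩ := hv
      exact Submodule.subset_span ⟨x, rfl⟩
    | zero =>
      convert Submodule.zero_mem _
      ext
      simp
    | add v w _ _ hv hw =>
      convert Submodule.add_mem _ hv hw
      ext
      simp
    | smul r v _ hv =>
      convert Submodule.smul_mem _ (f r) hv
      ext
      simp
  have hspan : Submodule.span K (Set.range k) = ⊤ := by
    rw [eq_top_iff, ← (Pi.basisFun K (Fin n)).span_eq, Submodule.span_le]
    rintro _ ⟨i, rfl⟩
    have hi : Pi.basisFun K (Fin n) i = f ∘ Pi.single i 1 := by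
      ext j
      simp [Pi.single_apply, apply_ite f]
    exact hi ▸ hmem (Pi.single i 1)
  obtain ⟨s, hs, hs', hli⟩ := exists_linearIndependent K (Set.range k)
  let v : Module.Basis s K (Fin n → K) := .mk hli (by simp [hs', hspan])
  let σ : Fin n ≃ s := (Pi.basisFun K (Fin n)).indexEquiv v
  choose b hb using fun i ↦ hs (σ i).2
  refine ⟨b, ?_⟩
  let M : Matrix (Fin n) (Fin n) K := .of fun i ↦ k (b i)
  have hM : M.row = fun i ↦ (σ i : Fin n → K) := funext hb
  have hrow : LinearIndependent K M.row := by
    rw [hM]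
    exact hli.comp σ σ.injective
  rw [Matrix.linearIndependent_rows_iff_isUnit, Matrix.isUnit_iff_isUnit_det] at hrow
  rw [RingHom.map_det]
  exact hrow.ne_zero

lemma isUnit_ι_appTop {T : Scheme.{u}} (f : Γ(T, ⊤)) : IsUnit ((T.basicOpen f).ι.appTop f) := by
  have h : IsUnit (T.presheaf.map (homOfLE (T.basicOpen_le f)).op f) :=
    RingedSpace.isUnit_res_basicOpen _ f
  have hle : (T.basicOpen f).ι ''ᵁ ⊤ ≤ T.basicOpen f := by simp
  have h' : IsUnit (T.presheaf.map (homOfLE hle).op (T.presheaf.map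
    (homOfLE (T.basicOpen_le f)).op f)) := h.map (T.presheaf.map (homOfLE hle).op).hom
  rw [res_res] at h'
  exact h'

lemma mem_basicOpen_of_isUnit_appTop {T T' : Scheme.{u}} (g : T' ⟶ T) {f : Γ(T, ⊤)}
    (hf : IsUnit (g.appTop f)) (z : T') : g z ∈ T.basicOpen f := by
  have : g ⁻¹ᵁ T.basicOpen f = T'.basicOpen (g.appTop f) := Scheme.preimage_basicOpen g f
  change z ∈ g ⁻¹ᵁ T.basicOpen f
  rw [this, T'.basicOpen_of_isUnit hf]
  trivial

section Affine

variable {n : ℕ} {A B : CommRingCat.{u}} (φ : A ⟶ B) (b : Fin n → B)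

/-- The affine scheme parametrizing the closed subschemes for which `b` induces a basis. -/
def framedBase : Over (Spec A) :=
  Over.mk (Spec.map (CommRingCat.ofHom (coordinateRingHom φ.hom b) :
    A ⟶ CommRingCat.of (CoordinateRing φ.hom b)))

lemma exists_universal : ∃ Z : HilbPoints n (Spec.map φ) (framedBase φ b).hom, Z.IsFramed b ∧
      Z.HasCoordinates b fun x i ↦ (Scheme.ΓSpecIso (CommRingCat.of (CoordinateRing φ.hom b))).inv
        (coordinateMap φ.hom b x i) :=
  HilbPoints.exists_of_isCoordinateMap (isCoordinateMap_coordinateMap φ.hom b)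

/-- The universal closed subscheme for which `b` induces a basis. -/
def universal : HilbPoints n (Spec.map φ) (framedBase φ b).hom := (exists_universal φ b).choose

lemma isFramed_universal : (universal φ b).IsFramed b := (exists_universal φ b).choose_spec.1

variable {φ b} {T T' : Scheme.{u}} {t : T ⟶ Spec A} {t' : T' ⟶ Spec A}

lemma hasCoordinates_universal_map (g : T ⟶ (framedBase φ b).left)
    (e : g ≫ (framedBase φ b).hom = t) : ((universal φ b).map g e).HasCoordinates b
      fun x i ↦ sectionsHom (B := CommRingCat.of (CoordinateRing φ.hom b)) g
        (coordinateMap φ.hom b x i) :=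
  (exists_universal φ b).choose_spec.2.map g e

/-- The coordinates of the pulled back universal subscheme are the images of the generators of the
coordinate ring. Coordinates of a framed subscheme are unique, so they determine the classifying
morphism. -/
lemma universal_map_injective {g g' : T ⟶ (framedBase φ b).left}
    (e : g ≫ (framedBase φ b).hom = t) (e' : g' ≫ (framedBase φ b).hom = t)
    (h : (universal φ b).map g e = (universal φ b).map g' e') : g = g' := by
  have hc := hasCoordinates_universal_map g e
  have hc' := hasCoordinates_universal_map g' e'
  have hfr := (isFramed_universal φ b).map g e
  have key := HilbPoints.HasCoordinates.unique hfr hc (h ▸ hc')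
  refine sectionsHom_injective (B := CommRingCat.of (CoordinateRing φ.hom b))
    (coordinateRing_hom_ext ?_ fun x k ↦ congr_fun (congr_fun key x) k)
  ext a
  refine (sectionsHom_comp_SpecMap (B := CommRingCat.of (CoordinateRing φ.hom b)) g
    (CommRingCat.ofHom (coordinateRingHom φ.hom b)) a).symm.trans (.trans ?_
      (sectionsHom_comp_SpecMap (B := CommRingCat.of (CoordinateRing φ.hom b)) g'
        (CommRingCat.ofHom (coordinateRingHom φ.hom b)) a))
  exact congr(sectionsHom $(e.trans e'.symm) a)

/-- The coordinates of `Z` define `g`; the universal subscheme pulled back along `g` has the same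
coordinates, hence equals `Z`. With `universal_map_injective`, `framedBase` represents the framed
subschemes. -/
lemma HilbPoints.isFramed_iff_exists {Z : HilbPoints n (Spec.map φ) t} : Z.IsFramed b ↔
    ∃ (g : T ⟶ (framedBase φ b).left) (e : g ≫ (framedBase φ b).hom = t),
      (universal φ b).map g e = Z := by
  constructor
  · intro h
    obtain ⟨c, hc, hc'⟩ := h.exists_hasCoordinates
    obtain ⟨ψ, hψ, hψ'⟩ := exists_coordinateRing_hom hc
    obtain ⟨g, hg⟩ := sectionsHom_surjective (B := CommRingCat.of (CoordinateRing φ.hom b)) ψ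
    have e : g ≫ (framedBase φ b).hom = t := by
      refine sectionsHom_injective (RingHom.ext fun a ↦ ?_)
      refine (sectionsHom_comp_SpecMap (B := CommRingCat.of (CoordinateRing φ.hom b)) g
        (CommRingCat.ofHom (coordinateRingHom φ.hom b)) a).trans ?_
      rw [hg]
      exact congr($hψ a)
    refine ⟨g, e, ext_of_hasCoordinates ((isFramed_universal φ b).map g e) h ?_ hc'⟩
    have := hasCoordinates_universal_map g e
    rw [hg] at this
    simpa only [hψ'] using this
  · rintro ⟨g, e, rfl⟩
    exact (isFramed_universal φ b).map g e

namespace HilbPoints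

/-- The largest open over which `b` induces a basis. -/
def framedLocus (b : Fin n → B) (Z : HilbPoints n (Spec.map φ) t) : T.Opens :=
  sSup {U | (Z.map U.ι rfl).IsFramed b}

lemma mem_framedLocus {Z : HilbPoints n (Spec.map φ) t} (j : T' ⟶ T) [IsOpenImmersion j]
    (e : j ≫ t = t') (h : (Z.map j e).IsFramed b) (z : T') : j z ∈ Z.framedLocus b := by
  refine Opens.mem_sSup.mpr ⟨j.opensRange, ?_, z, rfl⟩
  have h' := h.map (t' := j.opensRange.ι ≫ t) j.isoOpensRange.inv (by rw [← e]; simp)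
  rw [← map_comp (e'' := by simp)] at h'
  simpa using h'

lemma mem_framedLocus_of_map {Z : HilbPoints n (Spec.map φ) t} (j : T' ⟶ T) [IsOpenImmersion j]
    (e : j ≫ t = t') {z : T'} (h : z ∈ (Z.map j e).framedLocus b) : j z ∈ Z.framedLocus b := by
  obtain ⟨U : T'.Opens, hU, hz⟩ := Opens.mem_sSup.mp h
  have e' : (U.ι ≫ j) ≫ t = U.ι ≫ t' := by rw [Category.assoc, e]
  have hU' : (Z.map (U.ι ≫ j) e').IsFramed b := by
    rw [map_comp j e U.ι rfl]
    exact hU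
  exact mem_framedLocus (U.ι ≫ j) e' hU' ⟨z, hz⟩

variable {Z : HilbPoints n (Spec.map φ) t} {s : Fin n → Γ(Z.ideal.subscheme, ⊤)}
    {M : Matrix (Fin n) (Fin n) Γ(T, ⊤)}

lemma mapHom_eq_linearCombination
    (hb : ∀ i, Z.pull (b i) = linearCombination Z.toBase.appTop.hom s (M i)) (g : T' ⟶ T)
    (e : g ≫ t = t') (i) : (Z.map g e).pull (b i) = linearCombination (Z.map g e).toBase.appTop.hom
      (fun j ↦ (Z.mapHom g e).appTop (s j)) (M.map g.appTop i) := by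
  rw [← mapHom_pull, hb, mapHom_linearCombination]
  rfl

/-- `M` expresses `b` in the frame `s`, and both are compatible with base change; so one determinant
tests framedness after every base change. -/
lemma isFramed_map_iff_isUnit_det (hs : IsFrame Z.toBase s)
    (hb : ∀ i, Z.pull (b i) = linearCombination Z.toBase.appTop.hom s (M i)) (g : T' ⟶ T)
    (e : g ≫ t = t') : (Z.map g e).IsFramed b ↔ IsUnit (g.appTop M.det) := by
  have hs' := hs.of_isPullback (Z.isPullback_mapHom g e)
  have hM : g.appTop M.det = (M.map g.appTop).det := RingHom.map_det g.appTop.hom M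
  rw [hM]
  exact ⟨fun h ↦ hs'.isUnit_det (mapHom_eq_linearCombination hb g e) h,
    fun h ↦ hs'.of_isUnit_det (mapHom_eq_linearCombination hb g e) h⟩

lemma basicOpen_det_le_framedLocus (hs : IsFrame Z.toBase s)
    (hb : ∀ i, Z.pull (b i) = linearCombination Z.toBase.appTop.hom s (M i)) :
    T.basicOpen M.det ≤ Z.framedLocus b :=
  fun z hz ↦ mem_framedLocus (T.basicOpen M.det).ι rfl
    ((isFramed_map_iff_isUnit_det hs hb _ _).mpr (isUnit_ι_appTop _)) ⟨z, hz⟩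

lemma exists_isFrame_restrict (Z : HilbPoints n (Spec.map φ) t) (z : T) :
    ∃ U : T.Opens, IsAffineOpen U ∧ z ∈ U ∧
      ∃ s : Fin n → Γ((Z.map U.ι rfl).ideal.subscheme, ⊤), IsFrame (Z.map U.ι rfl).toBase s := by
  have := Z.isFinite
  obtain ⟨U, hU, hz, h⟩ := Z.isLocallyFree.exists_isFrame z
  exact ⟨U, hU, hz, h (Z.isPullback_mapHom U.ι rfl)⟩

/-- This makes the framed subschemes an open subfunctor. Choose a frame near `g z`: framedness after
base change makes the pulled back determinant a unit, so `g z` lies where the determinant is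
invertible. Conversely, being a frame is local on the base. -/
lemma isFramed_map_iff {Z : HilbPoints n (Spec.map φ) t} (g : T' ⟶ T) (e : g ≫ t = t') :
    (Z.map g e).IsFramed b ↔ ∀ z, g z ∈ Z.framedLocus b := by
  constructor
  · intro h z
    obtain ⟨U, hU, hz, s, hs⟩ := Z.exists_isFrame_restrict (g z)
    choose M hM using fun i ↦ hs.bijective_top.2 ((Z.map U.ι rfl).pull (b i))
    have hw : pullback.snd g U.ι ≫ U.ι ≫ t = pullback.fst g U.ι ≫ t' := by
      rw [← pullback.condition_assoc, e]
    have h' : ((Z.map U.ι rfl).map (pullback.snd g U.ι) hw).IsFramed b := by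
      have := h.map (pullback.fst g U.ι) rfl
      rw [← map_comp (e'' := by rw [Category.assoc, e])] at this
      rw [← map_comp (e'' := by rw [Category.assoc, hw])]
      simpa only [pullback.condition] using this
    obtain ⟨w, hw₁, hw₂⟩ := Scheme.exists_preimage_of_isPullback
      (IsPullback.of_hasPullback g U.ι) z ⟨g z, hz⟩ rfl
    have := basicOpen_det_le_framedLocus hs (fun i ↦ (hM i).symm)
      (mem_basicOpen_of_isUnit_appTop _
        ((isFramed_map_iff_isUnit_det hs (fun i ↦ (hM i).symm) _ hw).mp h') w)
    have := mem_framedLocus_of_map _ _ this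
    rw [hw₂] at this
    exact this
  · intro h
    refine isFrame_of_openCover fun z ↦ ?_
    obtain ⟨U : T.Opens, hU, hz⟩ := Opens.mem_sSup.mp (h z)
    have hw : pullback.snd g U.ι ≫ U.ι ≫ t = pullback.fst g U.ι ≫ t' := by
      rw [← pullback.condition_assoc, e]
    have h' : ((Z.map g e).map (pullback.fst g U.ι) rfl).IsFramed b := by
      have := IsFramed.map hU (pullback.snd g U.ι) hw
      rw [← map_comp (e'' := by rw [Category.assoc, hw])] at this
      rw [← map_comp (e'' := by rw [Category.assoc, e])]
      simpa only [pullback.condition] using this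
    obtain ⟨w, hw₁, -⟩ := Scheme.exists_preimage_of_isPullback
      (IsPullback.of_hasPullback g U.ι) z ⟨g z, hz⟩ rfl
    refine ⟨_, _, pullback.fst g U.ι, _, _, inferInstance,
      (Z.map g e).isPullback_mapHom (pullback.fst g U.ι) rfl, ⟨w, hw₁⟩, ?_⟩
    simp only [mapHom_pull]
    exact h'

/-- As `Z` is closed in the affine scheme `T ×_A B`, its functions are combinations of elements of
`B` with coefficients from `T`. -/
lemma span_range_eq_top [IsAffine T] (hs : IsFrame Z.toBase s) {c : B → Fin n → Γ(T, ⊤)}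
    (hc : ∀ x, Z.pull x = linearCombination Z.toBase.appTop.hom s (c x)) :
    Submodule.span Γ(T, ⊤) (Set.range c) = ⊤ := by
  have key (d : Γ(pullback t (Spec.map φ), ⊤)) : ∃ v ∈ Submodule.span Γ(T, ⊤) (Set.range c),
      Z.ideal.subschemeι.appTop d = linearCombination Z.toBase.appTop.hom s v := by
    refine induction_of_isAffine (motive := fun d ↦ ∃ v ∈ Submodule.span Γ(T, ⊤) (Set.range c),
      Z.ideal.subschemeι.appTop d = linearCombination Z.toBase.appTop.hom s v)
      ⟨0, Submodule.zero_mem _, by simp⟩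
      (fun x ↦ ⟨c x, Submodule.subset_span ⟨x, rfl⟩, ?_⟩) ?_ ?_ d
    · rw [← hc x, appTop_sectionsHom]; rfl
    · rintro r d ⟨v, hv, hv'⟩
      refine ⟨r • v, Submodule.smul_mem _ _ hv, ?_⟩
      rw [map_mul, hv', linearCombination_smul, appTop_subschemeι_fst]
    · rintro d d' ⟨v, hv, hv'⟩ ⟨w, hw, hw'⟩
      exact ⟨v + w, Submodule.add_mem _ hv hw, by rw [map_add, hv', hw', linearCombination_add]⟩
  rw [eq_top_iff]
  rintro v -
  obtain ⟨d, hd⟩ := Z.ideal.subschemeι_app_surjective ⟨⊤, isAffineOpen_top _⟩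
    (linearCombination Z.toBase.appTop.hom s v)
  obtain ⟨w, hw, hw'⟩ := key d
  rwa [hs.bijective_top.1 (hd.symm.trans hw')]

/-- In a local frame, the coordinates of the elements of `B` span, so some tuple has a determinant
that is nonzero in the residue field at `z`, hence invertible near `z`. -/
lemma exists_mem_framedLocus (Z : HilbPoints n (Spec.map φ) t) (z : T) :
    ∃ b, z ∈ Z.framedLocus b := by
  obtain ⟨U, hU, hz, s, hs⟩ := Z.exists_isFrame_restrict z
  have : IsAffine U := hU
  choose c hc using fun x ↦ hs.bijective_top.2 ((Z.map U.ι rfl).pull x)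
  let u : U.toScheme := ⟨z, hz⟩
  obtain ⟨b, hb⟩ := exists_det_ne_zero (K := U.toScheme.residueField u)
    (U.toScheme.evaluation ⊤ u trivial).hom c
    (span_range_eq_top hs fun x ↦ (hc x).symm)
  refine ⟨b, mem_framedLocus_of_map U.ι rfl (z := ⟨z, hz⟩)
    (basicOpen_det_le_framedLocus (M := .of fun i ↦ c (b i)) hs (fun i ↦ (hc (b i)).symm) ?_)⟩
  exact (U.toScheme.evaluation_ne_zero_iff_mem_basicOpen _ _ _).mp hb

end HilbPoints

/-- The Hilbert functor of points of an affine scheme over an affine scheme is representable. -/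
theorem isRepresentable_hilb_SpecMap (n : ℕ) (φ : A ⟶ B) :
    (hilb n (Spec.map φ)).IsRepresentable := by
  have hfr {T : Over (Spec A)} (b : Fin n → B) (Z : HilbPoints n (Spec.map φ) T.hom) :
      (∃ g : T ⟶ framedBase φ b, (hilb n (Spec.map φ)).map g.op (universal φ b) = Z) ↔
        Z.IsFramed b := by
    rw [HilbPoints.isFramed_iff_exists]
    exact ⟨fun ⟨g, hg⟩ ↦ ⟨g.left, Over.w g, hg⟩, fun ⟨g, e, hg⟩ ↦ ⟨Over.homMk g e, hg⟩⟩
  -- The cover is indexed by all `n`-tuples in `B`.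
  refine isRepresentable_of_cover (isZariskiSheaf_hilb _) (framedBase φ) (universal φ) ?_ ?_ ?_
  · intro b T g g' h
    exact Over.OverMorphism.ext (universal_map_injective (Over.w g) (Over.w g') h)
  · intro b T Z
    exact ⟨Z.framedLocus b, fun T' g ↦ (hfr b _).trans (HilbPoints.isFramed_map_iff _ _)⟩
  · intro T Z z
    obtain ⟨b, hb⟩ := Z.exists_mem_framedLocus z
    exact ⟨Z.framedLocus b, hb, b, (hfr b _).mpr ((HilbPoints.isFramed_map_iff _ _).mpr
      fun z ↦ z.2)⟩

end Affine

/-! ### Extension to functors over `S`, and open subschemes of the ambient scheme. -/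

lemma isRepresentable_of_bijective {C : Type*} [Category.{u} C] {G : Cᵒᵖ ⥤ Type u} {X : C}
    (x : G.obj (op X)) (h : ∀ T, Function.Bijective fun f : T ⟶ X ↦ G.map f.op x) :
    G.IsRepresentable :=
  Functor.RepresentableBy.isRepresentable (Y := X)
    { homEquiv := .ofBijective _ (h _)
      homEquiv_comp f g := by
        change G.map (f ≫ g).op x = G.map f.op (G.map g.op x)
        simp }

lemma exists_bijective_of_isRepresentable {C : Type*} [Category.{u} C] {G : Cᵒᵖ ⥤ Type u}
    (hG : G.IsRepresentable) :
    ∃ (X : C) (x : G.obj (op X)), ∀ T, Function.Bijective fun f : T ⟶ X ↦ G.map f.op x := by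
  obtain ⟨X, ⟨e⟩⟩ := hG.has_representation
  refine ⟨X, e.homEquiv (𝟙 X), fun T ↦ ?_⟩
  convert (e.homEquiv (X := T)).bijective with f
  rw [← e.homEquiv_comp, Category.comp_id]

section Ext

variable {n : ℕ} {W U S : Scheme.{u}} {q : W ⟶ U} {i : U ⟶ S}

lemma HilbPoints.sigma_map_eq_iff {T T' : Scheme.{u}} {t' : T' ⟶ S} {h : T ⟶ U} {h' : T' ⟶ U}
    (g : T' ⟶ T) (w : (g ≫ h) ≫ i = t') (w' : h' ≫ i = t') (Z : HilbPoints n q h)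
    (Z' : HilbPoints n q h') :
    (⟨⟨g ≫ h, w⟩, Z.map g rfl⟩ : Σ h : {h : T' ⟶ U // h ≫ i = t'}, HilbPoints n q h.1) =
      ⟨⟨h', w'⟩, Z'⟩ ↔ ∃ e : g ≫ h = h', Z.map g e = Z' := by
  constructor
  · intro H
    obtain rfl : g ≫ h = h' := congr(($H).1.1)
    cases H
    exact ⟨rfl, rfl⟩
  · rintro ⟨e, rfl⟩
    exact sigma_map_eq g e w w' Z

/-- The factorization through `U` is part of a point, so the representing `U`-scheme, viewed over
`S` through `i`, represents the extended functor. -/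
lemma isRepresentable_hilbExt (hq : (hilb n q).IsRepresentable) (i : U ⟶ S) :
    (hilbExt n q i).IsRepresentable := by
  obtain ⟨H, Z, hZ⟩ := exists_bijective_of_isRepresentable hq
  refine isRepresentable_of_bijective (X := Over.mk (H.hom ≫ i)) ⟨⟨H.hom, rfl⟩, Z⟩ fun T ↦ ⟨?_, ?_⟩
  · intro f f' hff'
    have hw : (f'.left ≫ H.hom) ≫ i = T.hom := (Category.assoc _ _ _).trans (Over.w f')
    obtain ⟨e, he⟩ := (HilbPoints.sigma_map_eq_iff f.left
      ((Category.assoc _ _ _).trans (Over.w f)) hw Z (Z.map f'.left rfl)).mp hff'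
    have := (hZ (Over.mk (f'.left ≫ H.hom))).1 (a₁ := Over.homMk f.left e)
      (a₂ := Over.homMk f'.left rfl) he
    exact Over.OverMorphism.ext congr(($this).left)
  · rintro ⟨⟨h, hw⟩, Z'⟩
    obtain ⟨g, hg⟩ := (hZ (Over.mk h)).2 Z'
    refine ⟨Over.homMk g.left (by
      rw [← hw]; exact (Category.assoc _ _ _).symm.trans congr($(Over.w g) ≫ i)), ?_⟩
    exact (HilbPoints.sigma_map_eq_iff g.left _ hw Z Z').mpr ⟨Over.w g, hg⟩

end Ext

/-- Because `f` is a monomorphism, the subscheme of `I`, embedded in `X`, pulls back along `f` to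
itself. -/
lemma comap_map_of_mono {Y X : Scheme.{u}} (I : Y.IdealSheafData) (f : Y ⟶ X) [Mono f]
    [IsClosedImmersion (I.subschemeι ≫ f)] : (I.map f).comap f = I := by
  have h₁ : IsPullback I.subschemeι (𝟙 _) (𝟙 _) I.subschemeι := IsPullback.of_vert_isIso ⟨by simp⟩
  have h₂ : IsPullback (𝟙 Y) (𝟙 Y) f f := IsKernelPair.id_of_mono f
  have h := h₁.paste_horiz h₂
  rw [Category.comp_id] at h
  exact (ker_eq_comap_of_isPullback h).symm.trans I.ker_subschemeι

section Incl

variable {n : ℕ} {W U X S T T' : Scheme.{u}} {q : W ⟶ U} {i : U ⟶ S} {p : X ⟶ S} {j : W ⟶ X}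
  {t : T ⟶ S} {t' : T' ⟶ S}

lemma HilbPoints.incl_injective [Mono j] [IsSeparated p] (w : j ≫ p = q ≫ i) {h : T ⟶ U}
    (e : h ≫ i = t) : Function.Injective (HilbPoints.incl (n := n) w e) := by
  intro Z Z' H
  have := isClosedImmersion_incl w e Z
  have := isClosedImmersion_incl w e Z'
  ext1
  rw [← comap_map_of_mono Z.ideal (inclMap w e), ← comap_map_of_mono Z'.ideal (inclMap w e)]
  exact congr(($H).ideal.comap (inclMap w e))

lemma hilbIncl_app_injective [Mono i] [Mono j] [IsSeparated p] (w : j ≫ p = q ≫ i)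
    (T : (Over S)ᵒᵖ) : Function.Injective ((hilbIncl n w).app T) := by
  rintro ⟨⟨h, e⟩, Z⟩ ⟨⟨h', e'⟩, Z'⟩ H
  obtain rfl : h = h' := (cancel_mono i).mp (e.trans e'.symm)
  obtain rfl := HilbPoints.incl_injective w e H
  rfl

/-- The projection to `T` and `k` give a morphism to `T ×_U W`. It is a closed immersion because its
composite with `inclMap` is the inclusion of `Z`; its kernel is the required ideal. -/
lemma HilbPoints.exists_incl_eq [Mono i] [Mono j] [IsSeparated p] (w : j ≫ p = q ≫ i) {h : T ⟶ U}
    (e : h ≫ i = t) (Z : HilbPoints n p t) (k : Z.ideal.subscheme ⟶ W) (hk : k ≫ j = Z.toTotal) :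
    ∃ Z₀ : HilbPoints n q h, Z₀.incl w e = Z := by
  let f : Z.ideal.subscheme ⟶ pullback h q := pullback.lift Z.toBase k (by
    rw [← cancel_mono i, Category.assoc, Category.assoc, e, ← w, reassoc_of% hk, toBase_comp])
  have hf₁ : f ≫ pullback.fst h q = Z.toBase := pullback.lift_fst _ _ _
  have hf₂ : f ≫ pullback.snd h q = k := pullback.lift_snd _ _ _
  have hf : f ≫ inclMap w e = Z.ideal.subschemeι := by
    apply pullback.hom_ext
    · rw [Category.assoc, inclMap_fst, hf₁]; rfl
    · rw [Category.assoc, inclMap_snd, reassoc_of% hf₂, hk]; rfl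
  have : IsClosedImmersion (f ≫ inclMap w e) := by rw [hf]; infer_instance
  have : IsClosedImmersion f := IsClosedImmersion.of_comp f (inclMap w e)
  obtain ⟨Z₀, hZ₀, -⟩ := exists_of_isClosedImmersion (n := n) f (by rw [hf₁]; exact Z.isFinite)
    (by rw [hf₁]; exact Z.isLocallyFree)
  obtain ⟨k', _, hk'⟩ := exists_comp_eq_ker_subschemeι f
  refine ⟨Z₀, HilbPoints.ext ?_⟩
  change Z₀.ideal.map (inclMap w e) = _
  rw [hZ₀, Scheme.IdealSheafData.map, ← hk', Category.assoc, Scheme.Hom.ker_comp_of_isIso, hf,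
    Scheme.IdealSheafData.ker_subschemeι]

lemma HilbPoints.exists_toTotal_incl [Mono j] [IsSeparated p] (w : j ≫ p = q ≫ i) {h : T ⟶ U}
    (e : h ≫ i = t) (Z : HilbPoints n q h) : ∃ k, (Z.incl w e).toTotal = k ≫ j := by
  have := isClosedImmersion_incl w e Z
  obtain ⟨k, _, hk⟩ := exists_comp_eq_ker_subschemeι (Z.ideal.subschemeι ≫ inclMap w e)
  have h : (Z.ideal.subschemeι ≫ inclMap w e).ker.subschemeι ≫ pullback.snd t p =
      (k ≫ Z.toTotal) ≫ j := by
    rw [← hk, Category.assoc, Category.assoc, inclMap_snd, toTotal]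
    simp only [Category.assoc]
  exact ⟨k ≫ Z.toTotal, h⟩

variable [IsOpenImmersion i] [IsOpenImmersion j]

/-- The open of the base over which a point of the Hilbert functor of `X` over `S` is contained in
the open subscheme `j : W ⟶ X` lying over `i : U ⟶ S`. -/
def includedLocus (i : U ⟶ S) [IsOpenImmersion i] (j : W ⟶ X) [IsOpenImmersion j]
    (Z : HilbPoints n p t) : T.Opens :=
  -- `Z ⟶ T` is finite, hence closed: the points of `T` below the part of `Z` outside `W` form a
  -- closed set, and this set is removed.
  t ⁻¹ᵁ i.opensRange ⊓ ⟨(Z.toBase '' (Z.toTotal ⁻¹ᵁ j.opensRange : Set _)ᶜ)ᶜ,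
    (Z.toBase.isClosedMap _ (Z.toTotal ⁻¹ᵁ j.opensRange).isOpen.isClosed_compl).isOpen_compl⟩

lemma mem_includedLocus_iff (Z : HilbPoints n p t) (z : T) : z ∈ includedLocus i j Z ↔
    t z ∈ i.opensRange ∧ ∀ y, Z.toBase y = z → Z.toTotal y ∈ j.opensRange := by
  refine and_congr Iff.rfl ⟨fun h y hy ↦ ?_, fun h ↦ ?_⟩
  · by_contra H
    exact h ⟨y, H, hy⟩
  · rintro ⟨y, hy, rfl⟩
    exact hy (h y rfl)

variable [IsSeparated p]

/-- Factoring through an open immersion is a condition on points, both for `T ⟶ S` and for the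
projection of `Z` to `X`. -/
lemma mem_range_hilbIncl_iff (w : j ≫ p = q ≫ i) (T : Over S) (Z : HilbPoints n p T.hom) :
    Z ∈ Set.range ((hilbIncl n w).app (op T)) ↔
      (∀ z, T.hom z ∈ i.opensRange) ∧ ∀ y, Z.toTotal y ∈ j.opensRange := by
  constructor
  · rintro ⟨⟨⟨h, e⟩, Z₀⟩, rfl⟩
    change h ≫ i = T.hom at e
    refine ⟨fun z ↦ ⟨h z, congr($e z)⟩, ?_⟩
    change ∀ y, (Z₀.incl w e).toTotal y ∈ j.opensRange
    obtain ⟨k, hk⟩ := Z₀.exists_toTotal_incl w e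
    rw [hk]
    exact fun y ↦ ⟨k y, rfl⟩
  · rintro ⟨h₁, h₂⟩
    let h : T.left ⟶ U := IsOpenImmersion.lift i T.hom (by rintro _ ⟨z, rfl⟩; exact h₁ z)
    have e : h ≫ i = T.hom := IsOpenImmersion.lift_fac _ _ _
    obtain ⟨Z₀, hZ₀⟩ := Z.exists_incl_eq w e
      (IsOpenImmersion.lift j Z.toTotal (by rintro _ ⟨y, rfl⟩; exact h₂ y))
      (IsOpenImmersion.lift_fac _ _ _)
    exact ⟨⟨⟨h, e⟩, Z₀⟩, hZ₀⟩

/-- Every point of `Z` over `g z` lifts to a point over `z` of the base change of `Z`, so the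
condition on the base change only concerns the fibres of `Z` over the image of `g`. -/
lemma map_mem_range_hilbIncl_iff (w : j ≫ p = q ≫ i) {T T' : Over S} (g : T' ⟶ T)
    (Z : HilbPoints n p T.hom) :
    (hilb n p).map g.op Z ∈ Set.range ((hilbIncl n w).app (op T')) ↔
      ∀ z, g.left z ∈ includedLocus i j Z := by
  refine (mem_range_hilbIncl_iff w T' (Z.map g.left (Over.w g))).trans ?_
  have h₁ (z) : T.hom (g.left z) = T'.hom z := congr($(Over.w g) z)
  have h₂ (y) : Z.toTotal (Z.mapHom g.left (Over.w g) y) =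
    (Z.map g.left (Over.w g)).toTotal y := congr($(Z.mapHom_toTotal g.left (Over.w g)) y)
  have H := Z.isPullback_mapHom g.left (Over.w g)
  constructor
  · rintro ⟨ha, hb⟩ z
    refine (mem_includedLocus_iff Z _).mpr ⟨h₁ z ▸ ha z, fun y hy ↦ ?_⟩
    obtain ⟨y', rfl, -⟩ := Scheme.exists_preimage_of_isPullback H y z hy
    rw [h₂]
    exact hb y'
  · intro h
    refine ⟨fun z ↦ h₁ z ▸ ((mem_includedLocus_iff Z _).mp (h z)).1, fun y ↦ ?_⟩
    rw [← h₂]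
    exact ((mem_includedLocus_iff Z _).mp (h _)).2 _ congr($(H.w) y)

lemma isOpenSubfunctor_hilbIncl (w : j ≫ p = q ≫ i) : IsOpenSubfunctor (hilbIncl n w) := by
  constructor
  · have (T : (Over S)ᵒᵖ) : Mono ((hilbIncl n w).app T) :=
      (mono_iff_injective _).mpr (hilbIncl_app_injective w T)
    exact NatTrans.mono_of_mono_app _
  · refine presheaf_of_forall_exists _ _ (hilbIncl_app_injective w) fun T Z ↦ ?_
    let V : T.left.Opens := includedLocus i j Z
    let v : Over.mk (V.ι ≫ T.hom) ⟶ T := Over.homMk V.ι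
    have hv : IsOpenImmersion v.left := inferInstanceAs (IsOpenImmersion V.ι)
    refine ⟨Over.mk (V.ι ≫ T.hom), v, hv, Over.mono_of_mono_left _,
      fun T' g ↦ (map_mem_range_hilbIncl_iff w g Z).trans ?_⟩
    constructor
    · intro h
      have hr : Set.range g.left ⊆ Set.range V.ι := by
        rw [Scheme.Opens.range_ι]
        exact Set.range_subset_iff.mpr h
      refine ⟨Over.homMk (IsOpenImmersion.lift V.ι g.left hr) ?_, ?_⟩
      · exact (IsOpenImmersion.lift_fac_assoc _ _ hr T.hom).trans (Over.w g)
      · exact Over.OverMorphism.ext (IsOpenImmersion.lift_fac _ _ hr)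
    · rintro ⟨h, rfl⟩ z
      exact (h.left z).2

end Incl

/-! ### Covering the Hilbert functor of the relative `Proj`. -/

/-- A Zariski sheaf covered by representable open subfunctors is representable. -/
lemma isRepresentable_of_openSubfunctors {S : Scheme.{u}} {G : (Over S)ᵒᵖ ⥤ Type u}
    (hG : IsZariskiSheaf G) {ι : Type u} (F : ι → (Over S)ᵒᵖ ⥤ Type u)
    (hF : ∀ k, (F k).IsRepresentable) (f : ∀ k, F k ⟶ G)
    (inj : ∀ k T, Function.Injective ((f k).app T))
    (hopen : ∀ k (T : Over S) (y : G.obj (op T)), ∃ V : T.left.Opens, ∀ (T' : Over S) (g : T' ⟶ T),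
      G.map g.op y ∈ Set.range ((f k).app (op T')) ↔ ∀ z, g.left z ∈ V)
    (hcov : ∀ (T : Over S) (y : G.obj (op T)) (t : T.left), ∃ V : T.left.Opens, t ∈ V ∧ ∃ k,
      G.map (Over.homMk V.ι : Over.mk (V.ι ≫ T.hom) ⟶ T).op y ∈
        Set.range ((f k).app (op (Over.mk (V.ι ≫ T.hom))))) :
    G.IsRepresentable := by
  choose X x hx using fun k ↦ exists_bijective_of_isRepresentable (hF k)
  have hnat (k) {T : Over S} (g : T ⟶ X k) :
      (f k).app (op T) ((F k).map g.op (x k)) = G.map g.op ((f k).app _ (x k)) :=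
    congr($((f k).naturality g.op) (x k))
  have hrange (k) {T : Over S} (y : G.obj (op T)) :
      (∃ g : T ⟶ X k, G.map g.op ((f k).app _ (x k)) = y) ↔ y ∈ Set.range ((f k).app (op T)) := by
    constructor
    · rintro ⟨g, rfl⟩
      exact ⟨_, hnat k g⟩
    · rintro ⟨y, rfl⟩
      obtain ⟨g, rfl⟩ := (hx k T).2 y
      exact ⟨g, (hnat k g).symm⟩
  refine isRepresentable_of_cover hG X (fun k ↦ (f k).app _ (x k)) ?_ ?_ ?_
  · intro k T g g' h
    rw [← hnat, ← hnat] at h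
    exact (hx k T).1 (inj k _ h)
  · intro k T y
    obtain ⟨V, hV⟩ := hopen k T y
    exact ⟨V, fun T' g ↦ (hrange k _).trans (hV T' g)⟩
  · intro T y t
    obtain ⟨V, ht, k, hk⟩ := hcov T y t
    exact ⟨V, ht, k, (hrange k _).mpr hk⟩

namespace QCohGradedAlgebra

variable {S : Scheme.{u}} (R : QCohGradedAlgebra S) {n : ℕ}

/-- A finite set of points of the relative `Proj` over a point of an affine open is contained in
one of the affine opens `Spec R_(f)`. -/
lemma exists_subset_opensRange_awayToProj (U : S.AffineZariskiSite) {s : Set R.proj}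
    (hs : s.Finite) (hU : ∀ x ∈ s, R.projToBase x ∈ U.1) :
    ∃ (d : ℕ) (hd : 0 < d) (f : R.sec U.1) (hf : f ∈ R.piece U.1 d),
      ∀ x ∈ s, x ∈ (R.awayToProj U hf hd).opensRange := by
  have hlift (x : s) : ∃ y : Proj (R.piece U.1), R.projChart U y = x := by
    have hx : R.projToBase x ∈ Set.range U.2.fromSpec := by
      rw [U.2.range_fromSpec]
      exact hU x x.2
    obtain ⟨u, hu⟩ := hx
    obtain ⟨y, hy, -⟩ := Scheme.exists_preimage_of_isPullback (R.isPullback_projChart U) x u hu.symm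
    exact ⟨y, hy⟩
  choose y hy using hlift
  have : Finite s := hs
  obtain ⟨d, f, hd, hf, h⟩ := exists_forall_notMem (R.piece U.1) (Set.finite_range y).toFinset
  refine ⟨d, hd, f, hf, fun x hx ↦ ?_⟩
  have hmem : y ⟨x, hx⟩ ∈ (Proj.awayι (R.piece U.1) f hf hd).opensRange := by
    rw [Proj.opensRange_awayι]
    exact h _ ((Set.finite_range y).mem_toFinset.mpr ⟨_, rfl⟩)
  obtain ⟨v, hv⟩ := hmem
  exact ⟨v, congr(R.projChart U $hv).trans (hy ⟨x, hx⟩)⟩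

/-- The fibre of `Z` over `t` is finite and lies over any affine open of `S` containing the image of
`t`, so prime avoidance puts it inside a single `Spec R_(f)`. -/
lemma exists_mem_includedLocus {T : Over S} (Z : HilbPoints n R.projToBase T.hom) (t : T.left) :
    ∃ (U : S.AffineZariskiSite) (d : ℕ) (hd : 0 < d) (f : R.sec U.1) (hf : f ∈ R.piece U.1 d),
      t ∈ includedLocus U.2.fromSpec (R.awayToProj U hf hd) Z := by
  obtain ⟨_, ⟨U, hU, rfl⟩, htU, -⟩ :=
    S.isBasis_affineOpens.exists_subset_of_mem_open (Set.mem_univ (T.hom t)) isOpen_univ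
  let U' : S.AffineZariskiSite := ⟨U, hU⟩
  have hfin : (Z.toBase ⁻¹' {t}).Finite := Z.toBase.finite_preimage_singleton t
  obtain ⟨d, hd, f, hf, h⟩ := R.exists_subset_opensRange_awayToProj U' (hfin.image Z.toTotal) (by
    rintro _ ⟨y, rfl, rfl⟩
    have : T.hom (Z.toBase y) = R.projToBase (Z.toTotal y) := congr($(Z.toBase_comp) y)
    rw [← this]
    exact htU)
  refine ⟨U', d, hd, f, hf, (mem_includedLocus_iff Z t).mpr ⟨?_, fun y hy ↦ h _ ⟨y, hy, rfl⟩⟩⟩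
  rw [hU.opensRange_fromSpec]
  exact htU

lemma map_mem_range_hilbAwayIncl_iff (U : S.AffineZariskiSite) {d : ℕ} (hd : 0 < d) {f : R.sec U.1}
    (hf : f ∈ R.piece U.1 d) {T T' : Over S} (g : T' ⟶ T) (Z : HilbPoints n R.projToBase T.hom) :
    (R.hilbProj n).map g.op Z ∈ Set.range ((R.hilbAwayIncl n U hf hd).app (op T')) ↔
      ∀ z, g.left z ∈ includedLocus U.2.fromSpec (R.awayToProj U hf hd) Z :=
  map_mem_range_hilbIncl_iff (R.awayToProj_projToBase U hf hd) g Z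

lemma exists_map_mem_range_hilbAwayIncl (T : Over S) (Z : (R.hilbProj n).obj (op T)) (t : T.left) :
    ∃ V : T.left.Opens, t ∈ V ∧
      ∃ (U : S.AffineZariskiSite) (d : ℕ) (hd : 0 < d) (f : R.sec U.1) (hf : f ∈ R.piece U.1 d),
        (R.hilbProj n).map (Over.homMk V.ι : Over.mk (V.ι ≫ T.hom) ⟶ T).op Z ∈
          Set.range ((R.hilbAwayIncl n U hf hd).app (op (Over.mk (V.ι ≫ T.hom)))) := by
  obtain ⟨U, d, hd, f, hf, h⟩ := R.exists_mem_includedLocus Z t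
  exact ⟨_, h, U, d, hd, f, hf, (R.map_mem_range_hilbAwayIncl_iff U hd hf _ Z).mpr fun z ↦ z.2⟩

lemma isRepresentable_hilbAway (U : S.AffineZariskiSite) (f : R.sec U.1) :
    (R.hilbAway n U f).IsRepresentable :=
  isRepresentable_hilb_SpecMap n _

lemma isRepresentable_hilbAwayExt (U : S.AffineZariskiSite) (f : R.sec U.1) :
    (R.hilbAwayExt n U f).IsRepresentable :=
  isRepresentable_hilbExt (R.isRepresentable_hilbAway U f) _

lemma isOpenSubfunctor_hilbAwayIncl (U : S.AffineZariskiSite) {d : ℕ} (hd : 0 < d)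
    {f : R.sec U.1} (hf : f ∈ R.piece U.1 d) : IsOpenSubfunctor (R.hilbAwayIncl n U hf hd) :=
  isOpenSubfunctor_hilbIncl _

lemma isRepresentable_hilbProj : (R.hilbProj n).IsRepresentable := by
  -- The degree belongs to the index because a homogeneous element does not determine it: zero has
  -- every degree.
  let ι := Σ U : S.AffineZariskiSite, {f : ℕ × R.sec U.1 // 0 < f.1 ∧ f.2 ∈ R.piece U.1 f.1}
  refine isRepresentable_of_openSubfunctors (isZariskiSheaf_hilb _) (ι := ι)
    (fun k ↦ R.hilbAwayExt n k.1 k.2.1.2) (fun k ↦ R.isRepresentable_hilbAwayExt _ _)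
    (fun k ↦ R.hilbAwayIncl n k.1 k.2.2.2 k.2.2.1) (fun k T ↦ hilbIncl_app_injective _ T) ?_ ?_
  · exact fun k T Z ↦ ⟨_, fun T' g ↦ R.map_mem_range_hilbAwayIncl_iff k.1 k.2.2.1 k.2.2.2 g Z⟩
  · intro T Z t
    obtain ⟨V, ht, U, d, hd, f, hf, h⟩ := R.exists_map_mem_range_hilbAwayIncl T Z t
    exact ⟨V, ht, ⟨U, ⟨d, f⟩, hd, hf⟩, h⟩

end QCohGradedAlgebra

end HilbertPoints

end

/-- Representability of the Hilbert functor of `n` points of the relative `Proj` of a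
quasi-coherent graded algebra, and its cover by the representable open subfunctors of closed
subschemes contained in `Spec R_(f)`, for affine opens `U = Spec A` of `S`, `R = Γ(U, 𝓡)` and
`f : R` homogeneous of positive degree. -/
theorem theorem5p7 {S : Scheme.{u}} (R : HilbertPoints.QCohGradedAlgebra S) (n : ℕ) :
    (R.hilbProj n).IsRepresentable ∧
    (∀ (U : S.AffineZariskiSite) (d : ℕ) (hd : 0 < d) (f : R.sec U.1) (hf : f ∈ R.piece U.1 d),
      (R.hilbAway n U f).IsRepresentable ∧
      (R.hilbAwayExt n U f).IsRepresentable ∧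
      HilbertPoints.IsOpenSubfunctor (R.hilbAwayIncl n U hf hd)) ∧
    (∀ (T : Over S) (Z : (R.hilbProj n).obj (op T)) (t : T.left),
      ∃ V : T.left.Opens, t ∈ V ∧
        ∃ (U : S.AffineZariskiSite) (d : ℕ) (hd : 0 < d) (f : R.sec U.1) (hf : f ∈ R.piece U.1 d),
          (R.hilbProj n).map (Over.homMk V.ι : Over.mk (V.ι ≫ T.hom) ⟶ T).op Z ∈
            Set.range ((R.hilbAwayIncl n U hf hd).app (op (Over.mk (V.ι ≫ T.hom))))) :=
  ⟨R.isRepresentable_hilbProj,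
    fun U _ hd f hf ↦ ⟨R.isRepresentable_hilbAway U f, R.isRepresentable_hilbAwayExt U f,
      R.isOpenSubfunctor_hilbAwayIncl U hd hf⟩,
    R.exists_map_mem_range_hilbAwayIncl⟩
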